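/- **Setting.** Let $\mathbb N=\{1,2,\dots\}$, $\mathbb N_0=\mathbb N\cup\{0\}$, and let $\mathcal F$ be the set of finitely supported sequences $\boldsymbol\nu=(\nu_j)_{j\in\mathbb N}$ in $\mathbb N_0$, ordered componentwise. Let $\gamma_1$ be the standard Gaussian measure on $\mathbb R$, $\gamma_N=\bigotimes_{j=1}^N\gamma_1$, and $\gamma=\bigotimes_{j\in\mathbb N}\gamma_1$ on $U=\mathbb R^{\infty}$. Let $X$ be a complex separable Hilbert space, $\boldsymbol b=(b_j)_{j\in\mathbb N}\in(0,\infty)^\infty$, $\xi>0$, $\delta>0$. *Holomorphy.* $\boldsymbol\rho\in(0,\infty)^N$ is called admissible if $\sum_{j=1}^N b_j\rho_j\le\xi$. A function $u\in L^2(U,X;\gamma)$ is $(\boldsymbol b,\xi,\delta,X)$-holomorphic if there are functions $u_N:\mathbb R^N\to X$ ($N\in\mathbb N$) such that: 1. for every admissible $\boldsymbol\rho\in(0,\infty)^N$, $u_N$ extends holomorphically to $\{\boldsymbol z\in\mathbb C^N:|\operatorname{Im}z_j|<\rho_j\ \forall j\}$, and $u_N(y_1,\dots,y_N)=u_M(y_1,\dots,y_N,0,\dots,0)$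 on $\mathbb R^N$ for all $N<M$; 2. for every $N$ there is $\varphi_N:\mathbb R^N\to[0,\infty)$ with $\|\varphi_N\|_{L^2(\mathbb R^N;\gamma_N)}\le\delta$ and $\|u_N(\boldsymbol y+\boldsymbol z)\|_X\le\varphi_N(\boldsymbol y)$ for all $\boldsymbol y\in\mathbb R^N$, all admissible $\boldsymbol\rho$, and all $\boldsymbol z\in\mathbb C^N$ with $|z_j|<\rho_j$ for all $j$; 3. $\tilde u_N(\boldsymbol y):=u_N(y_1,\dots,y_N)$ satisfies $\|u-\tilde u_N\|_{L^2(U,X;\gamma)}\to0$ as $N\to\infty$. Point values of $u$ are understood as $u(y_1,\dots,y_N,0,0,\dots):=u_N(y_1,\dots,y_N)$, for any fixed such family $(u_N)_{N\in\mathbb N}$. *Quadrature.* For $n\in\mathbb N_0$ let $\chi_{n,0},\dots,\chi_{n,n}$ be the $n+1$ roots of the probabilists' Hermite polynomial of degree $n+1$ (so $\chi_{0,0}=0$), and $\omega_{n,j}=\int_{\mathbb R}\prod_{i\ne j}\frac{y-\chi_{n,i}}{\chi_{n,j}-\chi_{n,i}}\,d\gamma_1(y)$. For $\boldsymbol\nu\in\mathcal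 F$ put $$\mathbf Q_{\boldsymbol\nu}u=\sum_{\boldsymbol\mu\in\mathcal F,\ \boldsymbol\mu\le\boldsymbol\nu}\Big(\prod_{j\in\mathbb N}\omega_{\nu_j,\mu_j}\Big)\,u\big((\chi_{\nu_j,\mu_j})_{j\in\mathbb N}\big),$$ and for a finite set $\Lambda\subseteq\mathcal F$ $$\mathbf Q_\Lambda u=\sum_{\boldsymbol\nu\in\Lambda}\Big(\sum_{\boldsymbol e\in\{0,1\}^{\infty},\ \boldsymbol\nu+\boldsymbol e\in\Lambda}(-1)^{|\boldsymbol e|}\Big)\mathbf Q_{\boldsymbol\nu}u,\qquad \mathrm{pts}(\Lambda)=\{(\chi_{\nu_j,\mu_j})_{j\in\mathbb N}:\boldsymbol\nu\in\Lambda,\ \boldsymbol\mu\le\boldsymbol\nu\}.$$ *Index sets.* For $p\in(0,1)$ with $\boldsymbol b\in\ell^p(\mathbb N)$, $r\in\mathbb N$, $\tau>0$, $K>0$ and $\varepsilon>0$ let $$\varrho_j=b_j^{p-1}\frac{\xi}{4\sqrt{r!}\,\|\boldsymbol b\|_{\ell^p}},\qquad c_{2,\boldsymbol\nu}=\prod_{j:\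 \nu_j\ne0}\max\{1,K\varrho_j\}^{4}\,\nu_j^{\,r-\tau},\qquad \Lambda_{2,\varepsilon}=\{\boldsymbol\nu\in\mathcal F:c_{2,\boldsymbol\nu}^{-1}\ge\varepsilon\}.$$ **Theorem 6.15.** Let $u$ be $(\boldsymbol b,\xi,\delta,X)$-holomorphic with $\boldsymbol b\in\ell^p(\mathbb N)$ for some $p\in(0,4/5)$. Let $\tau>0$, $K>0$, and let $r\in\mathbb N$ be so large that $$\frac{(r-\tau)\,p}{4(1-p)}>\max\{2,\,5-\tau\}$$ (for instance $\tau=3$ and $r>8/p-5$). Then there exists $C>0$ and, for every $n\in\mathbb N$, there exists $\varepsilon_n>0$ such that $\Lambda_{2,\varepsilon_n}$ is finite, $|\mathrm{pts}(\Lambda_{2,\varepsilon_n})|\le n$, and $$\Big\|\int_U u(\boldsymbol y)\,d\gamma(\boldsymbol y)-\mathbf Q_{\Lambda_{2,\varepsilon_n}}u\Big\|_X\le C\,n^{-\frac2p+\frac52}.$$ -/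

import Mathlib

open MeasureTheory ProbabilityTheory Filter Topology

namespace SparseGrid

noncomputable section

/-! ### Gaussian measures -/

/-- The `N`-fold product of the standard Gaussian measure on `ℝ`. -/
def gaussFin (N : ℕ) : Measure (Fin N → ℝ) :=
  Measure.pi fun _ => gaussianReal 0 1

/-- The countable product of the standard Gaussian measure, on `U = ℝ^∞`. -/
def gaussInf : Measure (ℕ → ℝ) :=
  Measure.infinitePi fun _ => gaussianReal 0 1

/-! ### `(b, ξ, δ, X)`-holomorphy -/

/-- The product of strips `{z : |Im z_j| < ρ_j for all j}`. -/
def strip {N : ℕ} (ρ : Fin N → ℝ) : Set (Fin N → ℂ) :=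
  {z | ∀ j, |(z j).im| < ρ j}

/-- The polydisc `{z : |z_j| < ρ_j for all j}`. -/
def polydisc {N : ℕ} (ρ : Fin N → ℝ) : Set (Fin N → ℂ) :=
  {z | ∀ j, ‖z j‖ < ρ j}

/-- `ρ ∈ (0,∞)^N` is `(b, ξ)`-admissible. -/
def Admissible (b : ℕ → ℝ) (ξ : ℝ) {N : ℕ} (ρ : Fin N → ℝ) : Prop :=
  (∀ j, 0 < ρ j) ∧ ∑ j : Fin N, b j * ρ j ≤ ξ

/-- `u ∈ L²(U, X; γ)` is `(b, ξ, δ, X)`-holomorphic, and `v N : ℝ^N → X` (for `N ≥ 1`) are the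
functions of finitely many variables that the definition of this notion asks for. The value
`v 0` is irrelevant. -/
structure HolomorphicWith {X : Type*} [NormedAddCommGroup X] [InnerProductSpace ℂ X]
    (b : ℕ → ℝ) (ξ δ : ℝ) (u : (ℕ → ℝ) → X) (v : (N : ℕ) → (Fin N → ℝ) → X) : Prop where
  memLp : MemLp u 2 gaussInf
  /-- For every admissible `ρ` the function `v N` has a holomorphic extension `V` to the strip,
  and these extensions are all bounded on real translates of the polydiscs by one function `φ`
  with `‖φ‖_{L²} ≤ δ`. -/
  extension : ∀ N : ℕ, 1 ≤ N → ∃ φ : (Fin N → ℝ) → ℝ,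
    (∀ y, 0 ≤ φ y) ∧ MemLp φ 2 (gaussFin N) ∧
    eLpNorm φ 2 (gaussFin N) ≤ ENNReal.ofReal δ ∧
    ∀ ρ : Fin N → ℝ, Admissible b ξ ρ → ∃ V : (Fin N → ℂ) → X,
      DifferentiableOn ℂ V (strip ρ) ∧
      (∀ y : Fin N → ℝ, V (fun j => (y j : ℂ)) = v N y) ∧
      ∀ y : Fin N → ℝ, ∀ z ∈ polydisc ρ, ‖V (fun j => (y j : ℂ) + z j)‖ ≤ φ y
  compatible : ∀ N M : ℕ, 1 ≤ N → N < M → ∀ y : Fin N → ℝ,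
    v N y = v M (fun i => if h : (i : ℕ) < N then y ⟨i, h⟩ else 0)
  tendsto : Tendsto
    (fun N : ℕ => eLpNorm (fun y : ℕ → ℝ => u y - v N (fun i => y i)) 2 gaussInf) atTop (𝓝 0)

/-- The smallest `N ≥ 1` such that all coordinates of `y` with index at least `N` vanish. -/
def activeDim (y : ℕ → ℝ) : ℕ :=
  sInf {N : ℕ | 1 ≤ N ∧ ∀ j, N ≤ j → y j = 0}

/-- Point evaluation at a finitely supported sequence:
`u(y_1, …, y_N, 0, 0, …) := u_N(y_1, …, y_N)`. -/
def pointEval {X : Type*} (v : (N : ℕ) → (Fin N → ℝ) → X) (y : ℕ → ℝ) : X :=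
  v (activeDim y) (fun i => y i)

/-- The point evaluation does not depend on the number of variables that is used for it. -/
theorem HolomorphicWith.pointEval_eq {X : Type*} [NormedAddCommGroup X] [InnerProductSpace ℂ X]
    {b : ℕ → ℝ} {ξ δ : ℝ} {u : (ℕ → ℝ) → X} {v : (N : ℕ) → (Fin N → ℝ) → X}
    (h : HolomorphicWith b ξ δ u v) {y : ℕ → ℝ} {N : ℕ} (hN : 1 ≤ N)
    (hy : ∀ j, N ≤ j → y j = 0) : pointEval v y = v N (fun i => y i) := by
  have hmem : activeDim y ∈ {N : ℕ | 1 ≤ N ∧ ∀ j, N ≤ j → y j = 0} := Nat.sInf_mem ⟨N, hN, hy⟩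
  have hle : activeDim y ≤ N := Nat.sInf_le ⟨hN, hy⟩
  rcases hle.eq_or_lt with heq | hlt
  · unfold pointEval
    rw [heq]
  · unfold pointEval
    rw [h.compatible _ _ hmem.1 hlt]
    congr 1
    funext i
    by_cases hi : (i : ℕ) < activeDim y
    · simp [hi]
    · simp [hi, hmem.2 i (not_lt.mp hi)]

/-! ### Gauss–Hermite points and Smolyak quadrature -/

/-- The normalized probabilistic Hermite polynomial of degree `k`. -/
def hermiteH (k : ℕ) : Polynomial ℝ :=
  Polynomial.C (Real.sqrt (k.factorial : ℝ))⁻¹ *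
    (Polynomial.hermite k).map (Int.castRingHom ℝ)

/-- `node n j`, for `0 ≤ j ≤ n`, are the roots of the Hermite polynomial of degree `n + 1`, in
increasing order. -/
def node (n j : ℕ) : ℝ :=
  ((hermiteH (n + 1)).roots.sort (· ≤ ·)).getD j 0

theorem node_zero_zero : node 0 0 = 0 := by
  simp [node, hermiteH]

/-- The Gauss–Hermite weights `∫ ∏_{i ≠ j} (y - χ_{n,i}) / (χ_{n,j} - χ_{n,i}) dγ₁(y)`. -/
def weight (n j : ℕ) : ℝ :=
  ∫ y, ∏ i ∈ (Finset.range (n + 1)).erase j, (y - node n i) / (node n j - node n i)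
    ∂(gaussianReal 0 1)

/-- The sequence `(χ_{ν_j, μ_j})_j`. -/
def gridPoint (ν μ : ℕ →₀ ℕ) : ℕ → ℝ := fun j => node (ν j) (μ j)

/-- The tensorized quadrature `⨂_j Q_{ν_j}`. The factors with `ν_j = 0` have the weight `1`. -/
def tensorQuad {X : Type*} [AddCommMonoid X] [Module ℝ X]
    (v : (N : ℕ) → (Fin N → ℝ) → X) (ν : ℕ →₀ ℕ) : X :=
  ∑ μ ∈ Finset.Icc 0 ν, (∏ j ∈ ν.support, weight (ν j) (μ j)) • pointEval v (gridPoint ν μ)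

open Classical in
/-- The combination coefficient: the sum of `(-1)^|e|` over the sequences `e` of zeros and ones
with `ν + e ∈ Λ`. The summation variable is `l = ν + e`. -/
def combCoeff (Λ : Finset (ℕ →₀ ℕ)) (ν : ℕ →₀ ℕ) : ℝ :=
  ∑ l ∈ Λ with ν ≤ l ∧ ∀ j, l j ≤ ν j + 1, (-1) ^ (l - ν).degree

/-- The Smolyak quadrature with the index set `Λ`. -/
def smolyakQuad {X : Type*} [AddCommMonoid X] [Module ℝ X]
    (Λ : Finset (ℕ →₀ ℕ)) (v : (N : ℕ) → (Fin N → ℝ) → X) : X :=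
  ∑ ν ∈ Λ, combCoeff Λ ν • tensorQuad v ν

/-- The set of all quadrature points that belong to the index set `Λ`. -/
def pts (Λ : Set (ℕ →₀ ℕ)) : Set (ℕ → ℝ) :=
  {y | ∃ ν ∈ Λ, ∃ μ ≤ ν, y = gridPoint ν μ}

/-! ### The index sets -/

/-- `ϱ_j = b_j^{p-1} ξ / (4 √(r!) ‖b‖_{ℓ^p})`. -/
def rhoSeq (b : ℕ → ℝ) (p ξ : ℝ) (r : ℕ) (j : ℕ) : ℝ :=
  b j ^ (p - 1) * (ξ / (4 * Real.sqrt (r.factorial : ℝ) * (∑' i, b i ^ p) ^ (1 / p)))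

/-- `c_{k,ν} = ∏_{j ∈ supp ν} max{1, K ϱ_j}^{2k} ν_j^{r-τ}`. -/
def cWeight (k : ℕ) (K : ℝ) (ϱ : ℕ → ℝ) (r τ : ℝ) (ν : ℕ →₀ ℕ) : ℝ :=
  ∏ j ∈ ν.support, max 1 (K * ϱ j) ^ (2 * k) * (ν j : ℝ) ^ (r - τ)

/-- `Λ_ε = {ν : c_ν⁻¹ ≥ ε}`. -/
def indexSet (c : (ℕ →₀ ℕ) → ℝ) (ε : ℝ) : Set (ℕ →₀ ℕ) :=
  {ν | ε ≤ (c ν)⁻¹}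

end

end SparseGrid

/-! The error is read off from Hermite expansions. If the Hermite coefficients `c_m` of `u_N` are
absolutely summable, then `u_N` is pointwise the sum of `H_m c_m`, so the quadrature acts termwise
and integral minus quadrature is the sum of `(1_{m=0} - Q_Λ H_m) c_m`. Two ingredients bound this
sum: the action of `Q_Λ` on Hermite polynomials and the decay of `c_m`, both uniformly in `N`.

Action of `Q_Λ`. For a downward closed `Λ` the combination formula (`sum_combCoeff_mul`) turns `Q_Λ`
into the sum over `l ∈ Λ` of the tensor products of the differences `Q_{l_j} - Q_{l_j - 1}`. Gauss
quadrature with `n + 1` nodes is exact up to degree `2n + 1`. Hence `Q_Λ H_m` is exact for `m ∈ Λ`,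
vanishes as soon as some `m_j = 1`, and is otherwise at most the product of `C m_j²` over the
support of `m`. The last bound rests on `exists_abs_quadHermite_le`.

Decay. For each `m` pick an order of differentiation `a(m) ≤ m`. Gaussian integration by parts turns
`c_m` into the coefficient with index `m - a(m)` of `∂^{a(m)} u_N`. Group the indices by `α = a(m)`.
Bessel's inequality for the Hermite system bounds each group by the `L²` norm of `∂^α u_N`, and
Bessel's inequality on circles, one variable after the other, bounds the sum over `α` of `‖ρ^α ∂^α
u_N(y) / α!‖²` by `φ_N(y)²`. No constant depends on `N` (`sum_weight_mul_norm_sq_coeff_le`). Order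
`r` in the variables of large degree and order 2 in those of degree between 2 and `r` give squared
weights with the factor `M_j m_j^r`, up to a constant, where `M_j = max(1, K ϱ_j)^4`. The fourth
power is available because entries equal to 1 do not contribute to the error.

Balance. Put `s = p / (4(1-p))`, so that `s < 1` exactly for `p < 4/5`, and `M_j^{-s}` is at most a
multiple of `b_j^p`. Cauchy–Schwarz bounds the squared error by a sum over `m ∉ Λ`. There `c_{2,m}⁻¹
< ε`, and splitting this quantity into its powers `1 - s` and `s` leaves `ε^{1-s}` times a sum that
is bounded uniformly in `N`. In the same way the number of points is at most `B ε^{-s}`. With `ε =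
(n/B)^{-1/s}` the error is of order `n^{-(1-s)/(2s)}`, and `(1-s)/(2s) = 2/p - 5/2`. Letting `N → ∞`
replaces `u_N` by `u`. -/

namespace SparseGrid

/-! ### Recursions for the normalized Hermite polynomials -/

section HermitePolynomials

open Polynomial

theorem derivative_hermite_succ (n : ℕ) :
    derivative (Polynomial.hermite (n + 1)) = (n + 1 : ℤ[X]) * Polynomial.hermite n := by
  induction n with
  | zero => simp
  | succ n ih =>
    rw [hermite_succ (n + 1), derivative_sub, derivative_mul, ih, derivative_X, derivative_mul,
      hermite_succ n]
    have : derivative ((n : ℤ[X]) + 1) = 0 := by simp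
    rw [this]
    push_cast
    ring

theorem hermiteH_eq (k : ℕ) : hermiteH k = C (Real.sqrt (k.factorial : ℝ))⁻¹ *
    (Polynomial.hermite k).map (Int.castRingHom ℝ) := rfl

@[simp] theorem hermiteH_zero : hermiteH 0 = 1 := by simp [hermiteH]

theorem sqrt_factorial_succ (k : ℕ) :
    Real.sqrt ((k + 1).factorial : ℝ) = Real.sqrt (k + 1) * Real.sqrt (k.factorial : ℝ) := by
  rw [Nat.factorial_succ]
  push_cast
  rw [Real.sqrt_mul (by positivity)]

theorem sqrt_factorial_pos (k : ℕ) : 0 < Real.sqrt (k.factorial : ℝ) :=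
  Real.sqrt_pos.2 (by exact_mod_cast k.factorial_pos)

theorem sqrt_mul_hermiteH_succ (k : ℕ) :
    C (Real.sqrt (k + 1)) * hermiteH (k + 1) = X * hermiteH k - derivative (hermiteH k) := by
  have h : Real.sqrt ((k : ℝ) + 1) * (Real.sqrt ((k + 1).factorial : ℝ))⁻¹ =
      (Real.sqrt (k.factorial : ℝ))⁻¹ := by
    have := sqrt_factorial_pos k
    have h2 : 0 < Real.sqrt ((k : ℝ) + 1) := Real.sqrt_pos.2 (by positivity)
    rw [sqrt_factorial_succ]
    field_simp
  rw [hermiteH_eq, hermiteH_eq, ← mul_assoc, ← C_mul, h, hermite_succ, derivative_C_mul,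
    Polynomial.map_sub, Polynomial.map_mul, Polynomial.map_X, derivative_map]
  ring

theorem derivative_hermiteH_succ (k : ℕ) :
    derivative (hermiteH (k + 1)) = C (Real.sqrt (k + 1)) * hermiteH k := by
  have h : (Real.sqrt ((k + 1).factorial : ℝ))⁻¹ * ((k : ℝ) + 1) =
      Real.sqrt ((k : ℝ) + 1) * (Real.sqrt (k.factorial : ℝ))⁻¹ := by
    have := sqrt_factorial_pos k
    have h2 : 0 < Real.sqrt ((k : ℝ) + 1) := Real.sqrt_pos.2 (by positivity)
    rw [sqrt_factorial_succ]
    field_simp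
    rw [Real.sq_sqrt (by positivity)]
  rw [hermiteH_eq, hermiteH_eq, derivative_C_mul, derivative_map, derivative_hermite_succ,
    ← mul_assoc, ← C_mul, ← h, Polynomial.map_mul, C_mul]
  simp only [Polynomial.map_add, Polynomial.map_natCast, Polynomial.map_one, map_add, map_natCast,
    map_one]
  ring

theorem hermiteH_add_two (k : ℕ) :
    C (Real.sqrt (k + 2)) * hermiteH (k + 2) =
      X * hermiteH (k + 1) - C (Real.sqrt (k + 1)) * hermiteH k := by
  have := sqrt_mul_hermiteH_succ (k + 1)
  rw [derivative_hermiteH_succ] at this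
  rw [← this]
  congr 3
  push_cast
  ring

theorem natDegree_hermiteH (k : ℕ) : (hermiteH k).natDegree = k := by
  rw [hermiteH_eq, natDegree_C_mul (inv_ne_zero (sqrt_factorial_pos k).ne'),
    (hermite_monic k).natDegree_map, natDegree_hermite]

theorem hermiteH_ne_zero (k : ℕ) : hermiteH k ≠ 0 := by
  rw [hermiteH_eq]
  exact mul_ne_zero (C_ne_zero.2 (inv_ne_zero (sqrt_factorial_pos k).ne'))
    ((hermite_monic k).map _).ne_zero

theorem degree_hermiteH (k : ℕ) : (hermiteH k).degree = k := by
  rw [degree_eq_natDegree (hermiteH_ne_zero k), natDegree_hermiteH]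

end HermitePolynomials

/-! ### Pointwise bounds for Hermite polynomials -/

/-- The normalized Hermite polynomial as a function. -/
noncomputable def hermiteFun (m : ℕ) (x : ℝ) : ℝ := (hermiteH m).eval x

@[simp] theorem hermiteFun_zero (x : ℝ) : hermiteFun 0 x = 1 := by simp [hermiteFun]

theorem hermiteFun_one (x : ℝ) : hermiteFun 1 x = x := by
  have := congrArg (Polynomial.eval x) (sqrt_mul_hermiteH_succ 0)
  simpa [hermiteFun] using this

theorem hermiteFun_add_two (k : ℕ) (x : ℝ) :
    Real.sqrt (k + 2) * hermiteFun (k + 2) x =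
      x * hermiteFun (k + 1) x - Real.sqrt (k + 1) * hermiteFun k x := by
  simpa [hermiteFun] using congrArg (Polynomial.eval x) (hermiteH_add_two k)

theorem continuous_hermiteFun (m : ℕ) : Continuous (hermiteFun m) :=
  (hermiteH m).continuous

theorem hasDerivAt_hermiteFun_succ (m : ℕ) (x : ℝ) :
    HasDerivAt (hermiteFun (m + 1)) (Real.sqrt (m + 1) * hermiteFun m x) x := by
  have := (hermiteH (m + 1)).hasDerivAt x
  rw [derivative_hermiteH_succ] at this
  exact this.congr_deriv (by simp [hermiteFun])

theorem hasDerivAt_hermiteFun (m : ℕ) (x : ℝ) :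
    HasDerivAt (hermiteFun m) (x * hermiteFun m x - Real.sqrt (m + 1) * hermiteFun (m + 1) x)
      x := by
  have := (hermiteH m).hasDerivAt x
  have h := congrArg (Polynomial.eval x) (sqrt_mul_hermiteH_succ m)
  simp only [Polynomial.eval_mul, Polynomial.eval_C, Polynomial.eval_sub, Polynomial.eval_X] at h
  refine this.congr_deriv ?_
  simp only [hermiteFun]
  linarith

theorem hermiteFun_neg (m : ℕ) (x : ℝ) : hermiteFun m (-x) = (-1) ^ m * hermiteFun m x := by
  induction m using Nat.strong_induction_on with
  | _ m ih =>
    match m with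
    | 0 => simp
    | 1 => simp [hermiteFun_one]
    | k + 2 =>
      have h1 := hermiteFun_add_two k x
      have h2 := hermiteFun_add_two k (-x)
      rw [ih (k + 1) (by omega), ih k (by omega)] at h2
      have h3 : Real.sqrt ((k : ℝ) + 2) ≠ 0 := (Real.sqrt_pos.2 (by positivity)).ne'
      apply mul_left_cancel₀ h3
      rw [h2]
      calc _ = (-1) ^ k * (x * hermiteFun (k + 1) x - Real.sqrt (k + 1) * hermiteFun k x) := by
            ring
        _ = _ := by rw [← h1]; ring

/-- At `0` the recursion loses its middle term, and each step of length two multiplies the modulus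
by `√(k+1)/√(k+2) ≤ 1`. -/
theorem abs_hermiteFun_zero_le (m : ℕ) : |hermiteFun m 0| ≤ 1 := by
  induction m using Nat.strong_induction_on with
  | _ m ih =>
    match m with
    | 0 => simp
    | 1 => simp [hermiteFun_one]
    | k + 2 =>
      have h1 := congrArg abs (hermiteFun_add_two k 0)
      have h2 := ih k (by omega)
      rw [zero_mul, zero_sub, abs_neg, abs_mul, abs_mul, abs_of_nonneg (Real.sqrt_nonneg _),
        abs_of_nonneg (Real.sqrt_nonneg _)] at h1
      have h3 : Real.sqrt ((k : ℝ) + 1) ≤ Real.sqrt ((k : ℝ) + 2) :=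
        Real.sqrt_le_sqrt (by linarith)
      have h4 : 0 < Real.sqrt ((k : ℝ) + 2) := Real.sqrt_pos.2 (by positivity)
      by_contra! h
      nlinarith [Real.sqrt_nonneg ((k : ℝ) + 1), abs_nonneg (hermiteFun k 0)]

/-- An energy estimate for the oscillator equation that `H_m e^{-x²/4}` satisfies. -/
theorem hermiteFun_sq_mul_le (m : ℕ) {x : ℝ} (hx : 0 ≤ x) :
    ((m : ℝ) + 1 / 2 - x ^ 2 / 4) * hermiteFun m x ^ 2 * Real.exp (-x ^ 2 / 2) ≤
      2 * m + 1 / 2 := by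
  rcases m with _ | m
  · have h1 : Real.exp (-x ^ 2 / 2) ≤ 1 := Real.exp_le_one_iff.2 (by nlinarith)
    have h2 := Real.exp_pos (-x ^ 2 / 2)
    simp only [Nat.cast_zero, hermiteFun_zero]
    nlinarith [sq_nonneg x]
  set s := Real.sqrt ((m : ℝ) + 1) with hs
  have hs2 : s ^ 2 = m + 1 := Real.sq_sqrt (by positivity)
  -- With `w = H_{m+1} e^{-x²/4}`, which solves `w'' + (m + 3/2 - x²/4) w = 0`, this is the energy
  -- `w'² + (m + 3/2 - x²/4) w²`. Its derivative is `-(x/2) w²`, so it decreases for `x ≥ 0` and is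
  -- controlled by its value at `0`.
  let G : ℝ → ℝ := fun x => Real.exp (-x ^ 2 / 2) *
    ((s * hermiteFun m x - x / 2 * hermiteFun (m + 1) x) ^ 2 +
      ((m : ℝ) + 1 + 1 / 2 - x ^ 2 / 4) * hermiteFun (m + 1) x ^ 2)
  have hG : ∀ x, HasDerivAt G (-(x / 2) * hermiteFun (m + 1) x ^ 2 * Real.exp (-x ^ 2 / 2)) x := by
    intro x
    have h1 := hasDerivAt_hermiteFun_succ m x
    have h0 := hasDerivAt_hermiteFun m x
    rw [← hs] at h0 h1
    have hi := hasDerivAt_id x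
    have he : HasDerivAt (fun x : ℝ => Real.exp (-x ^ 2 / 2)) (Real.exp (-x ^ 2 / 2) * (-x)) x := by
      have : HasDerivAt (fun x : ℝ => -x ^ 2 / 2) (-x) x := by
        have := ((hasDerivAt_pow 2 x).neg).div_const 2
        refine this.congr_deriv ?_
        norm_num
        ring
      exact this.exp
    have := he.mul (((((h0.const_mul s).sub ((hi.div_const 2).mul h1)).pow 2)).add
      ((((hasDerivAt_pow 2 x).div_const 4).const_sub ((m : ℝ) + 1 + 1 / 2)).mul (h1.pow 2)))
    refine this.congr_deriv ?_
    simp only [Pi.mul_apply, Pi.sub_apply, id, Pi.pow_apply, Pi.add_apply]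
    push_cast
    have e : (m : ℝ) = s ^ 2 - 1 := by linarith
    rw [e]
    ring
  have hanti : AntitoneOn G (Set.Ici 0) := by
    apply antitoneOn_of_deriv_nonpos (convex_Ici 0)
      (fun x _ => (hG x).continuousAt.continuousWithinAt)
      (fun x _ => (hG x).differentiableAt.differentiableWithinAt)
    intro x hx
    rw [interior_Ici, Set.mem_Ioi] at hx
    rw [(hG x).deriv]
    have := mul_nonneg (mul_nonneg hx.le (sq_nonneg (hermiteFun (m + 1) x)))
      (Real.exp_pos (-x ^ 2 / 2)).le
    linarith
  have h := hanti (Set.mem_Ici.2 le_rfl) (Set.mem_Ici.2 hx) hx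
  have h0 : G 0 ≤ 2 * (m + 1) + 1 / 2 := by
    have a1 := sq_le_one_iff_abs_le_one _ |>.2 (abs_hermiteFun_zero_le m)
    have a2 := sq_le_one_iff_abs_le_one _ |>.2 (abs_hermiteFun_zero_le (m + 1))
    simp only [G]
    norm_num
    rw [mul_pow, hs2]
    nlinarith
  have h1 := mul_nonneg (Real.exp_pos (-x ^ 2 / 2)).le
    (sq_nonneg (s * hermiteFun m x - x / 2 * hermiteFun (m + 1) x))
  simp only [G] at h h0
  push_cast
  nlinarith

/-- In this range the factor `m + 1/2 - x²/4` of the energy estimate is at least `(m+1)/2`, and `(2m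
+ 1/2) / ((m+1)/2) < 4`. -/
theorem abs_hermiteFun_le (m : ℕ) {x : ℝ} (hx : x ^ 2 ≤ 2 * m) :
    |hermiteFun m x| ≤ 2 * Real.exp (x ^ 2 / 4) := by
  wlog h0 : 0 ≤ x generalizing x
  · have := this (x := -x) (by simpa using hx) (by linarith)
    simpa [hermiteFun_neg, abs_mul] using this
  have h := hermiteFun_sq_mul_le m h0
  have hm : (0 : ℝ) ≤ m := Nat.cast_nonneg m
  apply abs_le_of_sq_le_sq _ (by positivity)
  have he : Real.exp (x ^ 2 / 4) ^ 2 * Real.exp (-x ^ 2 / 2) = 1 := by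
    rw [← Real.exp_nat_mul, ← Real.exp_add]
    convert Real.exp_zero using 2
    push_cast
    ring
  have he' := Real.exp_pos (-x ^ 2 / 2)
  rw [mul_pow]
  by_contra! hlt
  have h1 : 4 < hermiteFun m x ^ 2 * Real.exp (-x ^ 2 / 2) := by
    calc (4 : ℝ) = 2 ^ 2 * Real.exp (x ^ 2 / 4) ^ 2 * Real.exp (-x ^ 2 / 2) := by
          rw [mul_assoc, he]; norm_num
      _ < _ := by gcongr
  nlinarith

/-- On bounded intervals all normalized Hermite polynomials have a common bound. -/
theorem exists_abs_hermiteFun_le (R : ℝ) :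
    ∃ C : ℝ, 1 ≤ C ∧ ∀ m x, |x| ≤ R → |hermiteFun m x| ≤ C := by
  -- For `m ≥ M` the whole interval lies in the region `x² ≤ 2m` of the previous bound; the finitely
  -- many smaller degrees are bounded by compactness.
  obtain ⟨M, hM⟩ := exists_nat_ge (R ^ 2)
  have h1 : ∀ m : ℕ, ∃ C : ℝ, ∀ x, |x| ≤ R → |hermiteFun m x| ≤ C := by
    intro m
    obtain ⟨C, hC⟩ := (isCompact_Icc (a := -R) (b := R)).exists_bound_of_continuousOn
      (continuous_hermiteFun m).continuousOn
    exact ⟨C, fun x hx => by simpa using hC x (abs_le.1 hx)⟩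
  choose D hD using h1
  refine ⟨1 + 2 * Real.exp (R ^ 2 / 4) + ∑ m ∈ Finset.range M, |D m|, ?_, ?_⟩
  · have : 0 ≤ ∑ m ∈ Finset.range M, |D m| := Finset.sum_nonneg fun _ _ => abs_nonneg _
    have := Real.exp_pos (R ^ 2 / 4)
    linarith
  intro m x hx
  have hxR : x ^ 2 ≤ R ^ 2 := by
    rw [← sq_abs]; gcongr
  by_cases hm : m < M
  · have := Finset.single_le_sum (f := fun m => |D m|) (fun _ _ => abs_nonneg _)
      (Finset.mem_range.2 hm)
    have h2 := hD m x hx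
    have h3 := le_abs_self (D m)
    have := Real.exp_pos (R ^ 2 / 4)
    linarith
  · have hmM : (M : ℝ) ≤ m := by exact_mod_cast not_lt.1 hm
    have h1 := abs_hermiteFun_le m (x := x) (by nlinarith [sq_nonneg R])
    have : 0 ≤ ∑ m ∈ Finset.range M, |D m| := Finset.sum_nonneg fun _ _ => abs_nonneg _
    have h2 : Real.exp (x ^ 2 / 4) ≤ Real.exp (R ^ 2 / 4) := by gcongr
    linarith

/-! ### Integration by parts and orthonormality in one variable -/

section GaussianIntegrals

open Polynomial

theorem integrable_eval_gaussianReal (P : ℝ[X]) :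
    Integrable (fun x => P.eval x) (gaussianReal 0 1) := by
  induction P using Polynomial.induction_on' with
  | add p q hp hq => simpa [Pi.add_def] using hp.add hq
  | monomial n a =>
    have h1 : MemLp (fun x : ℝ => x) n (gaussianReal 0 1) := memLp_id_gaussianReal (n : NNReal)
    have h2 : Integrable (fun x : ℝ => x ^ n) (gaussianReal 0 1) := by
      rw [← integrable_norm_iff (by fun_prop)]
      simpa using h1.integrable_norm_pow'
    simpa using h2.const_mul a

theorem hasDerivAt_gaussianPDFReal (x : ℝ) :
    HasDerivAt (gaussianPDFReal 0 1) (-x * gaussianPDFReal 0 1 x) x := by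
  have : HasDerivAt (fun x : ℝ => -(x - 0) ^ 2 / (2 * ((1 : NNReal) : ℝ))) (-x) x := by
    have := ((((hasDerivAt_id x).sub_const 0).pow 2).neg).div_const (2 * ((1 : NNReal) : ℝ))
    refine this.congr_deriv ?_
    norm_num
    ring
  have h := (this.exp).const_mul (√(2 * Real.pi * ((1 : NNReal) : ℝ)))⁻¹
  refine h.congr_deriv ?_
  simp only [gaussianPDFReal]
  ring

theorem integrable_gaussianPDFReal_mul_iff {f : ℝ → ℝ} :
    Integrable (fun x => gaussianPDFReal 0 1 x * f x) ↔ Integrable f (gaussianReal 0 1) := by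
  rw [gaussianReal_of_var_ne_zero 0 one_ne_zero]
  have : gaussianPDF 0 1 = fun x => ((gaussianPDFReal 0 1 x).toNNReal : ENNReal) := rfl
  rw [this, integrable_withDensity_iff_integrable_smul
    ((measurable_gaussianPDFReal 0 1).real_toNNReal)]
  refine integrable_congr (ae_of_all _ fun x => ?_)
  simp [NNReal.smul_def, gaussianPDFReal_nonneg]

theorem integral_derivative_gaussianReal (P : ℝ[X]) :
    ∫ x, (derivative P).eval x ∂(gaussianReal 0 1) = ∫ x, (X * P).eval x ∂(gaussianReal 0 1) := by
  rw [integral_gaussianReal_eq_integral_smul one_ne_zero,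
    integral_gaussianReal_eq_integral_smul one_ne_zero, ← sub_eq_zero]
  have h1 := integrable_gaussianPDFReal_mul_iff.2 (integrable_eval_gaussianReal (derivative P))
  have h2 := integrable_gaussianPDFReal_mul_iff.2 (integrable_eval_gaussianReal (X * P))
  have h3 := integrable_gaussianPDFReal_mul_iff.2 (integrable_eval_gaussianReal P)
  simp only [smul_eq_mul]
  rw [← integral_sub h1 h2]
  refine integral_eq_zero_of_hasDerivAt_of_integrable (f := fun x => gaussianPDFReal 0 1 x *
    P.eval x) (fun x => ?_) (h1.sub h2) h3
  refine ((hasDerivAt_gaussianPDFReal x).mul (P.hasDerivAt x)).congr_deriv ?_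
  simp
  ring

/-- `√(m+1) H_{m+1} = x H_m - H_m'` is the Gaussian adjoint of the derivative applied to `H_m`.
Orthogonality to lower degrees and normalization both follow by induction. -/
theorem integral_hermiteH_succ_mul (m : ℕ) (A : ℝ[X]) :
    Real.sqrt (m + 1) * ∫ x, (hermiteH (m + 1) * A).eval x ∂(gaussianReal 0 1) =
      ∫ x, (hermiteH m * derivative A).eval x ∂(gaussianReal 0 1) := by
  have h : C (Real.sqrt (m + 1)) * (hermiteH (m + 1) * A) =
      X * (hermiteH m * A) - derivative (hermiteH m * A) + hermiteH m * derivative A := by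
    rw [← mul_assoc, sqrt_mul_hermiteH_succ, derivative_mul]
    ring
  rw [← integral_const_mul]
  have h' : ∀ x : ℝ, Real.sqrt (m + 1) * (hermiteH (m + 1) * A).eval x =
      (X * (hermiteH m * A)).eval x - (derivative (hermiteH m * A)).eval x +
        (hermiteH m * derivative A).eval x := by
    intro x
    have := congrArg (Polynomial.eval x) h
    rw [eval_add, eval_sub, eval_mul, eval_C] at this
    exact this
  simp_rw [h']
  have hs := (integrable_eval_gaussianReal (X * (hermiteH m * A))).sub
    (integrable_eval_gaussianReal (derivative (hermiteH m * A)))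
  simp only [Pi.sub_def] at hs
  rw [integral_add hs (integrable_eval_gaussianReal _), integral_sub (integrable_eval_gaussianReal _)
    (integrable_eval_gaussianReal _), integral_derivative_gaussianReal]
  ring

theorem integral_hermiteH_mul_eq_zero (m : ℕ) (A : ℝ[X]) (hA : A.degree < m) :
    ∫ x, (hermiteH m * A).eval x ∂(gaussianReal 0 1) = 0 := by
  induction m generalizing A with
  | zero =>
    have : A = 0 := by
      rw [← degree_eq_bot]
      exact Nat.WithBot.lt_zero_iff.1 (by simpa using hA)
    simp [this]
  | succ m ih =>
    have h := integral_hermiteH_succ_mul m A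
    rw [ih (derivative A)] at h
    · exact (mul_eq_zero.1 h).resolve_left (Real.sqrt_pos.2 (by positivity)).ne'
    · by_cases h0 : A = 0
      · simp [h0]
      · by_cases h1 : derivative A = 0
        · rw [h1, degree_zero]; exact WithBot.bot_lt_coe m
        · have h2 := degree_derivative_lt h0
          rw [degree_eq_natDegree h0] at hA h2
          rw [degree_eq_natDegree h1] at h2 ⊢
          norm_cast at *
          omega

theorem integral_hermiteFun_mul (i j : ℕ) :
    ∫ x, hermiteFun i x * hermiteFun j x ∂(gaussianReal 0 1) = if i = j then 1 else 0 := by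
  have e : ∀ i j : ℕ, ∫ x, hermiteFun i x * hermiteFun j x ∂(gaussianReal 0 1) =
      ∫ x, (hermiteH i * hermiteH j).eval x ∂(gaussianReal 0 1) := by
    intro i j; simp [hermiteFun]
  have hlt : ∀ i j : ℕ, i < j →
      ∫ x, hermiteFun j x * hermiteFun i x ∂(gaussianReal 0 1) = 0 := by
    intro i j hij
    rw [e]
    exact integral_hermiteH_mul_eq_zero j _ (by rw [degree_hermiteH]; exact_mod_cast hij)
  rcases lt_trichotomy i j with h | rfl | h
  · simp_rw [mul_comm (hermiteFun i _)]
    rw [hlt i j h, if_neg h.ne]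
  · rw [if_pos rfl]
    induction i with
    | zero => simp
    | succ m ih =>
      have h := integral_hermiteH_succ_mul m (hermiteH (m + 1))
      rw [derivative_hermiteH_succ] at h
      rw [e] at ih ⊢
      have h2 : ∫ x, (hermiteH m * (C (Real.sqrt (m + 1)) * hermiteH m)).eval x
          ∂(gaussianReal 0 1) = Real.sqrt (m + 1) * 1 := by
        rw [← ih, ← integral_const_mul]
        congr 1
        ext x
        simp
        ring
      rw [h2] at h
      exact mul_left_cancel₀ (Real.sqrt_pos.2 (by positivity)).ne' h
  · rw [hlt j i h, if_neg h.ne']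

theorem integral_hermiteFun (m : ℕ) :
    ∫ x, hermiteFun m x ∂(gaussianReal 0 1) = if m = 0 then 1 else 0 := by
  simpa using integral_hermiteFun_mul m 0

end GaussianIntegrals

/-! ### Reality, simplicity and location of the Hermite roots -/

section Roots

open Polynomial

/-- Stated over `ℂ` in order to put `w = conj z` at a root `z` of `H_{n+1}`: the right side
vanishes, while the sum on the left becomes `∑ |H_k(z)|² ≥ 1`. So `z = conj z`. -/
theorem christoffel_darboux (n : ℕ) (z w : ℂ) :
    (z - w) * ∑ k ∈ Finset.range (n + 1), aeval z (hermiteH k) * aeval w (hermiteH k) =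
      (Real.sqrt (n + 1) : ℂ) * (aeval z (hermiteH (n + 1)) * aeval w (hermiteH n) -
        aeval z (hermiteH n) * aeval w (hermiteH (n + 1))) := by
  induction n with
  | zero =>
    have h1 : hermiteH 1 = X := by
      have := sqrt_mul_hermiteH_succ 0
      simpa using this
    simp [h1]
  | succ n ih =>
    rw [Finset.sum_range_succ, mul_add, ih]
    have hz := congrArg (aeval z) (hermiteH_add_two n)
    have hw := congrArg (aeval w) (hermiteH_add_two n)
    simp only [map_mul, map_sub, aeval_C, aeval_X, Complex.coe_algebraMap] at hz hw
    have e : ((n + 1 : ℕ) : ℝ) + 1 = n + 2 := by push_cast; ring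
    rw [e]
    linear_combination (-aeval w (hermiteH (n + 1))) * hz + aeval z (hermiteH (n + 1)) * hw

theorem aeval_conj_real (P : ℝ[X]) (z : ℂ) :
    aeval (starRingEnd ℂ z) P = starRingEnd ℂ (aeval z P) := by
  simpa using (aeval_algHom_apply Complex.conjAe.toAlgHom z P)

theorem im_eq_zero_of_aeval_hermiteH_eq_zero (n : ℕ) {z : ℂ} (h : aeval z (hermiteH n) = 0) :
    z.im = 0 := by
  rcases n with _ | n
  · simp at h
  have hcd := christoffel_darboux n z (starRingEnd ℂ z)
  simp only [aeval_conj_real, h, map_zero, zero_mul, mul_zero, sub_zero, Complex.mul_conj] at hcd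
  rcases mul_eq_zero.1 hcd with h1 | h1
  · exact Complex.conj_eq_iff_im.1 (sub_eq_zero.1 h1).symm
  · exfalso
    rw [← Complex.ofReal_sum] at h1
    have h2 := Complex.ofReal_eq_zero.1 h1
    have := Finset.single_le_sum (f := fun k => Complex.normSq (aeval z (hermiteH k)))
      (fun k _ => Complex.normSq_nonneg _) (Finset.mem_range.2 (Nat.succ_pos n))
    rw [h2] at this
    simp at this
    linarith

theorem eval_hermiteH_ne_zero_of_succ {n : ℕ} {x : ℝ} (h : (hermiteH (n + 1)).eval x = 0) :
    (hermiteH n).eval x ≠ 0 := by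
  induction n with
  | zero => simp
  | succ n ih =>
    intro h1
    have := congrArg (Polynomial.eval x) (hermiteH_add_two n)
    simp only [eval_mul, eval_sub, eval_C, eval_X, h, h1, mul_zero, zero_sub] at this
    have h2 : Real.sqrt ((n : ℝ) + 1) ≠ 0 := (Real.sqrt_pos.2 (by positivity)).ne'
    exact ih h1 ((mul_eq_zero.1 (neg_eq_zero.1 this.symm)).resolve_left h2)

/-- Since `H_{n+1}'` is a multiple of `H_n`, a multiple root would be common to two consecutive
polynomials, and the recursion would carry it down to `H_0 = 1`. -/
theorem nodup_roots_hermiteH (n : ℕ) : (hermiteH n).roots.Nodup := by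
  rcases n with _ | n
  · simp
  rw [Multiset.nodup_iff_count_le_one]
  intro x
  rw [count_roots]
  by_contra! hlt
  have h1 := (one_lt_rootMultiplicity_iff_isRoot (hermiteH_ne_zero (n + 1))).1 hlt
  have h2 := h1.2
  rw [IsRoot.def] at h1 h2
  rw [derivative_hermiteH_succ, eval_mul, eval_C] at h2
  have h3 : Real.sqrt ((n : ℝ) + 1) ≠ 0 := (Real.sqrt_pos.2 (by positivity)).ne'
  exact eval_hermiteH_ne_zero_of_succ h1.1 ((mul_eq_zero.1 h2).resolve_left h3)

theorem card_roots_hermiteH (n : ℕ) : (hermiteH n).roots.card = n := by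
  have h : (hermiteH n).Splits := by
    refine Splits.of_splits_map (algebraMap ℝ ℂ) (IsAlgClosed.splits _) fun z hz => ?_
    have h1 : aeval z (hermiteH n) = 0 := by
      rw [aeval_def, ← eval_map]
      exact (mem_roots'.1 hz).2
    exact ⟨z.re, Complex.ext rfl (by simp [im_eq_zero_of_aeval_hermiteH_eq_zero n h1])⟩
  rw [splits_iff_card_roots.1 h, natDegree_hermiteH]

theorem node_eq_getElem {n j : ℕ} (hj : j < n + 1) :
    node n j = ((hermiteH (n + 1)).roots.sort (· ≤ ·))[j]'(by
      rw [Multiset.length_sort, card_roots_hermiteH]; exact hj) := by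
  rw [node, List.getD_eq_getElem]

theorem eval_node {n j : ℕ} (hj : j ∈ Finset.range (n + 1)) :
    (hermiteH (n + 1)).eval (node n j) = 0 := by
  have : node n j ∈ (hermiteH (n + 1)).roots.sort (· ≤ ·) := by
    rw [node_eq_getElem (Finset.mem_range.1 hj)]
    exact List.getElem_mem _
  rw [Multiset.mem_sort] at this
  exact (mem_roots'.1 this).2

theorem injOn_node (n : ℕ) : Set.InjOn (node n) (Finset.range (n + 1) : Set ℕ) := by
  intro i hi j hj hij
  rw [Finset.mem_coe, Finset.mem_range] at hi hj
  rw [node_eq_getElem hi, node_eq_getElem hj] at hij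
  have hnd : ((hermiteH (n + 1)).roots.sort (· ≤ ·)).Nodup := by
    rw [← Multiset.coe_nodup, Multiset.sort_eq]
    exact nodup_roots_hermiteH _
  exact (List.Nodup.getElem_inj_iff hnd).1 hij

/-- Beyond `2 √n` the polynomial `H_{n+1}` has no zeros. -/
theorem hermiteFun_pos_of_le {n : ℕ} {x : ℝ} (hx0 : 0 < x) (hx : 4 * n ≤ x ^ 2) :
    0 < hermiteFun (n + 1) x := by
  -- The recursion reproduces the ratio bound `√(k+1) H_{k+1} ≥ (x/2) H_k` as long as `x²/4` is at
  -- least the index that occurs, and this bound keeps all signs positive.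
  have key : ∀ k ≤ n, 0 < hermiteFun k x ∧
      x / 2 * hermiteFun k x ≤ Real.sqrt (k + 1) * hermiteFun (k + 1) x := by
    intro k hk
    induction k with
    | zero => simp [hermiteFun_one]; linarith
    | succ k ih =>
      obtain ⟨h1, h2⟩ := ih (by omega)
      have hs : 0 < Real.sqrt ((k : ℝ) + 1) := Real.sqrt_pos.2 (by positivity)
      have h3 : 0 < hermiteFun (k + 1) x := by
        have : 0 < Real.sqrt ((k : ℝ) + 1) * hermiteFun (k + 1) x :=
          lt_of_lt_of_le (by positivity) h2
        exact (pos_iff_pos_of_mul_pos this).1 hs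
      refine ⟨h3, ?_⟩
      have h4 := hermiteFun_add_two k x
      have e : ((k + 1 : ℕ) : ℝ) + 1 = k + 2 := by push_cast; ring
      rw [e, h4]
      have hk' : 4 * ((k : ℝ) + 1) ≤ x ^ 2 := by
        have : ((k + 1 : ℕ) : ℝ) ≤ n := by exact_mod_cast hk
        push_cast at this
        linarith
      have hs2 : Real.sqrt ((k : ℝ) + 1) ^ 2 = k + 1 := Real.sq_sqrt (by positivity)
      set s := Real.sqrt ((k : ℝ) + 1)
      have h5 : s * (x / 2 * hermiteFun k x) ≤ s * (s * hermiteFun (k + 1) x) :=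
        mul_le_mul_of_nonneg_left h2 hs.le
      have h6 : x * (s * hermiteFun k x) ≤ x * (x / 2 * hermiteFun (k + 1) x) := by nlinarith
      have h7 := le_of_mul_le_mul_left h6 hx0
      linarith
  obtain ⟨h1, h2⟩ := key n le_rfl
  have hs : 0 < Real.sqrt ((n : ℝ) + 1) := Real.sqrt_pos.2 (by positivity)
  exact (pos_iff_pos_of_mul_pos (lt_of_lt_of_le (by positivity) h2)).1 hs

theorem node_sq_le {n j : ℕ} (hj : j ∈ Finset.range (n + 1)) : node n j ^ 2 ≤ 4 * n := by
  by_contra! h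
  have h0 : hermiteFun (n + 1) (node n j) = 0 := eval_node hj
  have hne : node n j ≠ 0 := by
    intro h1
    rw [h1] at h
    have : (0 : ℝ) ≤ n := Nat.cast_nonneg n
    norm_num at h
    linarith
  rcases lt_or_gt_of_ne hne with h1 | h1
  · have := hermiteFun_pos_of_le (n := n) (x := -node n j) (by linarith) (by rw [neg_sq]; exact h.le)
    rw [hermiteFun_neg, h0, mul_zero] at this
    exact lt_irrefl _ this
  · exact (hermiteFun_pos_of_le h1 h.le).ne' h0

end Roots

/-! ### Gauss–Hermite quadrature and its values on Hermite polynomials -/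

section GaussQuadrature

open Polynomial

theorem weight_eq_integral_basis (n : ℕ) {j : ℕ} :
    weight n j = ∫ y, (Lagrange.basis (Finset.range (n + 1)) (node n) j).eval y
      ∂(gaussianReal 0 1) := by
  unfold weight
  congr 1
  ext y
  rw [Lagrange.basis, eval_prod]
  refine Finset.prod_congr rfl fun i _ => ?_
  simp [Lagrange.basisDivisor, div_eq_inv_mul]

theorem gaussQuadrature_eq_integral_of_degree_lt (n : ℕ) {P : ℝ[X]} (hP : P.degree < (n + 1 : ℕ)) :
    ∑ j ∈ Finset.range (n + 1), weight n j * P.eval (node n j) =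
      ∫ y, P.eval y ∂(gaussianReal 0 1) := by
  have h := Lagrange.eq_interpolate (injOn_node n) (f := P) (by simpa using hP)
  rw [Lagrange.interpolate_apply] at h
  have h2 : ∀ y : ℝ, P.eval y = ∑ j ∈ Finset.range (n + 1), P.eval (node n j) *
      (Lagrange.basis (Finset.range (n + 1)) (node n) j).eval y := by
    intro y
    conv_lhs => rw [h]
    simp [eval_finsetSum]
  rw [integral_congr_ae (ae_of_all _ h2), integral_finsetSum]
  · refine Finset.sum_congr rfl fun j _ => ?_
    rw [integral_const_mul, weight_eq_integral_basis, mul_comm]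
  · intro j _
    exact (integrable_eval_gaussianReal _).const_mul _

/-- Gauss quadrature with `n + 1` nodes is exact up to the degree `2 n + 1`. -/
theorem gaussQuadrature_eq_integral (n : ℕ) {P : ℝ[X]} (hP : P.natDegree ≤ 2 * n + 1) :
    ∑ j ∈ Finset.range (n + 1), weight n j * P.eval (node n j) =
      ∫ y, P.eval y ∂(gaussianReal 0 1) := by
  have hne := hermiteH_ne_zero (n + 1)
  have hdm := EuclideanDomain.div_add_mod P (hermiteH (n + 1))
  have hmod : (P % hermiteH (n + 1)).degree < (n + 1 : ℕ) := by
    rw [← degree_hermiteH (n + 1)]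
    exact EuclideanDomain.mod_lt P hne
  have hdiv : (P / hermiteH (n + 1)).degree < (n + 1 : ℕ) := by
    by_cases hlt : P.degree < (hermiteH (n + 1)).degree
    · rw [Polynomial.div_eq_zero_iff hne |>.2 hlt, degree_zero]
      exact WithBot.bot_lt_coe _
    · have h1 := degree_add_div hne (not_lt.1 hlt)
      have hP0 : P ≠ 0 := by
        rintro rfl
        apply hlt
        rw [degree_zero, degree_hermiteH]
        exact WithBot.bot_lt_coe _
      have hd0 : P / hermiteH (n + 1) ≠ 0 := by
        intro h0
        exact hlt ((Polynomial.div_eq_zero_iff hne).1 h0)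
      rw [degree_hermiteH, degree_eq_natDegree hd0, degree_eq_natDegree hP0] at h1
      rw [degree_eq_natDegree hd0]
      norm_cast at *
      omega
  calc _ = ∑ j ∈ Finset.range (n + 1), weight n j * (P % hermiteH (n + 1)).eval (node n j) := by
        refine Finset.sum_congr rfl fun j hj => ?_
        conv_lhs => rw [← hdm]
        rw [eval_add, eval_mul, eval_node hj, zero_mul, zero_add]
    _ = _ := by
        rw [gaussQuadrature_eq_integral_of_degree_lt n hmod]
        conv_rhs => rw [← hdm]
        simp_rw [eval_add]
        rw [integral_add (integrable_eval_gaussianReal _) (integrable_eval_gaussianReal _),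
          integral_hermiteH_mul_eq_zero _ _ hdiv, zero_add]

/-- The square of the Lagrange basis polynomial has degree `2n`, is still integrated exactly, and
picks out the single weight. -/
theorem weight_nonneg {n j : ℕ} (hj : j ∈ Finset.range (n + 1)) : 0 ≤ weight n j := by
  set L := Lagrange.basis (Finset.range (n + 1)) (node n) j with hL
  have hdeg : L.natDegree = n := by
    have := Lagrange.degree_basis (injOn_node n) hj
    rw [← hL, Finset.card_range] at this
    exact natDegree_eq_of_degree_eq_some (by simpa using this)
  have h := gaussQuadrature_eq_integral n (P := L ^ 2)
    (by rw [natDegree_pow, hdeg]; omega)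
  rw [Finset.sum_eq_single_of_mem j hj] at h
  · rw [eval_pow, hL, Lagrange.eval_basis_self (injOn_node n) hj, one_pow, mul_one] at h
    rw [h]
    exact integral_nonneg fun y => by simp only [eval_pow]; positivity
  · intro i hi hij
    rw [eval_pow, hL, Lagrange.eval_basis_of_ne hij.symm hi]
    simp

theorem sum_weight (n : ℕ) : ∑ j ∈ Finset.range (n + 1), weight n j = 1 := by
  have := gaussQuadrature_eq_integral n (P := 1) (by simp)
  simpa using this

theorem weight_zero_zero : weight 0 0 = 1 := by simpa using sum_weight 0

/-- The Gauss–Hermite quadrature with `n + 1` nodes of the Hermite polynomial of degree `m`. -/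
noncomputable def quadHermite (n m : ℕ) : ℝ :=
  ∑ j ∈ Finset.range (n + 1), weight n j * hermiteFun m (node n j)

theorem quadHermite_zero_right (n : ℕ) : quadHermite n 0 = 1 := by
  simpa [quadHermite] using sum_weight n

theorem quadHermite_eq_zero {n m : ℕ} (h0 : m ≠ 0) (hm : m ≤ 2 * n + 1) :
    quadHermite n m = 0 := by
  have := gaussQuadrature_eq_integral n (P := hermiteH m) (by rwa [natDegree_hermiteH])
  have h2 := integral_hermiteFun m
  rw [if_neg h0] at h2
  exact this.trans h2

/-- A weak Stirling bound. The induction step is `(1 - 1/(n+1))^(n+1) ≤ e⁻¹`. -/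
theorem exp_mul_factorial_le {n : ℕ} (hn : 1 ≤ n) :
    Real.exp n * n.factorial ≤ Real.exp 1 * n * (n : ℝ) ^ n := by
  induction n, hn using Nat.le_induction with
  | base => simp
  | succ n hn ih =>
    have hn0 : (0 : ℝ) < n := by exact_mod_cast hn
    have h1 : Real.exp 1 * (n : ℝ) ^ (n + 1) ≤ ((n : ℝ) + 1) ^ (n + 1) := by
      have h2 := Real.add_one_le_exp (-1 / ((n : ℝ) + 1))
      have h3 : -1 / ((n : ℝ) + 1) + 1 = n / (n + 1) := by field_simp; ring
      rw [h3] at h2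
      have h4 := pow_le_pow_left₀ (by positivity) h2 (n + 1)
      rw [← Real.exp_nat_mul, div_pow, div_le_iff₀ (by positivity)] at h4
      have h5 : ((n + 1 : ℕ) : ℝ) * (-1 / ((n : ℝ) + 1)) = -1 := by push_cast; field_simp
      rw [h5] at h4
      calc _ ≤ Real.exp 1 * (Real.exp (-1) * ((n : ℝ) + 1) ^ (n + 1)) := by gcongr
        _ = _ := by rw [← mul_assoc, ← Real.exp_add]; simp
    rw [Nat.factorial_succ]
    push_cast
    rw [Real.exp_add]
    calc Real.exp n * Real.exp 1 * (((n : ℝ) + 1) * n.factorial)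
        = Real.exp 1 * (n + 1) * (Real.exp n * n.factorial) := by ring
      _ ≤ Real.exp 1 * (n + 1) * (Real.exp 1 * n * (n : ℝ) ^ n) := by gcongr
      _ = Real.exp 1 * (n + 1) * (Real.exp 1 * (n : ℝ) ^ (n + 1)) := by ring
      _ ≤ _ := by gcongr

/-- A truncated exponential series dominates the exponential up to a linear factor. -/
theorem exp_le_mul_sum_range {n : ℕ} {y : ℝ} (hy0 : 0 ≤ y) (hy : y ≤ n) :
    Real.exp y ≤ Real.exp 1 * (n + 1) * ∑ k ∈ Finset.range (n + 1), y ^ k / k.factorial := by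
  -- The truncated series times `e^{-y}` has derivative `-(y^n / n!) e^{-y}`. Its minimum on `[0,
  -- n]` is therefore at `y = n`, where the last term `n^n / n!` alone is large enough by Stirling.
  let G : ℝ → ℝ := fun y => (∑ k ∈ Finset.range (n + 1), y ^ k / k.factorial) * Real.exp (-y)
  have hS : ∀ m : ℕ, ∀ y : ℝ, HasDerivAt (fun y : ℝ => ∑ k ∈ Finset.range (m + 1), y ^ k / k.factorial)
      (∑ k ∈ Finset.range m, y ^ k / k.factorial) y := by
    intro m y
    induction m with
    | zero => simpa using hasDerivAt_const y (1 : ℝ)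
    | succ m ih =>
      have h1 := ih.add ((hasDerivAt_pow (m + 1) y).div_const ((m + 1).factorial : ℝ))
      rw [Finset.sum_range_succ _ m]
      have e : (fun y : ℝ => ∑ k ∈ Finset.range (m + 1 + 1), y ^ k / (k.factorial : ℝ)) =
          (fun y : ℝ => ∑ k ∈ Finset.range (m + 1), y ^ k / (k.factorial : ℝ)) +
            fun y => y ^ (m + 1) / ((m + 1).factorial : ℝ) := by
        funext y
        rw [Finset.sum_range_succ]
        rfl
      rw [e]
      refine h1.congr_deriv ?_
      rw [Nat.factorial_succ]
      push_cast
      have : (m.factorial : ℝ) ≠ 0 := by positivity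
      field_simp
  have hG : ∀ y, HasDerivAt G (-(y ^ n / n.factorial) * Real.exp (-y)) y := by
    intro y
    have := (hS n y).mul ((hasDerivAt_neg y).exp)
    refine this.congr_deriv ?_
    rw [Finset.sum_range_succ]
    ring
  have hanti : AntitoneOn G (Set.Ici 0) := by
    apply antitoneOn_of_deriv_nonpos (convex_Ici 0)
      (fun x _ => (hG x).continuousAt.continuousWithinAt)
      (fun x _ => (hG x).differentiableAt.differentiableWithinAt)
    intro x hx
    rw [interior_Ici, Set.mem_Ioi] at hx
    rw [(hG x).deriv]
    have : 0 ≤ x ^ n / n.factorial * Real.exp (-x) := by positivity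
    linarith
  have h := hanti (Set.mem_Ici.2 hy0) (Set.mem_Ici.2 (hy0.trans hy)) hy
  have hlow : 1 ≤ Real.exp 1 * (n + 1) * G n := by
    rcases Nat.eq_zero_or_pos n with rfl | hn
    · simp [G]
    have h1 := exp_mul_factorial_le hn
    have h2 : (n : ℝ) ^ n / n.factorial ≤ ∑ k ∈ Finset.range (n + 1), (n : ℝ) ^ k / k.factorial :=
      Finset.single_le_sum (f := fun k => (n : ℝ) ^ k / k.factorial) (fun k _ => by positivity)
        (Finset.self_mem_range_succ n)
    have h3 : Real.exp n ≤ Real.exp 1 * (n + 1) * ((n : ℝ) ^ n / n.factorial) := by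
      rw [mul_div_assoc', le_div_iff₀ (by positivity)]
      refine h1.trans ?_
      gcongr
      linarith
    calc (1 : ℝ) = Real.exp n * Real.exp (-n) := by rw [← Real.exp_add]; simp
      _ ≤ (Real.exp 1 * (n + 1) * ∑ k ∈ Finset.range (n + 1), (n : ℝ) ^ k / k.factorial) *
          Real.exp (-n) := by
        gcongr
        exact h3.trans (by gcongr)
      _ = _ := by simp only [G]; ring
  calc Real.exp y = 1 * Real.exp y := (one_mul _).symm
    _ ≤ (Real.exp 1 * (n + 1) * G y) * Real.exp y := by
      gcongr
      exact hlow.trans (by gcongr)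
    _ = Real.exp 1 * (n + 1) * (∑ k ∈ Finset.range (n + 1), y ^ k / k.factorial) *
        (Real.exp (-y) * Real.exp y) := by simp only [G]; ring
    _ = _ := by rw [← Real.exp_add]; simp

theorem integrable_exp_sq_div_four_gaussianReal :
    Integrable (fun x : ℝ => Real.exp (x ^ 2 / 4)) (gaussianReal 0 1) := by
  rw [← integrable_gaussianPDFReal_mul_iff]
  have := (integrable_exp_neg_mul_sq (b := 1 / 4) (by norm_num)).const_mul
    (√(2 * Real.pi * ((1 : NNReal) : ℝ)))⁻¹
  refine this.congr (ae_of_all _ fun x => ?_)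
  simp only [gaussianPDFReal]
  rw [mul_assoc (√(2 * Real.pi * ((1 : NNReal) : ℝ)))⁻¹, ← Real.exp_add]
  congr 2
  norm_num
  ring

/-- Exactness settles `m ≤ 2n + 1`. For larger `m` all nodes satisfy `x² ≤ 4n ≤ 2m`, so `|H_m| ≤ 2
e^{x²/4}` there. At the nodes, where `x²/4 ≤ n`, this exponential is at most `e (n+1)` times its
Taylor polynomial `P` of degree `2n` in `x`. The weights are nonnegative, `P` is integrated exactly,
and its integral is at most the finite integral of `e^{x²/4}`. -/
theorem exists_abs_quadHermite_le : ∃ C : ℝ, 1 ≤ C ∧ ∀ n m, |quadHermite n m| ≤ C * (m + 1) := by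
  set I := ∫ x : ℝ, Real.exp (x ^ 2 / 4) ∂(gaussianReal 0 1) with hI
  have hI0 : 0 ≤ I := integral_nonneg fun x => (Real.exp_pos _).le
  refine ⟨1 + 2 * Real.exp 1 * I, by have := Real.exp_pos 1; nlinarith [mul_nonneg this.le hI0], ?_⟩
  intro n m
  have hC : 0 ≤ 2 * Real.exp 1 * I := by positivity
  have hm0 : (0 : ℝ) ≤ m := Nat.cast_nonneg m
  by_cases h0 : m = 0
  · rw [h0, quadHermite_zero_right]
    simp
    linarith
  by_cases hm : m ≤ 2 * n + 1
  · rw [quadHermite_eq_zero h0 hm, abs_zero]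
    positivity
  have hmn : 2 * (n : ℝ) + 2 ≤ m := by
    have : 2 * n + 2 ≤ m := by omega
    exact_mod_cast this
  set P : Polynomial ℝ := ∑ k ∈ Finset.range (n + 1),
    C ((k.factorial : ℝ)⁻¹ * (1 / 4) ^ k) * X ^ (2 * k) with hP
  have hPe : ∀ x : ℝ, P.eval x = ∑ k ∈ Finset.range (n + 1), (x ^ 2 / 4) ^ k / k.factorial := by
    intro x
    rw [hP, eval_finsetSum]
    refine Finset.sum_congr rfl fun k _ => ?_
    simp only [eval_mul, eval_C, eval_pow, eval_X]
    rw [pow_mul, div_eq_mul_one_div (x ^ 2), mul_pow]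
    ring
  have hPd : P.natDegree ≤ 2 * n + 1 := by
    refine natDegree_sum_le_of_forall_le _ _ fun k hk => ?_
    refine (natDegree_C_mul_X_pow_le _ _).trans ?_
    have := Finset.mem_range.1 hk
    omega
  have hPI : ∫ x, P.eval x ∂(gaussianReal 0 1) ≤ I := by
    refine integral_mono (integrable_eval_gaussianReal P)
      integrable_exp_sq_div_four_gaussianReal fun x => ?_
    simp only [hPe]
    exact Real.sum_le_exp_of_nonneg (by positivity) _
  calc |quadHermite n m|
      ≤ ∑ j ∈ Finset.range (n + 1), weight n j * |hermiteFun m (node n j)| := by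
        refine (Finset.abs_sum_le_sum_abs _ _).trans_eq (Finset.sum_congr rfl fun j hj => ?_)
        rw [abs_mul, abs_of_nonneg (weight_nonneg hj)]
    _ ≤ ∑ j ∈ Finset.range (n + 1), weight n j *
          (2 * (Real.exp 1 * (n + 1) * P.eval (node n j))) := by
        refine Finset.sum_le_sum fun j hj => mul_le_mul_of_nonneg_left ?_ (weight_nonneg hj)
        have hs := node_sq_le hj
        refine (abs_hermiteFun_le m (by linarith)).trans ?_
        rw [hPe]
        gcongr
        exact exp_le_mul_sum_range (by positivity) (by linarith)
    _ = 2 * (Real.exp 1 * (n + 1)) * ∫ x, P.eval x ∂(gaussianReal 0 1) := by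
        rw [← gaussQuadrature_eq_integral n hPd, Finset.mul_sum]
        exact Finset.sum_congr rfl fun j _ => by ring
    _ ≤ 2 * (Real.exp 1 * (m + 1)) * I := by
        have : (n : ℝ) ≤ m := by linarith
        exact mul_le_mul (by gcongr) hPI (integral_nonneg fun x => by
          simp only [hPe]; positivity) (by positivity)
    _ ≤ _ := by nlinarith

/-- The differences of consecutive quadratures, applied to Hermite polynomials. -/
noncomputable def quadDiff : ℕ → ℕ → ℝ
  | 0, m => quadHermite 0 m
  | k + 1, m => quadHermite (k + 1) m - quadHermite k m

theorem quadDiff_eq_zero_of_lt {k m : ℕ} (h : m < k) : quadDiff k m = 0 := by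
  obtain ⟨k, rfl⟩ : ∃ l, k = l + 1 := ⟨k - 1, by omega⟩
  by_cases h0 : m = 0
  · simp [quadDiff, h0, quadHermite_zero_right]
  · rw [quadDiff, quadHermite_eq_zero h0 (by omega), quadHermite_eq_zero h0 (by omega), sub_zero]

theorem quadDiff_zero_zero : quadDiff 0 0 = 1 := quadHermite_zero_right 0

/-- Even the one-point rule is exact in degree 1. Multi-indices with an entry 1 thus drop out of the
error, which allows two derivatives in every active variable. -/
theorem quadDiff_one_right (k : ℕ) : quadDiff k 1 = 0 := by
  cases k with
  | zero => exact quadHermite_eq_zero one_ne_zero (by omega)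
  | succ k =>
    rw [quadDiff, quadHermite_eq_zero one_ne_zero (by omega),
      quadHermite_eq_zero one_ne_zero (by omega), sub_zero]

theorem sum_quadDiff (n m : ℕ) :
    ∑ k ∈ Finset.range (n + 1), quadDiff k m = quadHermite n m := by
  induction n with
  | zero => simp [quadDiff]
  | succ n ih => rw [Finset.sum_range_succ, ih, quadDiff]; ring

theorem sum_quadDiff_self {m : ℕ} (h0 : m ≠ 0) :
    ∑ k ∈ Finset.range (m + 1), quadDiff k m = 0 := by
  rw [sum_quadDiff, quadHermite_eq_zero h0 (by omega)]

theorem exists_sum_abs_quadDiff_le : ∃ C : ℝ, 1 ≤ C ∧ ∀ m, 1 ≤ m →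
    ∑ k ∈ Finset.range (m + 1), |quadDiff k m| ≤ C * (m : ℝ) ^ 2 := by
  obtain ⟨C, hC1, hC⟩ := exists_abs_quadHermite_le
  refine ⟨8 * C, by linarith, fun m hm => ?_⟩
  have hm' : (1 : ℝ) ≤ m := by exact_mod_cast hm
  have h1 : ∀ k ∈ Finset.range (m + 1), |quadDiff k m| ≤ 4 * C * m := by
    intro k _
    cases k with
    | zero =>
      refine (hC 0 m).trans ?_
      nlinarith
    | succ k =>
      rw [quadDiff]
      refine (abs_sub _ _).trans ?_
      have := hC (k + 1) m
      have := hC k m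
      nlinarith
  refine (Finset.sum_le_sum h1).trans ?_
  rw [Finset.sum_const, Finset.card_range, nsmul_eq_mul]
  push_cast
  have : 0 ≤ C * m * (m - 1) := mul_nonneg (by positivity) (by linarith)
  nlinarith

end GaussQuadrature

/-! ### Bessel's inequality with values in a Hilbert space -/

section Bessel

/-- Bessel's inequality for Hilbert-space valued functions. -/
theorem sum_norm_sq_integral_le {Ω X ι : Type*} [MeasurableSpace Ω] {μ : Measure Ω}
    [NormedAddCommGroup X] [InnerProductSpace ℂ X] [CompleteSpace X] [DecidableEq ι] (s : Finset ι)
    (e : ι → Ω → ℂ)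
    (he : ∀ i ∈ s, MemLp (e i) 2 μ)
    (horth : ∀ i ∈ s, ∀ j ∈ s,
      ∫ ω, starRingEnd ℂ (e i ω) * e j ω ∂μ = if i = j then 1 else 0)
    {g : Ω → X} (hg : MemLp g 2 μ) :
    ∑ i ∈ s, ‖∫ ω, starRingEnd ℂ (e i ω) • g ω ∂μ‖ ^ 2 ≤ ∫ ω, ‖g ω‖ ^ 2 ∂μ := by
  set c : ι → X := fun i => ∫ ω, starRingEnd ℂ (e i ω) • g ω ∂μ with hc
  have hconj : ∀ i ∈ s, MemLp (fun ω => starRingEnd ℂ (e i ω)) 2 μ := fun i hi => (he i hi).star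
  have hint : ∀ i ∈ s, Integrable (fun ω => starRingEnd ℂ (e i ω) • g ω) μ := fun i hi =>
    memLp_one_iff_integrable.1 (hg.smul (hconj i hi))
  have hee : ∀ i ∈ s, ∀ j ∈ s, Integrable (fun ω => starRingEnd ℂ (e i ω) * e j ω) μ :=
    fun i hi j hj => (hconj i hi).integrable_mul (he j hj)
  have h1 : ∀ i ∈ s, Integrable (fun ω => inner ℂ (e i ω • c i) (g ω)) μ := by
    intro i hi
    refine ((hint i hi).const_inner (𝕜 := ℂ) (c i)).congr (ae_of_all _ fun ω => ?_)
    simp only [inner_smul_left, inner_smul_right]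
  have i1 : ∀ i ∈ s, ∫ ω, inner ℂ (e i ω • c i) (g ω) ∂μ = (‖c i‖ : ℂ) ^ 2 := by
    intro i hi
    have e1 : (‖c i‖ : ℂ) ^ 2 = inner ℂ (c i) (∫ ω, starRingEnd ℂ (e i ω) • g ω ∂μ) :=
      (inner_self_eq_norm_sq_to_K (c i)).symm
    rw [e1, ← integral_inner (𝕜 := ℂ) (hint i hi)]
    refine integral_congr_ae (ae_of_all _ fun ω => ?_)
    simp only [inner_smul_left, inner_smul_right]
  have h2 : ∀ i ∈ s, ∀ j ∈ s,
      Integrable (fun ω => inner ℂ (e i ω • c i) (e j ω • c j)) μ := by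
    intro i hi j hj
    refine ((hee i hi j hj).mul_const (inner ℂ (c i) (c j))).congr (ae_of_all _ fun ω => ?_)
    simp only [inner_smul_left, inner_smul_right]
    ring
  have i2 : ∀ i ∈ s, ∀ j ∈ s, ∫ ω, inner ℂ (e i ω • c i) (e j ω • c j) ∂μ =
      if i = j then (‖c i‖ : ℂ) ^ 2 else 0 := by
    intro i hi j hj
    have : ∀ ω, inner ℂ (e i ω • c i) (e j ω • c j) =
        (starRingEnd ℂ (e i ω) * e j ω) * inner ℂ (c i) (c j) := by
      intro ω
      simp only [inner_smul_left, inner_smul_right]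
      ring
    simp_rw [this]
    rw [integral_mul_const, horth i hi j hj]
    split_ifs with hij
    · rw [← hij, one_mul, inner_self_eq_norm_sq_to_K]; rfl
    · rw [zero_mul]
  have hgg : Integrable (fun ω => ‖g ω‖ ^ 2) μ := (memLp_two_iff_integrable_sq_norm hg.1).1 hg
  -- Expand the squared distance from `g` to its projection. The mixed sum and the double sum both
  -- integrate to `∑ ‖c i‖²`.
  have hpt : ∀ ω, ‖g ω - ∑ i ∈ s, e i ω • c i‖ ^ 2 = ‖g ω‖ ^ 2
      - 2 * (∑ i ∈ s, inner ℂ (e i ω • c i) (g ω)).re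
      + (∑ i ∈ s, ∑ j ∈ s, inner ℂ (e i ω • c i) (e j ω • c j)).re := by
    intro ω
    rw [@norm_sub_sq ℂ, ← inner_conj_symm, RCLike.conj_re, sum_inner,
      ← @inner_self_eq_norm_sq ℂ _ _ _ _ (∑ i ∈ s, e i ω • c i), sum_inner]
    simp_rw [inner_sum]
    rfl
  have h3 : Integrable (fun ω => ∑ i ∈ s, inner ℂ (e i ω • c i) (g ω)) μ :=
    integrable_finsetSum _ h1
  have h4 : Integrable
      (fun ω => ∑ i ∈ s, ∑ j ∈ s, inner ℂ (e i ω • c i) (e j ω • c j)) μ :=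
    integrable_finsetSum _ fun i hi => integrable_finsetSum _ fun j hj => h2 i hi j hj
  have h0 : 0 ≤ ∫ ω, ‖g ω - ∑ i ∈ s, e i ω • c i‖ ^ 2 ∂μ :=
    integral_nonneg fun ω => by positivity
  simp_rw [hpt] at h0
  have h3' := h3.re
  have h4' := h4.re
  simp only [RCLike.re_eq_complex_re] at h3' h4'
  have h5 : Integrable (fun ω => ‖g ω‖ ^ 2
      - 2 * (∑ i ∈ s, inner ℂ (e i ω • c i) (g ω)).re) μ := hgg.sub (h3'.const_mul 2)
  rw [integral_add h5 h4', integral_sub hgg (h3'.const_mul 2), integral_const_mul] at h0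
  have j1 : ∫ ω, (∑ i ∈ s, inner ℂ (e i ω • c i) (g ω)).re ∂μ = ∑ i ∈ s, ‖c i‖ ^ 2 := by
    have := integral_re h3
    simp only [RCLike.re_eq_complex_re] at this
    rw [this, integral_finsetSum _ h1, Finset.sum_congr rfl i1]
    norm_cast
  have j2 : ∫ ω, (∑ i ∈ s, ∑ j ∈ s, inner ℂ (e i ω • c i) (e j ω • c j)).re ∂μ =
      ∑ i ∈ s, ‖c i‖ ^ 2 := by
    have := integral_re h4
    simp only [RCLike.re_eq_complex_re] at this
    rw [this, integral_finsetSum _ fun i hi => integrable_finsetSum _ fun j hj => h2 i hi j hj]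
    have : ∀ i ∈ s, ∫ ω, ∑ j ∈ s, inner ℂ (e i ω • c i) (e j ω • c j) ∂μ = (‖c i‖ : ℂ) ^ 2 := by
      intro i hi
      rw [integral_finsetSum _ fun j hj => h2 i hi j hj, Finset.sum_congr rfl (i2 i hi)]
      simp [hi]
    rw [Finset.sum_congr rfl this]
    norm_cast
  rw [j1, j2] at h0
  linarith

end Bessel

/-! ### A class of functions that is closed under products and contained in `L²(γ_N)` -/

section ExpGrowth

variable {N : ℕ}

/-- Continuous functions of at most exponential growth. -/
def ExpGrowth (g : (Fin N → ℝ) → ℝ) : Prop :=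
  Continuous g ∧ ∃ C c : ℝ, 0 ≤ C ∧ 0 ≤ c ∧ ∀ y, |g y| ≤ C * Real.exp (c * ∑ j, |y j|)

theorem ExpGrowth.mul {f g : (Fin N → ℝ) → ℝ} (hf : ExpGrowth f) (hg : ExpGrowth g) :
    ExpGrowth fun y => f y * g y := by
  obtain ⟨hfc, C, c, hC, hc, h⟩ := hf
  obtain ⟨hgc, D, d, hD, hd, h'⟩ := hg
  refine ⟨hfc.mul hgc, C * D, c + d, by positivity, by positivity, fun y => ?_⟩
  rw [abs_mul, add_mul, Real.exp_add]
  calc _ ≤ (C * Real.exp (c * ∑ j, |y j|)) * (D * Real.exp (d * ∑ j, |y j|)) := by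
        gcongr
        exacts [h y, h' y]
    _ = _ := by ring

theorem ExpGrowth.const (a : ℝ) : ExpGrowth fun _ : Fin N → ℝ => a :=
  ⟨continuous_const, |a|, 0, abs_nonneg _, le_rfl, fun y => by simp⟩

theorem ExpGrowth.finset_prod {ι : Type*} (s : Finset ι) {f : ι → (Fin N → ℝ) → ℝ}
    (hf : ∀ i ∈ s, ExpGrowth (f i)) : ExpGrowth fun y => ∏ i ∈ s, f i y := by
  classical
  induction s using Finset.induction_on with
  | empty => simpa using ExpGrowth.const 1
  | insert a s ha ih =>
    simp_rw [Finset.prod_insert ha]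
    exact (hf a (Finset.mem_insert_self a s)).mul
      (ih fun i hi => hf i (Finset.mem_insert_of_mem hi))

theorem ExpGrowth.pow {g : (Fin N → ℝ) → ℝ} (hg : ExpGrowth g) (k : ℕ) :
    ExpGrowth fun y => g y ^ k := by
  simpa using ExpGrowth.finset_prod (Finset.range k) (f := fun _ => g) fun _ _ => hg

theorem ExpGrowth.add {f g : (Fin N → ℝ) → ℝ} (hf : ExpGrowth f) (hg : ExpGrowth g) :
    ExpGrowth fun y => f y + g y := by
  obtain ⟨hfc, C, c, hC, hc, h⟩ := hf
  obtain ⟨hgc, D, d, hD, hd, h'⟩ := hg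
  refine ⟨hfc.add hgc, C + D, c + d, by positivity, by positivity, fun y => ?_⟩
  have hs : 0 ≤ ∑ j, |y j| := Finset.sum_nonneg fun _ _ => abs_nonneg _
  rw [add_mul]
  refine (abs_add_le _ _).trans (add_le_add ((h y).trans ?_) ((h' y).trans ?_))
  · gcongr; linarith
  · gcongr; linarith

theorem ExpGrowth.coord (j : Fin N) : ExpGrowth fun y : Fin N → ℝ => y j := by
  refine ⟨continuous_apply j, 1, 1, zero_le_one, zero_le_one, fun y => ?_⟩
  have h1 := Finset.single_le_sum (f := fun j => |y j|) (fun _ _ => abs_nonneg _)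
    (Finset.mem_univ j)
  have h2 := Real.add_one_le_exp (∑ j, |y j|)
  simp only [one_mul] at *
  linarith

theorem ExpGrowth.finset_sum {ι : Type*} (s : Finset ι) {f : ι → (Fin N → ℝ) → ℝ}
    (hf : ∀ i ∈ s, ExpGrowth (f i)) : ExpGrowth fun y => ∑ i ∈ s, f i y := by
  classical
  induction s using Finset.induction_on with
  | empty => simpa using ExpGrowth.const 0
  | insert a s ha ih =>
    simp_rw [Finset.sum_insert ha]
    exact (hf a (Finset.mem_insert_self a s)).add
      (ih fun i hi => hf i (Finset.mem_insert_of_mem hi))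

theorem ExpGrowth.polynomial (P : Polynomial ℝ) (j : Fin N) :
    ExpGrowth fun y : Fin N → ℝ => P.eval (y j) := by
  simp_rw [Polynomial.eval_eq_sum_range]
  exact ExpGrowth.finset_sum _ fun i _ => (ExpGrowth.const _).mul ((ExpGrowth.coord j).pow i)

theorem ExpGrowth.exp_abs (c : ℝ) (hc : 0 ≤ c) :
    ExpGrowth fun y : Fin N → ℝ => Real.exp (c * ∑ j, |y j|) :=
  ⟨by fun_prop, 1, c, zero_le_one, hc, fun y => by rw [abs_of_pos (Real.exp_pos _), one_mul]⟩

instance : IsProbabilityMeasure (gaussFin N) := by unfold gaussFin; infer_instance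

theorem integrable_exp_abs_gaussFin (c : ℝ) :
    Integrable (fun y : Fin N → ℝ => Real.exp (c * ∑ j, |y j|)) (gaussFin N) := by
  have h1 : Integrable (fun x : ℝ => Real.exp (c * |x|)) (gaussianReal 0 1) := by
    refine ((integrable_exp_mul_gaussianReal c).add (integrable_exp_mul_gaussianReal (-c))).mono'
      (by fun_prop) (ae_of_all _ fun x => ?_)
    rw [Real.norm_eq_abs, abs_of_pos (Real.exp_pos _), Pi.add_apply]
    rcases abs_cases x with ⟨h, _⟩ | ⟨h, _⟩ <;> rw [h]
    · linarith [Real.exp_pos (-c * x)]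
    · rw [show c * -x = -c * x by ring]
      linarith [Real.exp_pos (c * x)]
  have := Integrable.fintype_prod (ι := Fin N) (f := fun _ x => Real.exp (c * |x|)) fun _ => h1
  refine this.congr (ae_of_all _ fun y => ?_)
  simp only
  rw [Finset.mul_sum, Real.exp_sum]

theorem ExpGrowth.memLp {g : (Fin N → ℝ) → ℝ} (hg : ExpGrowth g) :
    MemLp g 2 (gaussFin N) := by
  rw [memLp_two_iff_integrable_sq hg.1.aestronglyMeasurable]
  obtain ⟨hc, C, c, hC, hc0, h⟩ := hg.pow 2
  exact ((integrable_exp_abs_gaussFin c).const_mul C).mono' hc.aestronglyMeasurable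
    (ae_of_all _ h)

end ExpGrowth

/-! ### Orthonormality of tensor product Hermite polynomials -/

section HermiteProd

variable {N : ℕ}

/-- The tensor product Hermite polynomials. -/
noncomputable def hermiteProd (ν : Fin N → ℕ) (y : Fin N → ℝ) : ℝ := ∏ j, hermiteFun (ν j) (y j)

theorem expGrowth_hermiteProd (ν : Fin N → ℕ) : ExpGrowth (hermiteProd ν) :=
  ExpGrowth.finset_prod _ fun j _ => ExpGrowth.polynomial (hermiteH (ν j)) j

@[simp] theorem hermiteProd_zero (y : Fin N → ℝ) : hermiteProd 0 y = 1 := by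
  simp [hermiteProd]

theorem integral_hermiteProd_mul (μ ν : Fin N → ℕ) :
    ∫ y, hermiteProd μ y * hermiteProd ν y ∂(gaussFin N) = if μ = ν then 1 else 0 := by
  simp_rw [hermiteProd, ← Finset.prod_mul_distrib]
  rw [gaussFin, integral_fintype_prod_eq_prod
    (f := fun j x => hermiteFun (μ j) x * hermiteFun (ν j) x)]
  simp_rw [integral_hermiteFun_mul]
  split_ifs with h
  · simp [h]
  · obtain ⟨j, hj⟩ := Function.ne_iff.1 h
    exact Finset.prod_eq_zero (Finset.mem_univ j) (if_neg hj)

theorem sum_norm_sq_integral_hermiteProd_le {X : Type*} [NormedAddCommGroup X]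
    [InnerProductSpace ℂ X] [CompleteSpace X] (s : Finset (Fin N → ℕ)) {g : (Fin N → ℝ) → X}
    (hg : MemLp g 2 (gaussFin N)) :
    ∑ ν ∈ s, ‖∫ y, hermiteProd ν y • g y ∂(gaussFin N)‖ ^ 2 ≤
      ∫ y, ‖g y‖ ^ 2 ∂(gaussFin N) := by
  have := sum_norm_sq_integral_le (μ := gaussFin N) s (fun ν y => (hermiteProd ν y : ℂ))
    (fun ν _ => (expGrowth_hermiteProd ν).memLp.ofReal) (fun μ _ ν _ => by
      simp only [Complex.conj_ofReal]
      norm_cast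
      rw [integral_hermiteProd_mul]
      split_ifs <;> simp) hg
  simpa using this

end HermiteProd

/-! ### The Gaussian density and integration by parts in `N` variables -/

section Density

variable {N : ℕ}

/-- The density of the `N`-dimensional standard Gaussian measure. -/
noncomputable def gaussDensity (y : Fin N → ℝ) : ℝ := ∏ j, gaussianPDFReal 0 1 (y j)

theorem gaussDensity_pos (y : Fin N → ℝ) : 0 < gaussDensity y :=
  Finset.prod_pos fun _ _ => gaussianPDFReal_pos 0 1 _ one_ne_zero

theorem continuous_gaussDensity : Continuous (gaussDensity (N := N)) := by
  unfold gaussDensity gaussianPDFReal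
  fun_prop

theorem gaussFin_eq_withDensity :
    gaussFin N = volume.withDensity fun y => ENNReal.ofReal (gaussDensity y) := by
  refine Measure.pi_eq fun s hs => ?_
  rw [withDensity_apply _ (MeasurableSet.univ_pi hs), ← lintegral_indicator (MeasurableSet.univ_pi hs)]
  have h1 : ∀ y : Fin N → ℝ, (Set.univ.pi s).indicator (fun y => ENNReal.ofReal (gaussDensity y)) y =
      ENNReal.ofReal (∏ j, (s j).indicator (gaussianPDFReal 0 1) (y j)) := by
    intro y
    by_cases hy : y ∈ Set.univ.pi s
    · rw [Set.indicator_of_mem hy, gaussDensity]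
      congr 1
      refine Finset.prod_congr rfl fun j _ => ?_
      rw [Set.indicator_of_mem (hy j (Set.mem_univ j))]
    · rw [Set.indicator_of_notMem hy]
      rw [Set.mem_univ_pi] at hy
      push Not at hy
      obtain ⟨j, hj⟩ := hy
      rw [Finset.prod_eq_zero (Finset.mem_univ j) (Set.indicator_of_notMem hj _),
        ENNReal.ofReal_zero]
  have h2 : ∀ j, Integrable ((s j).indicator (gaussianPDFReal 0 1)) := fun j =>
    (integrable_gaussianPDFReal 0 1).indicator (hs j)
  have h3 : Integrable (fun y : Fin N → ℝ => ∏ j, (s j).indicator (gaussianPDFReal 0 1) (y j)) :=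
    Integrable.fintype_prod h2
  simp_rw [h1]
  rw [← ofReal_integral_eq_lintegral_ofReal h3
    (ae_of_all _ fun y => Finset.prod_nonneg fun j _ =>
      Set.indicator_nonneg (fun x _ => gaussianPDFReal_nonneg 0 1 x) _),
    integral_fintype_prod_volume_eq_prod, ENNReal.ofReal_prod_of_nonneg]
  · refine Finset.prod_congr rfl fun j _ => ?_
    rw [gaussianReal_apply_eq_integral 0 one_ne_zero, integral_indicator (hs j)]
  · exact fun j _ => integral_nonneg fun x =>
      Set.indicator_nonneg (fun x _ => gaussianPDFReal_nonneg 0 1 x) _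

theorem integrable_gaussFin_iff {X : Type*} [NormedAddCommGroup X] [NormedSpace ℝ X]
    {g : (Fin N → ℝ) → X} :
    Integrable g (gaussFin N) ↔ Integrable fun y => gaussDensity y • g y := by
  rw [gaussFin_eq_withDensity]
  have : (fun y : Fin N → ℝ => ENNReal.ofReal (gaussDensity y)) =
    fun y => (((gaussDensity y).toNNReal : NNReal) : ENNReal) := rfl
  rw [this, integrable_withDensity_iff_integrable_smul
    (continuous_gaussDensity.measurable.real_toNNReal)]
  refine integrable_congr (ae_of_all _ fun x => ?_)
  simp [NNReal.smul_def, (gaussDensity_pos x).le]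

theorem integral_gaussFin {X : Type*} [NormedAddCommGroup X] [NormedSpace ℝ X]
    (g : (Fin N → ℝ) → X) :
    ∫ y, g y ∂(gaussFin N) = ∫ y, gaussDensity y • g y := by
  rw [gaussFin_eq_withDensity]
  have : (fun y : Fin N → ℝ => ENNReal.ofReal (gaussDensity y)) =
    fun y => (((gaussDensity y).toNNReal : NNReal) : ENNReal) := rfl
  rw [this, integral_withDensity_eq_integral_smul
    (continuous_gaussDensity.measurable.real_toNNReal)]
  refine integral_congr_ae (ae_of_all _ fun x => ?_)
  simp [NNReal.smul_def, (gaussDensity_pos x).le]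

theorem memLp_two_smul_integrable {X : Type*} [NormedAddCommGroup X] [NormedSpace ℝ X]
    {f : (Fin N → ℝ) → ℝ} {g : (Fin N → ℝ) → X} (hf : ExpGrowth f) (hg : MemLp g 2 (gaussFin N)) :
    Integrable (fun y => f y • g y) (gaussFin N) :=
  memLp_one_iff_integrable.1 (hg.smul hf.memLp)

/-- Rodrigues' formula: with the one-dimensional density `g`, `(g H_m)' = -√(m+1) g H_{m+1}`. The
factors in the other coordinates are constant along the line. -/
theorem hasLineDerivAt_gaussDensity_mul_hermiteProd (μ : Fin N → ℕ) (j : Fin N) (y : Fin N → ℝ) :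
    HasLineDerivAt ℝ (fun y => gaussDensity y * hermiteProd μ y)
      (-(Real.sqrt (μ j + 1) * (gaussDensity y * hermiteProd (μ + Pi.single j 1) y))) y
      (Pi.single j 1) := by
  let w : ℕ → ℝ → ℝ := fun m x => gaussianPDFReal 0 1 x * hermiteFun m x
  have hw : ∀ m x, HasDerivAt (w m) (-(Real.sqrt (m + 1) * w (m + 1) x)) x := by
    intro m x
    refine ((hasDerivAt_gaussianPDFReal x).mul (hasDerivAt_hermiteFun m x)).congr_deriv ?_
    simp only [w]
    ring
  have he : ∀ (ν : Fin N → ℕ) y, gaussDensity y * hermiteProd ν y =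
      w (ν j) (y j) * ∏ i ∈ Finset.univ.erase j, w (ν i) (y i) := by
    intro ν y
    rw [gaussDensity, hermiteProd, ← Finset.prod_mul_distrib,
      ← Finset.mul_prod_erase _ _ (Finset.mem_univ j)]
  unfold HasLineDerivAt
  simp_rw [he]
  have h1 : ∀ t : ℝ, ∏ i ∈ Finset.univ.erase j, w (μ i) ((y + t • (Pi.single j 1 : Fin N → ℝ)) i) =
      ∏ i ∈ Finset.univ.erase j, w (μ i) (y i) := by
    intro t
    refine Finset.prod_congr rfl fun i hi => ?_
    simp [Finset.ne_of_mem_erase hi]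
  have h2 : ∏ i ∈ Finset.univ.erase j, w ((μ + (Pi.single j 1 : Fin N → ℕ)) i) (y i) =
      ∏ i ∈ Finset.univ.erase j, w (μ i) (y i) := by
    refine Finset.prod_congr rfl fun i hi => ?_
    simp [Finset.ne_of_mem_erase hi]
  simp_rw [h1]
  rw [h2]
  have h3 : HasDerivAt (fun t : ℝ => w (μ j) (y j + t)) (-(Real.sqrt (μ j + 1) *
      w (μ j + 1) (y j))) 0 := by
    have := hw (μ j) (y j + 0)
    have h := this.comp_const_add (y j) 0
    simpa using h
  have h4 := h3.mul_const (∏ i ∈ Finset.univ.erase j, w (μ i) (y i))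
  refine (h4.congr_deriv ?_).congr_of_eventuallyEq (Eventually.of_forall fun t => ?_)
  · simp
    ring
  · simp

/-- Gaussian integration by parts in the coordinate `j`. -/
theorem integral_hermiteProd_smul_lineDeriv {X : Type*} [NormedAddCommGroup X] [NormedSpace ℝ X]
    {g g' : (Fin N → ℝ) → X} (j : Fin N)
    (hg : MemLp g 2 (gaussFin N)) (hg' : MemLp g' 2 (gaussFin N))
    (hd : ∀ y, HasLineDerivAt ℝ g (g' y) y (Pi.single j 1)) (μ : Fin N → ℕ) :
    ∫ y, hermiteProd μ y • g' y ∂(gaussFin N) =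
      Real.sqrt (μ j + 1) • ∫ y, hermiteProd (μ + Pi.single j 1) y • g y ∂(gaussFin N) := by
  have hI : ∀ (ν : Fin N → ℕ) {h : (Fin N → ℝ) → X}, MemLp h 2 (gaussFin N) →
      Integrable fun y => (gaussDensity y * hermiteProd ν y) • h y := by
    intro ν h hh
    simp_rw [mul_smul]
    exact integrable_gaussFin_iff.1 (memLp_two_smul_integrable (expGrowth_hermiteProd ν) hh)
  have key := integral_bilinear_hasLineDerivAt_right_eq_neg_left_of_integrable
    (μ := (volume : Measure (Fin N → ℝ))) (f := g) (f' := g')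
    (g := fun y => gaussDensity y * hermiteProd μ y)
    (g' := fun y => -(Real.sqrt (μ j + 1) * (gaussDensity y * hermiteProd (μ + Pi.single j 1) y)))
    (v := Pi.single j 1) (B := (ContinuousLinearMap.lsmul ℝ ℝ (E := X)).flip)
    (by simpa using hI μ hg') (by
      have := ((hI (μ + Pi.single j 1) hg).smul (Real.sqrt (μ j + 1))).neg
      refine this.congr (ae_of_all _ fun y => ?_)
      simp [smul_smul]) (by simpa using hI μ hg)
    (fun y _ => hd y) (fun y _ => hasLineDerivAt_gaussDensity_mul_hermiteProd μ j y)
  simp only [ContinuousLinearMap.flip_apply, ContinuousLinearMap.lsmul_apply, neg_smul] at key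
  rw [integral_neg, neg_inj] at key
  rw [integral_gaussFin, integral_gaussFin, ← integral_smul]
  simp_rw [smul_smul]
  rw [← key]

end Density

/-! ### Completeness of the Hermite system by Fourier inversion -/

section Completeness

open FourierTransform

variable {N : ℕ}

theorem mul_hermiteFun (m : ℕ) (x : ℝ) :
    x * hermiteFun m x =
      Real.sqrt (m + 1) * hermiteFun (m + 1) x + Real.sqrt m * hermiteFun (m - 1) x := by
  cases m with
  | zero => simp [hermiteFun_one]
  | succ k =>
    have := hermiteFun_add_two k x
    push_cast
    rw [show (k : ℝ) + 1 + 1 = k + 2 by ring, this]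
    simp

theorem hermiteProd_update (ν : Fin N → ℕ) (j : Fin N) (m : ℕ) (y : Fin N → ℝ) :
    hermiteProd (Function.update ν j m) y =
      hermiteFun m (y j) * ∏ i ∈ Finset.univ.erase j, hermiteFun (ν i) (y i) := by
  rw [hermiteProd, ← Finset.mul_prod_erase _ _ (Finset.mem_univ j), Function.update_self]
  congr 1
  refine Finset.prod_congr rfl fun i hi => ?_
  rw [Function.update_of_ne (Finset.ne_of_mem_erase hi)]

theorem mul_hermiteProd (ν : Fin N → ℕ) (j : Fin N) (y : Fin N → ℝ) :
    y j * hermiteProd ν y = Real.sqrt (ν j + 1) * hermiteProd (Function.update ν j (ν j + 1)) y +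
      Real.sqrt (ν j) * hermiteProd (Function.update ν j (ν j - 1)) y := by
  have := hermiteProd_update ν j (ν j) y
  rw [Function.update_eq_self] at this
  rw [this, hermiteProd_update, hermiteProd_update, ← mul_assoc, mul_hermiteFun]
  ring

variable {X : Type*} [NormedAddCommGroup X]

theorem expGrowth_linear (t : Fin N → ℝ) : ExpGrowth fun y : Fin N → ℝ => ∑ j, t j * y j :=
  ExpGrowth.finset_sum _ fun j _ => (ExpGrowth.const (t j)).mul (ExpGrowth.coord j)

/-- By the three-term recurrence, multiplication by a linear form maps a Hermite product to a
combination of Hermite products. Keeping `ν` arbitrary makes the induction on the power close. -/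
theorem integral_pow_mul_hermiteProd_eq_zero [NormedSpace ℝ X] {f : (Fin N → ℝ) → X}
    (hf : MemLp f 2 (gaussFin N))
    (h0 : ∀ ν, ∫ y, hermiteProd ν y • f y ∂(gaussFin N) = 0) (t : Fin N → ℝ) (k : ℕ)
    (ν : Fin N → ℕ) :
    ∫ y, ((∑ j, t j * y j) ^ k * hermiteProd ν y) • f y ∂(gaussFin N) = 0 := by
  induction k generalizing ν with
  | zero => simpa using h0 ν
  | succ k ih =>
    have hi : ∀ μ : Fin N → ℕ,
        Integrable (fun y => ((∑ j, t j * y j) ^ k * hermiteProd μ y) • f y) (gaussFin N) :=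
      fun μ => memLp_two_smul_integrable
        (((expGrowth_linear t).pow k).mul (expGrowth_hermiteProd μ)) hf
    have he : ∀ y : Fin N → ℝ, ((∑ j, t j * y j) ^ (k + 1) * hermiteProd ν y) • f y =
        ∑ j, ((t j * Real.sqrt (ν j + 1)) • (((∑ j, t j * y j) ^ k *
          hermiteProd (Function.update ν j (ν j + 1)) y) • f y) +
          (t j * Real.sqrt (ν j)) • (((∑ j, t j * y j) ^ k *
          hermiteProd (Function.update ν j (ν j - 1)) y) • f y)) := by
      intro y
      simp_rw [smul_smul, ← add_smul, ← Finset.sum_smul]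
      congr 1
      rw [pow_succ, mul_assoc, Finset.sum_mul, Finset.mul_sum]
      refine Finset.sum_congr rfl fun j _ => ?_
      rw [mul_assoc (t j), mul_hermiteProd]
      ring
    simp_rw [he]
    have hsi : ∀ (a : ℝ) (μ : Fin N → ℕ), Integrable
        (fun y => a • (((∑ j, t j * y j) ^ k * hermiteProd μ y) • f y)) (gaussFin N) :=
      fun a μ => (hi μ).smul a
    rw [integral_finsetSum]
    · refine Finset.sum_eq_zero fun j _ => ?_
      rw [integral_add (hsi _ _) (hsi _ _), integral_smul, integral_smul, ih, ih]
      simp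
    · exact fun j _ => (hsi _ _).add (hsi _ _)

/-- The exponential series is integrated term by term; its partial sums are dominated by `e^{|t·y|}
‖f‖`, an integrable product of two `L²` functions. -/
theorem integral_exp_linear_eq_zero [NormedSpace ℂ X] {f : (Fin N → ℝ) → X}
    (hf : MemLp f 2 (gaussFin N))
    (h0 : ∀ ν, ∫ y, hermiteProd ν y • f y ∂(gaussFin N) = 0) (t : Fin N → ℝ) :
    ∫ y, Complex.exp ((∑ j, t j * y j : ℝ) * Complex.I) • f y ∂(gaussFin N) = 0 := by
  have hs : ∀ y : Fin N → ℝ, |∑ j, t j * y j| ≤ (∑ j, |t j|) * ∑ j, |y j| := by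
    intro y
    refine (Finset.abs_sum_le_sum_abs _ _).trans ?_
    rw [Finset.sum_mul]
    refine Finset.sum_le_sum fun j _ => ?_
    rw [abs_mul]
    gcongr
    exact Finset.single_le_sum (f := fun j => |y j|) (fun _ _ => abs_nonneg _) (Finset.mem_univ j)
  have hT : 0 ≤ ∑ j, |t j| := Finset.sum_nonneg fun _ _ => abs_nonneg _
  have hreal : ∀ x : ℝ, HasSum (fun k : ℕ => x ^ k / k.factorial) (Real.exp x) := by
    intro x
    rw [Real.exp_eq_exp_ℝ]
    exact NormedSpace.expSeries_div_hasSum_exp x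
  have key := hasSum_integral_of_dominated_convergence (μ := gaussFin N)
    (F := fun (k : ℕ) y => (((∑ j, t j * y j : ℝ) * Complex.I) ^ k / (k.factorial : ℂ)) • f y)
    (f := fun y => Complex.exp ((∑ j, t j * y j : ℝ) * Complex.I) • f y)
    (bound := fun k y => |∑ j, t j * y j| ^ k / k.factorial * ‖f y‖)
    (fun k => by
      refine AEStronglyMeasurable.smul (Continuous.aestronglyMeasurable (by fun_prop)) hf.1)
    (fun k => ae_of_all _ fun y => by
      rw [norm_smul, norm_div, norm_pow, norm_mul, Complex.norm_I, mul_one, Complex.norm_real,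
        Real.norm_eq_abs, Complex.norm_natCast])
    (ae_of_all _ fun y => ((hreal _).summable.mul_right _))
    (by
      have h1 : ∀ y : Fin N → ℝ, ∑' k : ℕ, |∑ j, t j * y j| ^ k / k.factorial * ‖f y‖ =
          Real.exp |∑ j, t j * y j| * ‖f y‖ := by
        intro y
        rw [tsum_mul_right, (hreal _).tsum_eq]
      simp_rw [h1]
      have h2 := memLp_two_smul_integrable (ExpGrowth.exp_abs (N := N) _ hT) hf.norm
      refine h2.mono' ?_ (ae_of_all _ fun y => ?_)
      · refine AEStronglyMeasurable.mul (Continuous.aestronglyMeasurable ?_) hf.1.norm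
        fun_prop
      · rw [Real.norm_eq_abs, abs_of_nonneg (by positivity), smul_eq_mul]
        gcongr
        exact hs y)
    (ae_of_all _ fun y => by
      refine HasSum.smul_const ?_ (f y)
      rw [Complex.exp_eq_exp_ℂ]
      exact NormedSpace.expSeries_div_hasSum_exp _)
  refine key.unique ?_
  convert hasSum_zero using 1
  funext k
  have h := integral_pow_mul_hermiteProd_eq_zero hf h0 t k 0
  have h1 : ∀ y : Fin N → ℝ,
      (((∑ j, t j * y j : ℝ) * Complex.I) ^ k / (k.factorial : ℂ)) • f y =
      (Complex.I ^ k / (k.factorial : ℂ)) •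
        (((∑ j, t j * y j) ^ k * hermiteProd 0 y) • f y) := by
    intro y
    rw [hermiteProd_zero, mul_one, ← Complex.coe_smul, smul_smul]
    congr 1
    push_cast
    ring
  simp_rw [h1]
  rw [integral_smul, h, smul_zero]

/-- A continuous function in `L²(γ_N)` whose Hermite coefficients vanish is zero. -/
theorem eq_zero_of_integral_hermiteProd_eq_zero [NormedSpace ℂ X] [CompleteSpace X]
    {f : (Fin N → ℝ) → X} (hc : Continuous f) (hf : MemLp f 2 (gaussFin N))
    (h0 : ∀ ν, ∫ y, hermiteProd ν y • f y ∂(gaussFin N) = 0) (y : Fin N → ℝ) : f y = 0 := by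
  -- The Fourier transform needs the Euclidean space in place of the product with the sup norm.
  -- Density times `f` is continuous and integrable with vanishing transform, so inversion holds at
  -- every point.
  let g : EuclideanSpace ℝ (Fin N) → X := fun v => gaussDensity v.ofLp • f v.ofLp
  have hmp := PiLp.volume_preserving_ofLp (Fin N)
  have hgc : Continuous g := by
    have := continuous_gaussDensity (N := N)
    have h2 : Continuous fun v : EuclideanSpace ℝ (Fin N) => v.ofLp :=
      PiLp.continuous_ofLp 2 _
    exact (this.comp h2).smul (hc.comp h2)
  have hme : MeasurableEmbedding (WithLp.ofLp : EuclideanSpace ℝ (Fin N) → Fin N → ℝ) :=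
    (MeasurableEquiv.toLp 2 (Fin N → ℝ)).symm.measurableEmbedding
  have hfi : Integrable f (gaussFin N) := hf.integrable one_le_two
  have hgi : Integrable g :=
    (hmp.integrable_comp_emb hme (g := fun y => gaussDensity y • f y)).2
      (integrable_gaussFin_iff.1 hfi)
  have hF : 𝓕 g = 0 := by
    funext w
    rw [Real.fourier_eq']
    have h1 := hmp.integral_comp hme (fun y : Fin N → ℝ => gaussDensity y •
      (Complex.exp ((∑ j, (-2 * Real.pi * w j) * y j : ℝ) * Complex.I) • f y))
    rw [← integral_gaussFin, integral_exp_linear_eq_zero hf h0] at h1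
    rw [Pi.zero_apply, ← h1]
    refine integral_congr_ae (ae_of_all _ fun v => ?_)
    simp only [g]
    rw [smul_comm]
    congr 4
    rw [PiLp.inner_apply, Finset.mul_sum]
    simp [mul_assoc]
  have hg0 := hgc.fourierInv_fourier_eq hgi (by rw [hF]; exact integrable_zero _ _ _)
  rw [hF] at hg0
  have h2 := congrFun hg0 (WithLp.toLp 2 y)
  have h3 : (𝓕⁻ (0 : EuclideanSpace ℝ (Fin N) → X)) (WithLp.toLp 2 y) = 0 := by
    rw [Real.fourierInv_eq]
    simp
  rw [h3] at h2
  exact (smul_eq_zero.1 h2.symm).resolve_left (gaussDensity_pos y).ne'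

end Completeness

/-! ### Partial derivatives of separately holomorphic functions -/

section SeparatelyHolomorphic

variable {N : ℕ} {X : Type*} [NormedAddCommGroup X] [NormedSpace ℂ X]

/-- The partial derivative in the complex variable `j`. -/
noncomputable def cder (j : Fin N) (F : (Fin N → ℂ) → X) (z : Fin N → ℂ) : X :=
  deriv (fun w : ℂ => F (z + Pi.single j w)) 0

/-- Continuous, separately holomorphic functions on a product of strips. -/
structure SepHolo (ρ : Fin N → ℝ) (F : (Fin N → ℂ) → X) : Prop where
  cont : ContinuousOn F (strip ρ)
  diff : ∀ z ∈ strip ρ, ∀ j, DifferentiableAt ℂ (fun w : ℂ => F (z + Pi.single j w)) 0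

theorem isOpen_strip (ρ : Fin N → ℝ) : IsOpen (strip ρ) := by
  have : strip ρ = ⋂ j, {z : Fin N → ℂ | |(z j).im| < ρ j} := by ext; simp [strip]
  rw [this]
  exact isOpen_iInter_of_finite fun j => isOpen_lt (by fun_prop) continuous_const

theorem continuous_single_complex (j : Fin N) :
    Continuous fun w : ℂ => (Pi.single j w : Fin N → ℂ) :=
  (ContinuousLinearMap.single ℂ (fun _ : Fin N => ℂ) j).continuous

theorem add_single_mem_strip {ρ : Fin N → ℝ} {z : Fin N → ℂ} (hz : z ∈ strip ρ) {j : Fin N} {w : ℂ}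
    (hw : |(z j).im| + ‖w‖ < ρ j) : z + Pi.single j w ∈ strip ρ := by
  intro i
  by_cases h : i = j
  · subst h
    simp only [Pi.add_apply, Pi.single_eq_same, Complex.add_im]
    have h1 := abs_add_le (z i).im w.im
    have h2 := Complex.abs_im_le_norm w
    linarith
  · simpa [h] using hz i

theorem DifferentiableOn.sepHolo {ρ : Fin N → ℝ} {F : (Fin N → ℂ) → X}
    (hF : DifferentiableOn ℂ F (strip ρ)) : SepHolo ρ F where
  cont := hF.continuousOn
  diff z hz j := by
    have h1 : DifferentiableAt ℂ F (z + Pi.single j (0 : ℂ)) := by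
      simpa using hF.differentiableAt ((isOpen_strip ρ).mem_nhds hz)
    refine h1.comp (0 : ℂ) ((differentiableAt_const z).add ?_)
    exact (ContinuousLinearMap.single ℂ (fun _ : Fin N => ℂ) j).differentiableAt

theorem SepHolo.differentiableAt_single {ρ : Fin N → ℝ} {F : (Fin N → ℂ) → X} (hF : SepHolo ρ F)
    {z : Fin N → ℂ} {j : Fin N} {w : ℂ} (hz : z + Pi.single j w ∈ strip ρ) :
    DifferentiableAt ℂ (fun w : ℂ => F (z + Pi.single j w)) w := by
  have h := hF.diff _ hz j
  have h2 : (fun w' : ℂ => F (z + Pi.single j w')) =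
      (fun h : ℂ => F (z + Pi.single j w + Pi.single j h)) ∘ fun w' => w' - w := by
    funext w'
    simp only [Function.comp, add_assoc, ← Pi.single_add]
    congr 3
    ring
  rw [h2]
  have h3 : DifferentiableAt ℂ (fun w' : ℂ => w' - w) w := by fun_prop
  refine DifferentiableAt.comp w ?_ h3
  simpa using h

theorem SepHolo.differentiableOn_single {ρ : Fin N → ℝ} {F : (Fin N → ℂ) → X} (hF : SepHolo ρ F)
    {z : Fin N → ℂ} (hz : z ∈ strip ρ) {j : Fin N} {r : ℝ} (hr : |(z j).im| + r ≤ ρ j) :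
    DifferentiableOn ℂ (fun w : ℂ => F (z + Pi.single j w)) (Metric.ball 0 r) := by
  intro w hw
  rw [mem_ball_zero_iff] at hw
  exact (hF.differentiableAt_single
    (add_single_mem_strip hz (by linarith))).differentiableWithinAt

theorem SepHolo.diffContOnCl_single {ρ : Fin N → ℝ} {F : (Fin N → ℂ) → X} (hF : SepHolo ρ F)
    {z : Fin N → ℂ} (hz : z ∈ strip ρ) {j : Fin N} {r : ℝ} (hr : |(z j).im| + r < ρ j) :
    DiffContOnCl ℂ (fun w : ℂ => F (z + Pi.single j w)) (Metric.ball 0 r) := by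
  refine DifferentiableOn.diffContOnCl ((hF.differentiableOn_single hz (j := j)
    (r := ρ j - |(z j).im|) (by linarith)).mono ?_)
  refine Metric.closure_ball_subset_closedBall.trans (Metric.closedBall_subset_ball (by linarith))

theorem iteratedDeriv_single (j : Fin N) (F : (Fin N → ℂ) → X) (z : Fin N → ℂ) (a : ℕ) (w : ℂ) :
    iteratedDeriv a (fun w : ℂ => F (z + Pi.single j w)) w =
      (cder j)^[a] F (z + Pi.single j w) := by
  induction a generalizing w with
  | zero => simp
  | succ a ih =>
    rw [iteratedDeriv_succ, funext ih, Function.iterate_succ_apply', cder]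
    have := deriv_comp_const_add (fun w : ℂ => (cder j)^[a] F (z + Pi.single j w)) w 0
    rw [add_zero] at this
    rw [← this]
    congr 1
    funext h
    rw [add_assoc, Pi.single_add]

/-- Integrals of holomorphic functions depending on a parameter are holomorphic. -/
theorem differentiableAt_intervalIntegral {Φ : ℂ → ℝ → X} {R M a b : ℝ} (hR : 0 < R)
    (hc : ∀ w ∈ Metric.ball (0 : ℂ) R, Continuous (Φ w))
    (hd : ∀ θ, DifferentiableOn ℂ (fun w => Φ w θ) (Metric.ball 0 R))
    (hM : ∀ w ∈ Metric.ball (0 : ℂ) R, ∀ θ, ‖Φ w θ‖ ≤ M) :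
    DifferentiableAt ℂ (fun w => ∫ θ in a..b, Φ w θ) 0 := by
  -- Room for Cauchy's estimate on discs of radius `R/4` around the points of the half disc; it
  -- bounds the derivative by `M / (R/4)`.
  have hsub : ∀ w ∈ Metric.ball (0 : ℂ) (R / 2), Metric.closedBall w (R / 4) ⊆ Metric.ball 0 R := by
    intro w hw x hx
    rw [mem_ball_zero_iff] at hw ⊢
    rw [Metric.mem_closedBall, dist_eq_norm] at hx
    have := norm_add_le (x - w) w
    rw [sub_add_cancel] at this
    linarith
  have hdat : ∀ θ, ∀ w ∈ Metric.ball (0 : ℂ) R, DifferentiableAt ℂ (fun w => Φ w θ) w :=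
    fun θ w hw => (hd θ).differentiableAt (Metric.isOpen_ball.mem_nhds hw)
  have h0R : (0 : ℂ) ∈ Metric.ball (0 : ℂ) R := Metric.mem_ball_self hR
  have key := intervalIntegral.hasDerivAt_integral_of_dominated_loc_of_deriv_le
    (μ := volume) (a := a) (b := b) (F := Φ)
    (F' := fun w θ => deriv (fun w => Φ w θ) w) (x₀ := 0) (bound := fun _ => M / (R / 4))
    (Metric.ball_mem_nhds (0 : ℂ) (half_pos hR)) ?_ ?_ ?_ ?_ ?_ ?_
  · exact key.2.differentiableAt
  · filter_upwards [Metric.ball_mem_nhds (0 : ℂ) hR] with w hw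
    exact (hc w hw).aestronglyMeasurable
  · exact (hc 0 h0R).intervalIntegrable _ _
  -- The derivative at `0` is measurable in `θ` as a limit of difference quotients along this
  -- sequence.
  · let t : ℕ → ℂ := fun n => ((R / 2 / (n + 1) : ℝ) : ℂ)
    have ht0 : ∀ n : ℕ, 0 < R / 2 / ((n : ℝ) + 1) := fun n =>
      div_pos (half_pos hR) (by positivity)
    have htR : ∀ n, t n ∈ Metric.ball (0 : ℂ) R := by
      intro n
      rw [mem_ball_zero_iff, Complex.norm_real, Real.norm_eq_abs, abs_of_pos (ht0 n)]
      have : R / 2 / ((n : ℝ) + 1) ≤ R / 2 := 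
        div_le_self (half_pos hR).le (by linarith [n.cast_nonneg (α := ℝ)])
      linarith
    have htend : Tendsto t atTop (𝓝[≠] 0) := by
      rw [tendsto_nhdsWithin_iff]
      refine ⟨?_, Eventually.of_forall fun n => ?_⟩
      · have h1 : Tendsto (fun n : ℕ => R / 2 / ((n : ℝ) + 1)) atTop (𝓝 0) := by
          have := (tendsto_one_div_add_atTop_nhds_zero_nat (𝕜 := ℝ)).const_mul (R / 2)
          simpa [div_eq_mul_inv] using this
        simpa [t, Function.comp_def] using (Complex.continuous_ofReal.tendsto 0).comp h1
      · simpa [t] using (Complex.ofReal_ne_zero.2 (ht0 n).ne')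
    refine aestronglyMeasurable_of_tendsto_ae atTop
      (f := fun n θ => (t n)⁻¹ • (Φ (0 + t n) θ - Φ 0 θ)) (fun n => ?_) (ae_of_all _ fun θ => ?_)
    · rw [zero_add]
      exact (((hc _ (htR n)).sub (hc 0 h0R)).const_smul _).aestronglyMeasurable
    · exact (hasDerivAt_iff_tendsto_slope_zero.1 (hdat θ 0 h0R).hasDerivAt).comp htend
  · refine ae_of_all _ fun θ _ w hw => ?_
    refine Complex.norm_deriv_le_of_forall_mem_sphere_norm_le (by positivity) ?_ ?_
    · exact DifferentiableOn.diffContOnCl ((hd θ).mono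
        (Metric.closure_ball_subset_closedBall.trans (hsub w hw)))
    · exact fun x hx => hM x (hsub w hw (Metric.sphere_subset_closedBall hx)) θ
  · exact intervalIntegrable_const
  · refine ae_of_all _ fun θ _ w hw => (hdat θ w ?_).hasDerivAt
    exact hsub w hw (Metric.mem_closedBall_self (by positivity))

variable [CompleteSpace X]

theorem SepHolo.cder_eq_integral {ρ : Fin N → ℝ} {F : (Fin N → ℂ) → X} (hF : SepHolo ρ F)
    {z : Fin N → ℂ} (hz : z ∈ strip ρ) {j : Fin N} {r : ℝ} (hr0 : 0 < r)
    (hr : |(z j).im| + r < ρ j) :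
    cder j F z = ∫ θ in 0..2 * Real.pi,
      (2 * Real.pi * circleMap 0 r θ : ℂ)⁻¹ • F (z + Pi.single j (circleMap 0 r θ)) := by
  have h := DiffContOnCl.circleIntegral_one_div_sub_center_pow_smul hr0 1
    (hF.diffContOnCl_single hz hr)
  rw [iteratedDeriv_one] at h
  have hpi : (2 * Real.pi * Complex.I : ℂ) ≠ 0 := Complex.two_pi_I_ne_zero
  have h2 : cder j F z = (2 * Real.pi * Complex.I : ℂ)⁻¹ •
      ∮ w in C(0, r), (1 / (w - 0) ^ (1 + 1)) • F (z + Pi.single j w) := by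
    rw [h, smul_smul, Nat.factorial_one, Nat.cast_one, div_one, inv_mul_cancel₀ hpi, one_smul]
    rfl
  rw [h2, circleIntegral, ← intervalIntegral.integral_smul]
  refine intervalIntegral.integral_congr fun θ _ => ?_
  simp only [smul_smul, deriv_circleMap]
  congr 1
  have hne : circleMap 0 r θ ≠ 0 := circleMap_ne_center hr0.ne'
  have hI := Complex.I_ne_zero
  have hpi2 : (Real.pi : ℂ) ≠ 0 := Complex.ofReal_ne_zero.2 Real.pi_ne_zero
  rw [sub_zero]
  field_simp

/-- Cauchy's formula writes the partial derivative as an integral over a small circle; continuity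
and holomorphy in every variable pass under the integral. This stability is what the class is for:
only one-variable Cauchy theory is used. -/
theorem SepHolo.cder {ρ : Fin N → ℝ} {F : (Fin N → ℂ) → X} (hF : SepHolo ρ F) (j : Fin N) :
    SepHolo ρ (cder j F) := by
  -- A neighborhood of radius `2r`: one `r` for moving the point, one `r` for the Cauchy circle. It
  -- is compactly contained in the strip, so `F` is bounded on it.
  have hloc : ∀ z₀ ∈ strip ρ, ∃ r > 0, ∃ M, ∀ z : Fin N → ℂ, (∀ i, ‖z i - z₀ i‖ ≤ 2 * r) →
      z ∈ strip ρ ∧ |(z j).im| + r < ρ j ∧ ‖F z‖ ≤ M := by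
    intro z₀ hz₀
    have h1 : ∀ᶠ r : ℝ in 𝓝[>] 0, ∀ i, 3 * r < ρ i - |(z₀ i).im| := by
      rw [eventually_all]
      intro i
      have h2 : Tendsto (fun r : ℝ => 3 * r) (𝓝[>] 0) (𝓝 0) := by
        have : Tendsto (fun r : ℝ => 3 * r) (𝓝 0) (𝓝 (3 * 0)) := by
          exact (continuous_const.mul continuous_id).tendsto 0
        rw [mul_zero] at this
        exact this.mono_left nhdsWithin_le_nhds
      exact h2.eventually (gt_mem_nhds (sub_pos.2 (hz₀ i)))
    obtain ⟨r, hr, hr0⟩ := (h1.and self_mem_nhdsWithin).exists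
    replace hr0 : 0 < r := hr0
    have him : ∀ z : Fin N → ℂ, (∀ i, ‖z i - z₀ i‖ ≤ 2 * r) → ∀ i, |(z i).im| + r < ρ i := by
      intro z hz i
      have h3 := Complex.abs_im_le_norm (z i - z₀ i)
      have h4 := abs_add_le (z i - z₀ i).im (z₀ i).im
      rw [← Complex.add_im, sub_add_cancel] at h4
      have := hr i
      have := hz i
      linarith
    let K : Set (Fin N → ℂ) := Set.univ.pi fun i => Metric.closedBall (z₀ i) (2 * r)
    have hK : IsCompact K := isCompact_univ_pi fun i => isCompact_closedBall _ _
    have hKs : K ⊆ strip ρ := by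
      intro z hz i
      have := him z (fun i => by simpa [dist_eq_norm] using hz i (Set.mem_univ i)) i
      linarith
    obtain ⟨M, hM⟩ := hK.exists_bound_of_continuousOn (hF.cont.mono hKs)
    refine ⟨r, hr0, M, fun z hz => ?_⟩
    have hzK : z ∈ K := fun i _ => by simpa [dist_eq_norm] using hz i
    exact ⟨hKs hzK, him z hz j, hM z hzK⟩
  have hsingle : ∀ {k : Fin N} {w : ℂ} {s : ℝ}, ‖w‖ ≤ s → ∀ i, ‖(Pi.single k w : Fin N → ℂ) i‖ ≤ s := by
    intro k w s hw i
    by_cases h : i = k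
    · subst h; simpa using hw
    · simp [h]; exact (norm_nonneg w).trans hw
  have hcm : ∀ {r : ℝ}, 0 < r → ∀ θ, ‖circleMap 0 r θ‖ = r := by
    intro r hr θ
    simp [norm_circleMap_zero, abs_of_pos hr]
  have hker : ∀ {r : ℝ}, 0 < r → Continuous fun θ : ℝ => (2 * Real.pi * circleMap 0 r θ : ℂ)⁻¹ := by
    intro r hr
    refine Continuous.inv₀ (by fun_prop) fun θ => ?_
    exact mul_ne_zero (mul_ne_zero two_ne_zero (Complex.ofReal_ne_zero.2 Real.pi_ne_zero))
      (circleMap_ne_center hr.ne')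
  have hkn : ∀ {r : ℝ}, 0 < r → ∀ θ : ℝ, ‖(2 * Real.pi * circleMap 0 r θ : ℂ)⁻¹‖ =
      (2 * Real.pi * r)⁻¹ := by
    intro r hr θ
    rw [norm_inv, norm_mul, norm_mul, hcm hr, Complex.norm_real, Real.norm_eq_abs,
      abs_of_pos Real.pi_pos]
    simp
  constructor
  · intro z₀ hz₀
    obtain ⟨r, hr0, M, h⟩ := hloc z₀ hz₀
    have hnear : ∀ z : Fin N → ℂ, ‖z - z₀‖ < r → ∀ θ i,
        ‖(z + (Pi.single j (circleMap 0 r θ) : Fin N → ℂ)) i - z₀ i‖ ≤ 2 * r := by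
      intro z hz θ i
      have h1 := (norm_le_pi_norm (z - z₀) i)
      have h2 := hsingle (k := j) (hcm hr0 θ).le i
      calc _ = ‖(z - z₀) i + (Pi.single j (circleMap 0 r θ) : Fin N → ℂ) i‖ := by
            simp only [Pi.add_apply, Pi.sub_apply]; congr 1; ring
        _ ≤ _ := norm_add_le _ _
        _ ≤ _ := by linarith
    have hnear0 : ∀ z : Fin N → ℂ, ‖z - z₀‖ < r → ∀ i, ‖z i - z₀ i‖ ≤ 2 * r := by
      intro z hz i
      have h1 := (norm_le_pi_norm (z - z₀) i)
      rw [Pi.sub_apply] at h1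
      linarith
    have hev : ∀ᶠ z in 𝓝 z₀, ‖z - z₀‖ < r := by
      filter_upwards [Metric.ball_mem_nhds z₀ hr0] with z hz
      rwa [← dist_eq_norm]
    refine ContinuousAt.continuousWithinAt ?_
    refine ContinuousAt.congr ?_ (f := fun z => ∫ θ in 0..2 * Real.pi,
      (2 * Real.pi * circleMap 0 r θ : ℂ)⁻¹ • F (z + Pi.single j (circleMap 0 r θ))) ?_
    · have hcF : ∀ z, ‖z - z₀‖ < r →
          Continuous fun θ => F (z + Pi.single j (circleMap 0 r θ)) := by
        intro z hz
        refine hF.cont.comp_continuous ?_ fun θ => (h _ (hnear z hz θ)).1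
        exact continuous_const.add ((continuous_single_complex j).comp (continuous_circleMap 0 r))
      refine intervalIntegral.continuousAt_of_dominated_interval
        (bound := fun _ => (2 * Real.pi * r)⁻¹ * M) ?_ ?_ intervalIntegrable_const ?_
      · filter_upwards [hev] with z hz
        exact ((hker hr0).smul (hcF z hz)).aestronglyMeasurable
      · filter_upwards [hev] with z hz
        refine ae_of_all _ fun θ _ => ?_
        rw [norm_smul, hkn hr0]
        gcongr
        exact (h _ (hnear z hz θ)).2.2
      · refine ae_of_all _ fun θ _ => ?_
        refine ContinuousAt.const_smul ?_ _
        have h1 : ContinuousAt F (z₀ + Pi.single j (circleMap 0 r θ)) :=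
          hF.cont.continuousAt ((isOpen_strip ρ).mem_nhds
            (h _ (hnear z₀ (by simpa using hr0) θ)).1)
        exact ContinuousAt.comp (f := fun z : Fin N → ℂ => z + Pi.single j (circleMap 0 r θ)) h1
          (by fun_prop)
    · filter_upwards [hev] with z hz
      exact (hF.cder_eq_integral (h z (hnear0 z hz)).1 hr0 (h z (hnear0 z hz)).2.1).symm
  · intro z₀ hz₀ k
    obtain ⟨r, hr0, M, h⟩ := hloc z₀ hz₀
    have hnear : ∀ w : ℂ, ‖w‖ < r → ∀ θ i,
        ‖(z₀ + (Pi.single k w : Fin N → ℂ) + (Pi.single j (circleMap 0 r θ) : Fin N → ℂ)) i - z₀ i‖ ≤ 2 * r := by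
      intro w hw θ i
      have h1 := hsingle (k := k) hw.le i
      have h2 := hsingle (k := j) (hcm hr0 θ).le i
      calc _ = ‖(Pi.single k w : Fin N → ℂ) i + (Pi.single j (circleMap 0 r θ) : Fin N → ℂ) i‖ := by
            simp only [Pi.add_apply]; congr 1; ring
        _ ≤ _ := norm_add_le _ _
        _ ≤ _ := by linarith
    have hnear0 : ∀ w : ℂ, ‖w‖ < r → ∀ i, ‖(z₀ + (Pi.single k w : Fin N → ℂ)) i - z₀ i‖ ≤ 2 * r := by
      intro w hw i
      have h1 := hsingle (k := k) hw.le i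
      simp only [Pi.add_apply, add_sub_cancel_left]
      linarith
    refine DifferentiableAt.congr_of_eventuallyEq (𝕜 := ℂ)
      (f := fun w : ℂ => ∫ θ in 0..2 * Real.pi,
      (2 * Real.pi * circleMap 0 r θ : ℂ)⁻¹ •
        F (z₀ + Pi.single k w + Pi.single j (circleMap 0 r θ))) ?_ ?_
    · refine differentiableAt_intervalIntegral (M := (2 * Real.pi * r)⁻¹ * M) hr0 ?_ ?_ ?_
      · intro w hw
        rw [mem_ball_zero_iff] at hw
        refine (hker hr0).smul (hF.cont.comp_continuous ?_ fun θ => (h _ (hnear w hw θ)).1)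
        exact continuous_const.add ((continuous_single_complex j).comp (continuous_circleMap 0 r))
      · intro θ w hw
        rw [mem_ball_zero_iff] at hw
        have h1 := (h _ (hnear w hw θ)).1
        rw [add_right_comm] at h1
        simp_rw [add_right_comm z₀]
        exact ((hF.differentiableAt_single h1).const_smul
          (2 * Real.pi * circleMap 0 r θ : ℂ)⁻¹).differentiableWithinAt
      · intro w hw θ
        rw [mem_ball_zero_iff] at hw
        rw [norm_smul, hkn hr0]
        gcongr
        exact (h _ (hnear w hw θ)).2.2
    · filter_upwards [Metric.ball_mem_nhds (0 : ℂ) hr0] with w hw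
      rw [mem_ball_zero_iff] at hw
      exact hF.cder_eq_integral (h _ (hnear0 w hw)).1 hr0 (h _ (hnear0 w hw)).2.1

theorem SepHolo.iterate_cder {ρ : Fin N → ℝ} {F : (Fin N → ℂ) → X} (hF : SepHolo ρ F) (j : Fin N)
    (a : ℕ) : SepHolo ρ ((SparseGrid.cder j)^[a] F) := by
  induction a with
  | zero => exact hF
  | succ a ih => rw [Function.iterate_succ_apply']; exact ih.cder j

end SeparatelyHolomorphic

/-! ### Square summability of Taylor coefficients -/

section TaylorBessel

variable {X : Type*} [NormedAddCommGroup X] [InnerProductSpace ℂ X] [CompleteSpace X]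

theorem integral_exp_int_mul (m : ℤ) :
    ∫ θ in 0..2 * Real.pi, Complex.exp (m * θ * Complex.I) =
      if m = 0 then (2 * Real.pi : ℂ) else 0 := by
  split_ifs with h
  · simp [h]
  · have hc : (m * Complex.I : ℂ) ≠ 0 := mul_ne_zero (Int.cast_ne_zero.2 h) Complex.I_ne_zero
    have h1 := integral_exp_mul_complex (a := 0) (b := 2 * Real.pi) hc
    have h2 : Complex.exp (m * Complex.I * (2 * Real.pi : ℝ)) = 1 := by
      rw [Complex.exp_eq_one_iff]
      exact ⟨m, by push_cast; ring⟩
    rw [h2] at h1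
    simp only [Complex.ofReal_zero, mul_zero, Complex.exp_zero, sub_self, zero_div] at h1
    rw [← h1]
    refine intervalIntegral.integral_congr fun θ _ => ?_
    congr 1
    ring

/-- The normalized Lebesgue measure on `(0, 2π]`. -/
noncomputable def angleMeasure : Measure ℝ :=
  ENNReal.ofReal (2 * Real.pi)⁻¹ • volume.restrict (Set.Ioc 0 (2 * Real.pi))

instance : IsFiniteMeasure angleMeasure := Measure.smul_finite _ ENNReal.ofReal_ne_top

theorem integral_angleMeasure {E : Type*} [NormedAddCommGroup E] [NormedSpace ℝ E] (f : ℝ → E) :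
    ∫ θ, f θ ∂angleMeasure = (2 * Real.pi)⁻¹ • ∫ θ in 0..2 * Real.pi, f θ := by
  rw [angleMeasure, integral_smul_measure, intervalIntegral.integral_of_le Real.two_pi_pos.le,
    ENNReal.toReal_ofReal (inv_nonneg.2 Real.two_pi_pos.le)]

/-- The Taylor coefficients at the center of a disc are square summable, with a bound by the square
mean over the circle. -/
theorem sum_norm_sq_iteratedDeriv_le {g : ℂ → X} {ρ : ℝ} (hρ : 0 < ρ)
    (hg : DiffContOnCl ℂ g (Metric.ball 0 ρ)) (n : ℕ) :
    ∑ a ∈ Finset.range n, ‖((ρ ^ a / a.factorial : ℝ) : ℂ) • iteratedDeriv a g 0‖ ^ 2 ≤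
      (2 * Real.pi)⁻¹ * ∫ θ in 0..2 * Real.pi, ‖g (circleMap 0 ρ θ)‖ ^ 2 := by
  have hgc : Continuous fun θ => g (circleMap 0 ρ θ) := by
    refine hg.continuousOn.comp_continuous (continuous_circleMap 0 ρ) fun θ => ?_
    rw [closure_ball _ hρ.ne']
    exact circleMap_mem_closedBall _ hρ.le θ
  have hgm : MemLp (fun θ => g (circleMap 0 ρ θ)) 2 angleMeasure := by
    obtain ⟨C, hC⟩ := (isCompact_closedBall (0 : ℂ) ρ).exists_bound_of_continuousOn
      (by simpa [closure_ball _ hρ.ne'] using hg.continuousOn)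
    exact MemLp.of_bound hgc.aestronglyMeasurable C
      (ae_of_all _ fun θ => hC _ (circleMap_mem_closedBall _ hρ.le θ))
  have key := sum_norm_sq_integral_le (μ := angleMeasure) (Finset.range n)
    (fun a θ => Complex.exp ((a : ℤ) * θ * Complex.I)) (fun a _ => by
      refine MemLp.of_bound (Continuous.aestronglyMeasurable (by fun_prop)) 1
        (ae_of_all _ fun θ => ?_)
      have : ((a : ℤ) * θ * Complex.I : ℂ) = ((a * θ : ℝ) : ℂ) * Complex.I := by push_cast; ring
      rw [this, Complex.norm_exp_ofReal_mul_I]) (fun a _ b _ => by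
      have h1 : ∀ θ : ℝ, starRingEnd ℂ (Complex.exp ((a : ℤ) * θ * Complex.I)) *
          Complex.exp ((b : ℤ) * θ * Complex.I) =
          Complex.exp (((b - a : ℤ) : ℂ) * θ * Complex.I) := by
        intro θ
        rw [← Complex.exp_conj, ← Complex.exp_add]
        congr 1
        simp
        ring
      simp_rw [h1]
      rw [integral_angleMeasure, integral_exp_int_mul]
      have hpi : (Real.pi : ℂ) ≠ 0 := Complex.ofReal_ne_zero.2 Real.pi_ne_zero
      by_cases hab : a = b
      · rw [if_pos (by omega), if_pos hab, Complex.real_smul]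
        push_cast
        field_simp
      · rw [if_neg (by omega), if_neg hab, smul_zero]) hgm
  rw [integral_angleMeasure, smul_eq_mul] at key
  refine le_trans (le_of_eq (Finset.sum_congr rfl fun a _ => ?_)) key
  congr 2
  rw [integral_angleMeasure]
  have h1 := DiffContOnCl.circleIntegral_one_div_sub_center_pow_smul hρ a hg
  have hpi : (Real.pi : ℂ) ≠ 0 := Complex.ofReal_ne_zero.2 Real.pi_ne_zero
  have hρ' : (ρ : ℂ) ≠ 0 := Complex.ofReal_ne_zero.2 hρ.ne'
  have hfac : (a.factorial : ℂ) ≠ 0 := Nat.cast_ne_zero.2 a.factorial_ne_zero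
  have hI := Complex.I_ne_zero
  have h2 : ((ρ ^ a / a.factorial : ℝ) : ℂ) • iteratedDeriv a g 0 =
      ((ρ : ℂ) ^ a * (2 * Real.pi * Complex.I)⁻¹) •
        ∮ z in C(0, ρ), (1 / (z - 0) ^ (a + 1)) • g z := by
    rw [h1, smul_smul]
    congr 1
    push_cast
    field_simp
  rw [h2, circleIntegral, ← intervalIntegral.integral_smul, ← intervalIntegral.integral_smul]
  refine intervalIntegral.integral_congr fun θ _ => ?_
  simp only [smul_smul, deriv_circleMap, sub_zero]
  rw [← Complex.coe_smul, smul_smul]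
  congr 1
  rw [circleMap_zero, ← Complex.exp_conj]
  have he : starRingEnd ℂ ((a : ℤ) * θ * Complex.I) = -(a * (θ * Complex.I)) := by
    simp
    ring
  have hexp := Complex.exp_ne_zero (θ * Complex.I)
  rw [he, Complex.exp_neg, Complex.exp_nat_mul]
  push_cast
  field_simp
  ring

/-- The bound is assumed for the square sum over a whole family on the circle, not for single
functions. In this form it passes from one variable to the next without any loss of constants. -/
theorem sum_sum_norm_sq_iteratedDeriv_le {ι : Type*} (s : Finset ι) (g : ι → ℂ → X) {ρ M : ℝ}
    (hρ : 0 < ρ) (hg : ∀ i ∈ s, DiffContOnCl ℂ (g i) (Metric.ball 0 ρ))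
    (hM : ∀ w : ℂ, ‖w‖ = ρ → ∑ i ∈ s, ‖g i w‖ ^ 2 ≤ M) (n : ℕ) :
    ∑ i ∈ s, ∑ a ∈ Finset.range n,
      ‖((ρ ^ a / a.factorial : ℝ) : ℂ) • iteratedDeriv a (g i) 0‖ ^ 2 ≤ M := by
  have h2pi := Real.two_pi_pos
  have hi : ∀ i ∈ s, IntervalIntegrable (fun θ => ‖g i (circleMap 0 ρ θ)‖ ^ 2) volume 0
      (2 * Real.pi) := by
    intro i hi
    refine Continuous.intervalIntegrable ?_ _ _
    refine Continuous.pow (Continuous.norm ?_) 2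
    refine (hg i hi).continuousOn.comp_continuous (continuous_circleMap 0 ρ) fun θ => ?_
    rw [closure_ball _ hρ.ne']
    exact circleMap_mem_closedBall _ hρ.le θ
  refine (Finset.sum_le_sum fun i hi => sum_norm_sq_iteratedDeriv_le hρ (hg i hi) n).trans ?_
  rw [← Finset.mul_sum, ← intervalIntegral.integral_finsetSum hi]
  have hsum : IntervalIntegrable (fun θ => ∑ i ∈ s, ‖g i (circleMap 0 ρ θ)‖ ^ 2) volume 0
      (2 * Real.pi) := by
    simpa [Finset.sum_fn] using IntervalIntegrable.sum s hi
  have h1 : ∫ θ in 0..2 * Real.pi, ∑ i ∈ s, ‖g i (circleMap 0 ρ θ)‖ ^ 2 ≤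
      ∫ _ in 0..2 * Real.pi, M := by
    refine intervalIntegral.integral_mono_on h2pi.le hsum
      intervalIntegrable_const fun θ _ => hM _ ?_
    rw [norm_circleMap_zero, abs_of_pos hρ]
  rw [intervalIntegral.integral_const, sub_zero, smul_eq_mul] at h1
  calc _ ≤ (2 * Real.pi)⁻¹ * (2 * Real.pi * M) := by gcongr
    _ = M := by field_simp

variable {N : ℕ}

/-- The iterated partial derivative of order `α j` in the variables `j` of a list. -/
noncomputable def iterDer (α : Fin N → ℕ) : List (Fin N) → ((Fin N → ℂ) → X) → (Fin N → ℂ) → X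
  | [], F => F
  | j :: L, F => (cder j)^[α j] (iterDer α L F)

omit [CompleteSpace X] in
theorem iterDer_congr {α β : Fin N → ℕ} {L : List (Fin N)} (h : ∀ j ∈ L, α j = β j)
    (F : (Fin N → ℂ) → X) : iterDer α L F = iterDer β L F := by
  induction L with
  | nil => rfl
  | cons j L ih =>
    rw [iterDer, iterDer, h j List.mem_cons_self, ih fun i hi => h i (List.mem_cons_of_mem j hi)]

theorem SepHolo.iterDer {ρ : Fin N → ℝ} {F : (Fin N → ℂ) → X} (hF : SepHolo ρ F) (α : Fin N → ℕ)
    (L : List (Fin N)) : SepHolo ρ (iterDer α L F) := by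
  induction L with
  | nil => exact hF
  | cons j L ih => exact ih.iterate_cder j _

/-- The factor `∏ ρ_j^{α_j} / α_j!` over the variables of a list. -/
noncomputable def taylorWeight (ρ : Fin N → ℝ) (α : Fin N → ℕ) (L : List (Fin N)) : ℝ :=
  (L.map fun j => ρ j ^ α j / (α j).factorial).prod

theorem taylorWeight_congr (ρ : Fin N → ℝ) {α β : Fin N → ℕ} {L : List (Fin N)}
    (h : ∀ j ∈ L, α j = β j) : taylorWeight ρ α L = taylorWeight ρ β L := by
  unfold taylorWeight
  congr 1
  exact List.map_congr_left fun j hj => by rw [h j hj]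

/-- The multi-indices with entries below `n` on a list, and `0` elsewhere. -/
def boxIndices (n : ℕ) (L : List (Fin N)) : Finset (Fin N → ℕ) :=
  Fintype.piFinset fun j => if j ∈ L then Finset.range n else {0}

theorem sum_boxIndices_cons (n : ℕ) {j : Fin N} {L : List (Fin N)} (hj : j ∉ L)
    (f : (Fin N → ℕ) → ℝ) :
    ∑ α ∈ boxIndices n (j :: L), f α =
      ∑ α ∈ boxIndices n L, ∑ a ∈ Finset.range n, f (Function.update α j a) := by
  rw [← Finset.sum_product']
  refine Finset.sum_bij' (fun α _ => (Function.update α j 0, α j))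
    (fun q _ => Function.update q.1 j q.2) ?_ ?_ ?_ ?_ ?_
  · intro α hα
    rw [boxIndices, Fintype.mem_piFinset] at hα
    rw [Finset.mem_product, boxIndices, Fintype.mem_piFinset]
    refine ⟨fun i => ?_, by simpa using hα j⟩
    by_cases hi : i = j
    · subst hi; simp [hj]
    · simpa [hi] using hα i
  · rintro ⟨α, a⟩ hq
    rw [Finset.mem_product, boxIndices, Fintype.mem_piFinset] at hq
    rw [boxIndices, Fintype.mem_piFinset]
    intro i
    by_cases hi : i = j
    · subst hi; simpa using hq.2
    · simpa [hi] using hq.1 i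
  · intro α _; simp
  · rintro ⟨α, a⟩ hq
    rw [Finset.mem_product, boxIndices, Fintype.mem_piFinset] at hq
    have : α j = 0 := by simpa [hj] using hq.1 j
    simp [← this]
  · intro α _; simp

/-- The Taylor coefficients of a separately holomorphic function, in the variables of a list, are
square summable. -/
theorem sum_norm_sq_iterDer_le {ρ ρ' : Fin N → ℝ} (hρ : ∀ j, 0 < ρ j) (hρ' : ∀ j, ρ j < ρ' j)
    {F : (Fin N → ℂ) → X} (hF : SepHolo ρ' F) (y : Fin N → ℝ) {M : ℝ}
    (hM : ∀ z ∈ polydisc ρ', ‖F (fun j => (y j : ℂ) + z j)‖ ^ 2 ≤ M) (n : ℕ) (L : List (Fin N))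
    (hL : L.Nodup) (z : Fin N → ℂ) (hz : z ∈ polydisc ρ') (hz0 : ∀ j ∈ L, z j = 0) :
    ∑ α ∈ boxIndices n L,
      ‖(taylorWeight ρ α L : ℂ) • iterDer α L F (fun j => (y j : ℂ) + z j)‖ ^ 2 ≤ M := by
  -- The base point must be free: applying the estimate in the variable `j` moves `z j` to the
  -- circle of radius `ρ j`, while the variables still on the list stay at the center.
  induction L generalizing z with
  | nil =>
    have : boxIndices n ([] : List (Fin N)) = {0} := by
      ext α
      rw [boxIndices, Fintype.mem_piFinset]
      simp [funext_iff]
    rw [this, Finset.sum_singleton]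
    simpa [taylorWeight, iterDer] using hM z hz
  | cons j L ih =>
    rw [List.nodup_cons] at hL
    rw [sum_boxIndices_cons n hL.1]
    have hstrip : ∀ z ∈ polydisc ρ', (fun i => (y i : ℂ) + z i) ∈ strip ρ' := by
      intro z hz i
      simp only [Complex.add_im, Complex.ofReal_im, zero_add]
      exact (Complex.abs_im_le_norm _).trans_lt (hz i)
    have hzj : z j = 0 := hz0 j List.mem_cons_self
    have hadd : ∀ w : ℂ, (fun i => (y i : ℂ) + z i) + Pi.single j w =
        fun i => (y i : ℂ) + (z + (Pi.single j w : Fin N → ℂ)) i := by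
      intro w
      funext i
      simp [add_assoc]
    have key := sum_sum_norm_sq_iteratedDeriv_le (boxIndices n L)
      (fun α w => (taylorWeight ρ α L : ℂ) •
        iterDer α L F ((fun i => (y i : ℂ) + z i) + Pi.single j w)) (M := M) (hρ j)
      (fun α _ => by
        have := (hF.iterDer α L).diffContOnCl_single (hstrip z hz) (j := j) (r := ρ j)
          (by simpa [hzj] using hρ' j)
        exact this.const_smul _) (fun w hw => by
        simp_rw [hadd]
        refine ih hL.2 _ (fun i => ?_) fun i hi => ?_
        · by_cases h : i = j
          · subst h; simpa [hzj, hw] using hρ' i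
          · simpa [h] using hz i
        · have h : i ≠ j := fun h => hL.1 (h ▸ hi)
          simpa [h] using hz0 i (List.mem_cons_of_mem j hi)) n
    refine le_trans (le_of_eq ?_) key
    refine Finset.sum_congr rfl fun α _ => Finset.sum_congr rfl fun a _ => ?_
    have hcongr : ∀ i ∈ L, Function.update α j a i = α i := fun i hi =>
      Function.update_of_ne (fun h : i = j => hL.1 (h ▸ hi)) _ _
    rw [iteratedDeriv_fun_const_smul_field, iteratedDeriv_single, Pi.single_zero, add_zero, smul_smul]
    congr 3
    · rw [taylorWeight, List.map_cons, List.prod_cons, Function.update_self]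
      change ((_ * taylorWeight ρ (Function.update α j a) L : ℝ) : ℂ) = _
      rw [taylorWeight_congr ρ hcongr]
      push_cast
      ring
    · rw [iterDer, Function.update_self, iterDer_congr hcongr]

end TaylorBessel

/-! ### Weighted square sums of Hermite coefficients -/

section HermiteCoefficients

variable {X : Type*} [NormedAddCommGroup X] [InnerProductSpace ℂ X] [CompleteSpace X] {N : ℕ}

/-- The embedding of `ℝ^N` into `ℂ^N`. -/
def toComplex (y : Fin N → ℝ) : Fin N → ℂ := fun j => (y j : ℂ)

theorem continuous_toComplex : Continuous (toComplex (N := N)) := by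
  unfold toComplex
  fun_prop

theorem toComplex_mem_strip {ρ : Fin N → ℝ} (hρ : ∀ j, 0 < ρ j) (y : Fin N → ℝ) :
    toComplex y ∈ strip ρ := fun j => by simpa [toComplex] using hρ j

omit [CompleteSpace X] in
theorem SepHolo.continuous_comp_toComplex {ρ : Fin N → ℝ} (hρ : ∀ j, 0 < ρ j)
    {F : (Fin N → ℂ) → X} (hF : SepHolo ρ F) : Continuous fun y => F (toComplex y) :=
  hF.cont.comp_continuous continuous_toComplex (toComplex_mem_strip hρ)

omit [CompleteSpace X] in
theorem SepHolo.hasLineDerivAt {ρ : Fin N → ℝ} (hρ : ∀ j, 0 < ρ j) {F : (Fin N → ℂ) → X}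
    (hF : SepHolo ρ F) (j : Fin N) (y : Fin N → ℝ) :
    HasLineDerivAt ℝ (fun y => F (toComplex y)) (SparseGrid.cder j F (toComplex y)) y
      (Pi.single j 1) := by
  have h1 := (hF.diff _ (toComplex_mem_strip hρ y) j).hasDerivAt
  have h2 := h1.scomp_of_eq (0 : ℝ) (Complex.ofRealCLM.hasDerivAt (x := 0)) (by simp)
  unfold HasLineDerivAt
  refine (h2.congr_deriv (by simp [SparseGrid.cder])).congr_of_eventuallyEq
    (Eventually.of_forall fun t => ?_)
  simp only [Function.comp]
  congr 1
  funext i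
  by_cases h : i = j
  · subst h; simp [toComplex]
  · simp [toComplex, h]

theorem taylorWeight_pos {ρ : Fin N → ℝ} (hρ : ∀ j, 0 < ρ j) (α : Fin N → ℕ) (L : List (Fin N)) :
    0 < taylorWeight ρ α L := by
  unfold taylorWeight
  refine List.prod_pos fun x hx => ?_
  obtain ⟨j, _, rfl⟩ := List.mem_map.1 hx
  have := hρ j
  positivity

variable {ρ ρ' : Fin N → ℝ} {F : (Fin N → ℂ) → X} {φ : (Fin N → ℝ) → ℝ}

theorem sum_norm_sq_iterDer_toComplex_le (hρ : ∀ j, 0 < ρ j) (hρ' : ∀ j, ρ j < ρ' j)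
    (hF : SepHolo ρ' F)
    (hFφ : ∀ y, ∀ z ∈ polydisc ρ', ‖F (fun j => (y j : ℂ) + z j)‖ ≤ φ y) (n : ℕ)
    {L : List (Fin N)} (hL : L.Nodup) (y : Fin N → ℝ) :
    ∑ α ∈ boxIndices n L, ‖(taylorWeight ρ α L : ℂ) • iterDer α L F (toComplex y)‖ ^ 2 ≤
      φ y ^ 2 := by
  have := sum_norm_sq_iterDer_le hρ hρ' hF y (M := φ y ^ 2)
    (fun z hz => pow_le_pow_left₀ (norm_nonneg _) (hFφ y z hz) 2) n L hL 0
    (fun j => by simpa using (hρ j).trans (hρ' j)) (fun _ _ => rfl)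
  simp only [Pi.zero_apply, add_zero] at this
  exact this

/-- Each derivative, with its Taylor weight, is a single term of a square sum that is at most `φ²`,
hence it is dominated by a multiple of `φ`. -/
theorem memLp_iterDer (hρ : ∀ j, 0 < ρ j) (hρ' : ∀ j, ρ j < ρ' j) (hF : SepHolo ρ' F)
    (hφ0 : ∀ y, 0 ≤ φ y) (hφ : MemLp φ 2 (gaussFin N))
    (hFφ : ∀ y, ∀ z ∈ polydisc ρ', ‖F (fun j => (y j : ℂ) + z j)‖ ≤ φ y) (α : Fin N → ℕ)
    {L : List (Fin N)} (hL : L.Nodup) :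
    MemLp (fun y => iterDer α L F (toComplex y)) 2 (gaussFin N) := by
  have hρ0 : ∀ j, 0 < ρ' j := fun j => (hρ j).trans (hρ' j)
  -- Orders off the list are irrelevant for the derivative; setting them to zero places the index in
  -- the box of the square sum.
  let β : Fin N → ℕ := fun j => if j ∈ L then α j else 0
  have hβ : iterDer α L F = iterDer β L F := iterDer_congr (fun j hj => by simp [β, hj]) F
  rw [hβ]
  have hmem : β ∈ boxIndices (∑ j, α j + 1) L := by
    rw [boxIndices, Fintype.mem_piFinset]
    intro j
    by_cases hj : j ∈ L
    · have := Finset.single_le_sum (f := α) (fun _ _ => Nat.zero_le _) (Finset.mem_univ j)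
      simp only [β, hj, if_true, Finset.mem_range]
      omega
    · simp [β, hj]
  have hw := taylorWeight_pos hρ β L
  refine hφ.of_le_mul (c := (taylorWeight ρ β L)⁻¹)
    ((hF.iterDer β L).continuous_comp_toComplex hρ0).aestronglyMeasurable (ae_of_all _ fun y => ?_)
  have h1 := sum_norm_sq_iterDer_toComplex_le hρ hρ' hF hFφ (∑ j, α j + 1) hL y
  have h2 := (Finset.single_le_sum (f := fun α => ‖(taylorWeight ρ α L : ℂ) •
    iterDer α L F (toComplex y)‖ ^ 2) (fun _ _ => by positivity) hmem).trans h1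
  have h3 := abs_le_of_sq_le_sq h2 (hφ0 y)
  rw [abs_norm, norm_smul, Complex.norm_real, Real.norm_eq_abs, abs_of_pos hw] at h3
  rw [Real.norm_eq_abs, abs_of_nonneg (hφ0 y), ← div_eq_inv_mul, le_div_iff₀ hw]
  linarith

/-- Iterated integration by parts. The accumulated factor `√(μ_j + 1) ⋯ √(μ_j + a)` is a quotient of
square roots of factorials, written here without division. -/
theorem sqrt_factorial_smul_integral_iterate_cder (hρ : ∀ j, 0 < ρ j) {G : (Fin N → ℂ) → X}
    (hG : SepHolo ρ G) (j : Fin N)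
    (hm : ∀ a, MemLp (fun y => (cder j)^[a] G (toComplex y)) 2 (gaussFin N)) (a : ℕ)
    (μ : Fin N → ℕ) :
    Real.sqrt ((μ j).factorial) •
      ∫ y, hermiteProd μ y • (cder j)^[a] G (toComplex y) ∂(gaussFin N) =
    Real.sqrt ((μ j + a).factorial) •
      ∫ y, hermiteProd (μ + Pi.single j a) y • G (toComplex y) ∂(gaussFin N) := by
  induction a generalizing μ with
  | zero => simp
  | succ a ih =>
    have h1 := integral_hermiteProd_smul_lineDeriv j (hm a) (hm (a + 1)) (fun y => by
      rw [Function.iterate_succ_apply']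
      exact (hG.iterate_cder j a).hasLineDerivAt hρ j y) μ
    have h2 := ih (μ + Pi.single j 1)
    rw [h1, smul_smul, mul_comm, ← sqrt_factorial_succ]
    rw [add_assoc, ← Pi.single_add, Pi.add_apply, Pi.single_eq_same] at h2
    rw [h2]
    congr 3
    · ring_nf
    · ext y
      rw [add_comm 1 a]

theorem prod_sqrt_factorial_smul_integral_iterDer (hρ : ∀ j, 0 < ρ j) (hρ' : ∀ j, ρ j < ρ' j)
    (hF : SepHolo ρ' F) (hφ0 : ∀ y, 0 ≤ φ y) (hφ : MemLp φ 2 (gaussFin N))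
    (hFφ : ∀ y, ∀ z ∈ polydisc ρ', ‖F (fun j => (y j : ℂ) + z j)‖ ≤ φ y) (α : Fin N → ℕ)
    {L : List (Fin N)} (hL : L.Nodup) (μ : Fin N → ℕ) :
    (L.map fun j => Real.sqrt ((μ j).factorial)).prod •
      ∫ y, hermiteProd μ y • iterDer α L F (toComplex y) ∂(gaussFin N) =
    (L.map fun j => Real.sqrt ((μ j + α j).factorial)).prod •
      ∫ y, hermiteProd (μ + (L.map fun j => Pi.single j (α j)).sum) y • F (toComplex y)
        ∂(gaussFin N) := by
  induction L generalizing μ with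
  | nil => simp [iterDer]
  | cons j L ih =>
    have hρ0 : ∀ j, 0 < ρ' j := fun j => (hρ j).trans (hρ' j)
    have hjL := (List.nodup_cons.1 hL).1
    have hm : ∀ a, MemLp (fun y => (cder j)^[a] (iterDer α L F) (toComplex y)) 2 (gaussFin N) := by
      intro a
      have := memLp_iterDer hρ hρ' hF hφ0 hφ hFφ (Function.update α j a) hL
      rw [iterDer, Function.update_self, iterDer_congr (β := α) (fun i hi =>
        Function.update_of_ne (fun h : i = j => hjL (h ▸ hi)) _ _)] at this
      exact this
    have h1 := sqrt_factorial_smul_integral_iterate_cder hρ0 (hF.iterDer α L) j hm (α j) μ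
    have h2 := ih (List.nodup_cons.1 hL).2 (μ + Pi.single j (α j))
    have h3 : ∀ i ∈ L, (μ + (Pi.single j (α j) : Fin N → ℕ)) i = μ i := fun i hi => by
      have : i ≠ j := fun h => hjL (h ▸ hi)
      simp [this]
    have e1 : L.map (fun i => Real.sqrt (((μ + (Pi.single j (α j) : Fin N → ℕ)) i).factorial)) =
        L.map fun i => Real.sqrt ((μ i).factorial) :=
      List.map_congr_left fun i hi => by rw [h3 i hi]
    have e2 : L.map (fun i => Real.sqrt
        (((μ + (Pi.single j (α j) : Fin N → ℕ)) i + α i).factorial)) =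
        L.map fun i => Real.sqrt ((μ i + α i).factorial) :=
      List.map_congr_left fun i hi => by rw [h3 i hi]
    rw [e1, e2] at h2
    rw [List.map_cons, List.prod_cons, List.map_cons, List.prod_cons, List.map_cons, List.sum_cons,
      iterDer, mul_comm, mul_smul, h1, smul_comm, h2, smul_smul, add_assoc]

/-- The Hermite coefficients of the restriction to `ℝ^N` are square summable with the weights that
belong to the derivatives of order `a ν`. -/
theorem sum_weight_mul_norm_sq_coeff_le (hρ : ∀ j, 0 < ρ j) (hρ' : ∀ j, ρ j < ρ' j)
    (hF : SepHolo ρ' F) (hφ0 : ∀ y, 0 ≤ φ y) (hφ : MemLp φ 2 (gaussFin N))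
    (hFφ : ∀ y, ∀ z ∈ polydisc ρ', ‖F (fun j => (y j : ℂ) + z j)‖ ≤ φ y)
    (a : (Fin N → ℕ) → Fin N → ℕ) (ha : ∀ ν j, a ν j ≤ ν j) {n : ℕ} (han : ∀ ν j, a ν j < n)
    (S : Finset (Fin N → ℕ)) :
    ∑ ν ∈ S, (∏ j, (ρ j ^ a ν j / (a ν j).factorial) ^ 2 *
        ((ν j).factorial / (ν j - a ν j).factorial : ℝ)) *
      ‖∫ y, hermiteProd ν y • F (toComplex y) ∂(gaussFin N)‖ ^ 2 ≤
    ∫ y, φ y ^ 2 ∂(gaussFin N) := by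
  set L := List.finRange N with hLdef
  have hL : L.Nodup := List.nodup_finRange N
  let t : (Fin N → ℕ) → (Fin N → ℝ) → X := fun α y =>
    (taylorWeight ρ α L : ℂ) • iterDer α L F (toComplex y)
  have ht : ∀ α, MemLp (t α) 2 (gaussFin N) := fun α =>
    (memLp_iterDer hρ hρ' hF hφ0 hφ hFφ α hL).const_smul _
  -- The coefficient `ν` of `F` is, up to factorials, the coefficient `ν - a ν` of the derivative of
  -- order `a ν`; the factor in the sum is exactly the one that this exchange produces.
  have hterm : ∀ ν, (∏ j, (ρ j ^ a ν j / (a ν j).factorial) ^ 2 *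
        ((ν j).factorial / (ν j - a ν j).factorial : ℝ)) *
      ‖∫ y, hermiteProd ν y • F (toComplex y) ∂(gaussFin N)‖ ^ 2 =
      ‖∫ y, hermiteProd (ν - a ν) y • t (a ν) y ∂(gaussFin N)‖ ^ 2 := by
    intro ν
    have h1 := prod_sqrt_factorial_smul_integral_iterDer hρ hρ' hF hφ0 hφ hFφ (a ν) hL (ν - a ν)
    rw [← Fin.prod_univ_def, ← Fin.prod_univ_def] at h1
    have e1 : ν - a ν + (L.map fun j => (Pi.single j (a ν j) : Fin N → ℕ)).sum = ν := by
      rw [hLdef, ← Fin.sum_univ_def, Finset.univ_sum_single]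
      funext j
      simp [ha ν j]
    rw [e1] at h1
    have e2 : ∀ j, (ν - a ν) j + a ν j = ν j := fun j => by simp [ha ν j]
    simp_rw [e2] at h1
    have hP : 0 < ∏ j, Real.sqrt (((ν - a ν) j).factorial : ℝ) :=
      Finset.prod_pos fun j _ => sqrt_factorial_pos _
    have h2 := congrArg (fun x => ‖x‖ ^ 2) h1
    simp only [norm_smul, mul_pow, Real.norm_eq_abs, sq_abs] at h2
    rw [← Finset.prod_pow, ← Finset.prod_pow] at h2
    simp_rw [Real.sq_sqrt (Nat.cast_nonneg _)] at h2
    have h3 : ∫ y, hermiteProd (ν - a ν) y • t (a ν) y ∂(gaussFin N) =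
        (taylorWeight ρ (a ν) L : ℂ) •
          ∫ y, hermiteProd (ν - a ν) y • iterDer (a ν) L F (toComplex y) ∂(gaussFin N) := by
      rw [← integral_smul]
      refine integral_congr_ae (ae_of_all _ fun y => ?_)
      simp only [t]
      rw [smul_comm]
    rw [h3, norm_smul, mul_pow, Complex.norm_real, Real.norm_eq_abs, sq_abs, taylorWeight, hLdef,
      ← Fin.prod_univ_def, ← Finset.prod_pow, Finset.prod_mul_distrib, mul_assoc]
    congr 1
    rw [Finset.prod_div_distrib, div_mul_eq_mul_div, div_eq_iff]
    · rw [← h2]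
      simp only [Pi.sub_apply]
      ring
    · exact Finset.prod_ne_zero_iff.2 fun j _ => Nat.cast_ne_zero.2 (Nat.factorial_ne_zero _)
  simp_rw [hterm]
  have hbox : ∀ ν ∈ S, a ν ∈ boxIndices n L := by
    intro ν _
    rw [boxIndices, Fintype.mem_piFinset]
    intro j
    simpa [hLdef, List.mem_finRange] using han ν j
  -- Group by the order `α = a ν`. On each fiber `ν ↦ ν - α` is injective, so the Hermite Bessel
  -- inequality for `t α` applies; then the sum over `α` is bounded pointwise by `φ²`.
  rw [← Finset.sum_fiberwise_of_maps_to hbox]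
  have hinj : ∀ α, Set.InjOn (fun ν : Fin N → ℕ => ν - α)
      (S.filter fun ν => a ν = α : Finset (Fin N → ℕ)) := by
    intro α ν hν ν' hν' h
    rw [Finset.mem_coe, Finset.mem_filter] at hν hν'
    funext j
    have h1 := congrFun h j
    have h2 := ha ν j
    have h3 := ha ν' j
    rw [hν.2] at h2
    rw [hν'.2] at h3
    simp only [Pi.sub_apply] at h1
    omega
  calc _ ≤ ∑ α ∈ boxIndices n L, ∫ y, ‖t α y‖ ^ 2 ∂(gaussFin N) := by
        refine Finset.sum_le_sum fun α _ => ?_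
        have h1 := sum_norm_sq_integral_hermiteProd_le
          ((S.filter fun ν => a ν = α).image fun ν => ν - α) (ht α)
        rw [Finset.sum_image (hinj α)] at h1
        refine le_trans (le_of_eq (Finset.sum_congr rfl fun ν hν => ?_)) h1
        rw [(Finset.mem_filter.1 hν).2]
    _ = ∫ y, ∑ α ∈ boxIndices n L, ‖t α y‖ ^ 2 ∂(gaussFin N) := by
        rw [integral_finsetSum]
        exact fun α _ => (memLp_two_iff_integrable_sq_norm (ht α).1).1 (ht α)
    _ ≤ _ := by
        refine integral_mono (integrable_finsetSum _ fun α _ =>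
          (memLp_two_iff_integrable_sq_norm (ht α).1).1 (ht α)) hφ.integrable_sq fun y => ?_
        exact sum_norm_sq_iterDer_toComplex_le hρ hρ' hF hFφ n hL y

end HermiteCoefficients

/-! ### Pointwise convergence of Hermite series -/

section Expansion

variable {N : ℕ}

theorem exists_abs_hermiteProd_le (R : ℝ) :
    ∃ C : ℝ, ∀ (ν : Fin N → ℕ) (y : Fin N → ℝ), ‖y‖ ≤ R → |hermiteProd ν y| ≤ C := by
  obtain ⟨C, hC1, hC⟩ := exists_abs_hermiteFun_le R
  refine ⟨C ^ N, fun ν y hy => ?_⟩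
  rw [hermiteProd, Finset.abs_prod]
  calc ∏ j, |hermiteFun (ν j) (y j)| ≤ ∏ _j : Fin N, C :=
        Finset.prod_le_prod (fun _ _ => abs_nonneg _) fun j _ => hC _ _ (by
          simpa using (norm_le_pi_norm y j).trans hy)
    _ = C ^ N := by simp

theorem continuous_tsum_of_locally_bounded {ι X : Type*} [NormedAddCommGroup X] [NormedSpace ℝ X]
    [CompleteSpace X] {c : ι → X} (hc : Summable fun i => ‖c i‖) {h : ι → (Fin N → ℝ) → ℝ}
    (hh : ∀ i, Continuous (h i)) (hb : ∀ R : ℝ, ∃ C, ∀ i y, ‖y‖ ≤ R → |h i y| ≤ C) :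
    Continuous fun y => ∑' i, h i y • c i := by
  rw [continuous_iff_continuousAt]
  intro y₀
  obtain ⟨C, hC⟩ := hb (‖y₀‖ + 1)
  have h1 : ContinuousOn (fun y => ∑' i, h i y • c i) (Metric.ball 0 (‖y₀‖ + 1)) := by
    refine continuousOn_tsum (u := fun i => C * ‖c i‖)
      (fun i => ((hh i).smul continuous_const).continuousOn) (hc.mul_left C) fun i y hy => ?_
    rw [norm_smul, Real.norm_eq_abs]
    exact mul_le_mul_of_nonneg_right (hC i y (mem_ball_zero_iff.1 hy).le) (norm_nonneg _)
  exact h1.continuousAt (Metric.isOpen_ball.mem_nhds (by simp))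

theorem summable_of_locally_bounded {ι X : Type*} [NormedAddCommGroup X] [NormedSpace ℝ X]
    [CompleteSpace X] {c : ι → X} (hc : Summable fun i => ‖c i‖) {h : ι → (Fin N → ℝ) → ℝ}
    (hb : ∀ R : ℝ, ∃ C, ∀ i y, ‖y‖ ≤ R → |h i y| ≤ C) (y : Fin N → ℝ) :
    Summable fun i => ‖h i y • c i‖ := by
  obtain ⟨C, hC⟩ := hb ‖y‖
  refine Summable.of_nonneg_of_le (fun _ => norm_nonneg _) (fun i => ?_) (hc.mul_left C)
  rw [norm_smul, Real.norm_eq_abs]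
  exact mul_le_mul_of_nonneg_right (hC i y le_rfl) (norm_nonneg _)

theorem integrable_hermiteProd_mul (μ ν : Fin N → ℕ) :
    Integrable (fun y => hermiteProd μ y * hermiteProd ν y) (gaussFin N) :=
  (expGrowth_hermiteProd μ).memLp.integrable_mul (expGrowth_hermiteProd ν).memLp

theorem integrable_tsum_hermiteProd_sq {c : (Fin N → ℕ) → ℝ} (hc0 : ∀ ν, 0 ≤ c ν)
    (hc : Summable c) :
    Integrable (fun y => ∑' ν, hermiteProd ν y ^ 2 * c ν) (gaussFin N) := by
  have hcn : Summable fun ν => ‖c ν‖ := hc.norm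
  have hb : ∀ R : ℝ, ∃ C, ∀ (ν : Fin N → ℕ) y, ‖y‖ ≤ R → |hermiteProd ν y ^ 2| ≤ C := by
    intro R
    obtain ⟨C, hC⟩ := exists_abs_hermiteProd_le (N := N) R
    refine ⟨C ^ 2, fun ν y hy => ?_⟩
    rw [abs_pow]
    exact pow_le_pow_left₀ (abs_nonneg _) (hC ν y hy) 2
  have hcont := continuous_tsum_of_locally_bounded (N := N) hcn
    (fun ν => (expGrowth_hermiteProd ν).1.pow 2) hb
  simp only [smul_eq_mul] at hcont
  have hpos : ∀ (ν : Fin N → ℕ) y, 0 ≤ hermiteProd ν y ^ 2 * c ν := fun ν y =>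
    mul_nonneg (sq_nonneg _) (hc0 ν)
  have hi : ∀ ν : Fin N → ℕ, Integrable (fun y => hermiteProd ν y ^ 2 * c ν) (gaussFin N) :=
    fun ν => by
      simpa [sq] using (integrable_hermiteProd_mul ν ν).mul_const (c ν)
  refine ⟨hcont.aestronglyMeasurable, ?_⟩
  rw [hasFiniteIntegral_iff_ofReal (ae_of_all _ fun y => tsum_nonneg fun ν => hpos ν y)]
  have h1 : ∀ y, ENNReal.ofReal (∑' ν, hermiteProd ν y ^ 2 * c ν) =
      ∑' ν, ENNReal.ofReal (hermiteProd ν y ^ 2 * c ν) := fun y =>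
    ENNReal.ofReal_tsum_of_nonneg (fun ν => hpos ν y)
      (by simpa using (summable_of_locally_bounded hcn hb y).of_norm)
  simp_rw [h1]
  rw [lintegral_tsum fun ν => (hi ν).1.aemeasurable.ennreal_ofReal]
  have h2 : ∀ ν : Fin N → ℕ, ∫⁻ y, ENNReal.ofReal (hermiteProd ν y ^ 2 * c ν) ∂(gaussFin N) =
      ENNReal.ofReal (c ν) := by
    intro ν
    rw [← ofReal_integral_eq_lintegral_ofReal (hi ν) (ae_of_all _ (hpos ν)), integral_mul_const]
    simp_rw [sq]
    rw [integral_hermiteProd_mul, if_pos rfl, one_mul]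
  simp_rw [h2]
  rw [← ENNReal.ofReal_tsum_of_nonneg hc0 hc]
  exact ENNReal.ofReal_lt_top

variable {X : Type*} [NormedAddCommGroup X]

/-- Cauchy–Schwarz with the weights `‖c ν‖` bounds the squared norm of the sum by `∑ ‖c ν‖` times `∑
H_ν² ‖c ν‖`, which is integrable by Tonelli. -/
theorem memLp_tsum_hermiteProd [NormedSpace ℝ X] [CompleteSpace X] {c : (Fin N → ℕ) → X}
    (hc : Summable fun ν => ‖c ν‖) :
    MemLp (fun y => ∑' ν, hermiteProd ν y • c ν) 2 (gaussFin N) := by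
  have hcont := continuous_tsum_of_locally_bounded hc
    (fun ν => (expGrowth_hermiteProd ν).1) (exists_abs_hermiteProd_le (N := N))
  rw [memLp_two_iff_integrable_sq_norm hcont.aestronglyMeasurable]
  refine ((integrable_tsum_hermiteProd_sq (fun ν => norm_nonneg (c ν)) hc).const_mul
    (∑' ν, ‖c ν‖)).mono' (hcont.norm.pow 2).aestronglyMeasurable (ae_of_all _ fun y => ?_)
  rw [Real.norm_eq_abs, abs_of_nonneg (by positivity)]
  have hs := summable_of_locally_bounded hc (exists_abs_hermiteProd_le (N := N)) y
  have hsq : Summable fun ν => hermiteProd ν y ^ 2 * ‖c ν‖ := by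
    obtain ⟨C, hC⟩ := exists_abs_hermiteProd_le (N := N) ‖y‖
    refine Summable.of_nonneg_of_le (fun ν => by positivity) (fun ν => ?_) (hc.mul_left (C ^ 2))
    have := pow_le_pow_left₀ (abs_nonneg _) (hC ν y le_rfl) 2
    rw [sq_abs] at this
    gcongr
  have h1 := norm_tsum_le_tsum_norm hs
  have h2 : (∑' ν, ‖hermiteProd ν y • c ν‖) ^ 2 ≤
      (∑' ν, ‖c ν‖) * ∑' ν, hermiteProd ν y ^ 2 * ‖c ν‖ := by
    refine le_of_tendsto (hs.hasSum.pow 2) (Eventually.of_forall fun s => ?_)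
    calc (∑ ν ∈ s, ‖hermiteProd ν y • c ν‖) ^ 2
        ≤ (∑ ν ∈ s, ‖c ν‖) * ∑ ν ∈ s, hermiteProd ν y ^ 2 * ‖c ν‖ := by
          refine Finset.sum_sq_le_sum_mul_sum_of_sq_le_mul s (fun _ _ => norm_nonneg _)
            (fun _ _ => by positivity) fun ν _ => le_of_eq ?_
          rw [norm_smul, mul_pow, Real.norm_eq_abs, sq_abs]
          ring
      _ ≤ _ := mul_le_mul (hc.sum_le_tsum s fun _ _ => norm_nonneg _)
          (hsq.sum_le_tsum s fun _ _ => by positivity)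
          (Finset.sum_nonneg fun _ _ => by positivity) (tsum_nonneg fun _ => norm_nonneg _)
  exact (pow_le_pow_left₀ (norm_nonneg _) h1 2).trans h2

theorem integral_hermiteProd_smul_tsum [NormedSpace ℝ X] [CompleteSpace X] {c : (Fin N → ℕ) → X}
    (hc : Summable fun ν => ‖c ν‖) (μ : Fin N → ℕ) :
    ∫ y, hermiteProd μ y • ∑' ν, hermiteProd ν y • c ν ∂(gaussFin N) = c μ := by
  have hi : ∀ ν, Integrable (fun y => (hermiteProd μ y * hermiteProd ν y) • c ν) (gaussFin N) :=
    fun ν => (integrable_hermiteProd_mul μ ν).smul_const _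
  have hbound : ∀ ν, ∫ y, ‖(hermiteProd μ y * hermiteProd ν y) • c ν‖ ∂(gaussFin N) ≤ ‖c ν‖ := by
    intro ν
    simp_rw [norm_smul]
    rw [integral_mul_const]
    -- `|H_μ H_ν| ≤ (H_μ² + H_ν²) / 2`, and both squares have integral 1.
    have h1 : ∫ y, ‖hermiteProd μ y * hermiteProd ν y‖ ∂(gaussFin N) ≤
        ∫ y, (1 / 2 * (hermiteProd μ y * hermiteProd μ y) +
          1 / 2 * (hermiteProd ν y * hermiteProd ν y)) ∂(gaussFin N) := by
      refine integral_mono (integrable_hermiteProd_mul μ ν).norm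
        (((integrable_hermiteProd_mul μ μ).const_mul _).add
          ((integrable_hermiteProd_mul ν ν).const_mul _)) fun y => ?_
      simp only [norm_mul, Real.norm_eq_abs]
      nlinarith [sq_nonneg (|hermiteProd μ y| - |hermiteProd ν y|), sq_abs (hermiteProd μ y),
        sq_abs (hermiteProd ν y)]
    rw [integral_add ((integrable_hermiteProd_mul μ μ).const_mul _)
      ((integrable_hermiteProd_mul ν ν).const_mul _), integral_const_mul, integral_const_mul,
      integral_hermiteProd_mul, integral_hermiteProd_mul] at h1
    norm_num at h1
    simp only [norm_mul, Real.norm_eq_abs]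
    calc _ ≤ 1 * ‖c ν‖ := by gcongr
      _ = _ := one_mul _
  have key := hasSum_integral_of_summable_integral_norm hi
    (Summable.of_nonneg_of_le (fun ν => integral_nonneg fun y => norm_nonneg _) hbound hc)
  have h2 : ∀ ν, ∫ y, (hermiteProd μ y * hermiteProd ν y) • c ν ∂(gaussFin N) =
      if ν = μ then c μ else 0 := by
    intro ν
    rw [integral_smul_const, integral_hermiteProd_mul]
    by_cases h : ν = μ
    · simp [h]
    · rw [if_neg h, if_neg (Ne.symm h), zero_smul]
  simp_rw [h2] at key
  rw [← key.unique (hasSum_ite_eq μ (c μ))]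
  refine integral_congr_ae (ae_of_all _ fun y => ?_)
  simp only [mul_smul]
  exact (((summable_of_locally_bounded hc (exists_abs_hermiteProd_le (N := N)) y).of_norm).tsum_const_smul
    _).symm

/-- If the Hermite coefficients of a continuous function in `L²` are absolutely summable, then the
function is pointwise the sum of its Hermite series. -/
theorem hasSum_hermiteProd_smul [NormedSpace ℂ X] [CompleteSpace X] {f : (Fin N → ℝ) → X}
    (hfc : Continuous f) (hf : MemLp f 2 (gaussFin N))
    (hs : Summable fun ν => ‖∫ y, hermiteProd ν y • f y ∂(gaussFin N)‖) (y : Fin N → ℝ) :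
    HasSum (fun ν => hermiteProd ν y • ∫ x, hermiteProd ν x • f x ∂(gaussFin N)) (f y) := by
  set c : (Fin N → ℕ) → X := fun ν => ∫ y, hermiteProd ν y • f y ∂(gaussFin N) with hcdef
  have hcont := continuous_tsum_of_locally_bounded hs
    (fun ν => (expGrowth_hermiteProd ν).1) (exists_abs_hermiteProd_le (N := N))
  have hmem := memLp_tsum_hermiteProd hs
  -- The function minus its series is continuous, in `L²`, and has vanishing coefficients.
  -- Continuity of the series is what yields equality at the nodes, which form a null set.
  have h0 := eq_zero_of_integral_hermiteProd_eq_zero (hfc.sub hcont) (hf.sub hmem) (fun μ => by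
    simp only [Pi.sub_apply, smul_sub]
    rw [integral_sub (memLp_two_smul_integrable (expGrowth_hermiteProd μ) hf)
      (memLp_two_smul_integrable (expGrowth_hermiteProd μ) hmem),
      integral_hermiteProd_smul_tsum hs, sub_self]) y
  rw [sub_eq_zero.1 h0]
  exact ((summable_of_locally_bounded hs (exists_abs_hermiteProd_le (N := N)) y).of_norm).hasSum

end Expansion

/-! ### Sums over multi-indices of products -/

section ProductSums

/-- Sums of products over multi-indices are bounded by products of sums. -/
theorem sum_prod_le_prod_tsum {N : ℕ} {g : Fin N → ℕ → ℝ} (h0 : ∀ j k, 0 ≤ g j k)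
    (hg : ∀ j, Summable (g j)) (S : Finset (Fin N → ℕ)) :
    ∑ ν ∈ S, ∏ j, g j (ν j) ≤ ∏ j, ∑' k, g j k := by
  let M : ℕ := ∑ ν ∈ S, ∑ j, ν j + 1
  have hS : S ⊆ Fintype.piFinset fun _ : Fin N => Finset.range M := by
    intro ν hν
    rw [Fintype.mem_piFinset]
    intro j
    have h1 := Finset.single_le_sum (f := fun ν : Fin N → ℕ => ∑ j, ν j)
      (fun _ _ => Nat.zero_le _) hν
    have h2 := Finset.single_le_sum (f := ν) (fun _ _ => Nat.zero_le _) (Finset.mem_univ j)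
    rw [Finset.mem_range]
    omega
  calc _ ≤ ∑ ν ∈ Fintype.piFinset fun _ : Fin N => Finset.range M, ∏ j, g j (ν j) :=
        Finset.sum_le_sum_of_subset_of_nonneg hS fun ν _ _ => Finset.prod_nonneg fun j _ => h0 _ _
    _ = ∏ j, ∑ k ∈ Finset.range M, g j k := (Finset.prod_univ_sum _ _).symm
    _ ≤ _ := Finset.prod_le_prod (fun j _ => Finset.sum_nonneg fun k _ => h0 j k) fun j _ =>
        (hg j).sum_le_tsum _ fun k _ => h0 j k

end ProductSums

/-! ### Decay of the Hermite coefficients for an admissible radius -/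

section CoefficientDecay

/-- The order of differentiation that is used to bound a Hermite coefficient of degree `k`. -/
def derivOrder (r k : ℕ) : ℕ := if k < 2 then 0 else if k < r then 2 else r

theorem derivOrder_le (r k : ℕ) : derivOrder r k ≤ k := by
  unfold derivOrder
  split_ifs <;> omega

theorem derivOrder_lt {r : ℕ} (hr : 2 ≤ r) (k : ℕ) : derivOrder r k < r + 1 := by
  unfold derivOrder
  split_ifs <;> omega

/-- A lower bound of the weights in the weighted sum of the squared Hermite coefficients. -/
noncomputable def coeffWeight (C M : ℝ) (r k : ℕ) : ℝ := if k < 2 then 1 else C⁻¹ * M * (k : ℝ) ^ r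

theorem coeffWeight_pos {C M : ℝ} (hC : 0 < C) (hM : 0 < M) (r k : ℕ) : 0 < coeffWeight C M r k := by
  unfold coeffWeight
  split_ifs with h
  · exact one_pos
  · have : (0 : ℝ) < k := by exact_mod_cast (by omega : 0 < k)
    positivity

theorem pow_le_pow_mul_descFactorial {r k : ℕ} (h : r ≤ k) :
    k ^ r ≤ r ^ r * k.descFactorial r := by
  have h1 : k ≤ r * (k + 1 - r) ∨ r = 0 := by
    rcases Nat.eq_zero_or_pos r with h0 | h0
    · exact Or.inr h0
    · left
      obtain ⟨d, rfl⟩ := Nat.exists_eq_add_of_le h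
      rw [show r + d + 1 - r = d + 1 by omega]
      nlinarith
  rcases h1 with h1 | rfl
  · calc k ^ r ≤ (r * (k + 1 - r)) ^ r := Nat.pow_le_pow_left h1 r
      _ = r ^ r * (k + 1 - r) ^ r := mul_pow _ _ _
      _ ≤ _ := Nat.mul_le_mul_left _ (Nat.pow_sub_le_descFactorial k r)
  · simp

/-- For `k ≥ r`, order `r` gives the growth `k^r` through the descending factorial, and `ρ^{2r} ≥
ρ^4 ρ₀^{2r-4}`. For `2 ≤ k < r`, order 2 gives the needed `ρ^4`, and `k^r ≤ r^r` is a constant.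
These cases produce the two nontrivial summands of `C`; the 4 is `(2!)²`. -/
theorem exists_coeffWeight_le {r : ℕ} (hr : 2 ≤ r) {ρ₀ A : ℝ} (hρ₀ : 0 < ρ₀) (hA : 0 ≤ A) :
    ∃ C : ℝ, 1 ≤ C ∧ ∀ ρ M : ℝ, ρ₀ ≤ ρ → 0 ≤ M → M ≤ A * ρ ^ 4 → ∀ k : ℕ,
      coeffWeight C M r k ≤ (ρ ^ derivOrder r k / (derivOrder r k).factorial) ^ 2 *
        ((k.factorial : ℝ) / ((k - derivOrder r k).factorial : ℝ)) := by
  refine ⟨1 + 4 * A * r ^ r + A * r ^ r * (r.factorial : ℝ) ^ 2 / ρ₀ ^ (2 * r - 4), ?_, ?_⟩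
  · have : 0 ≤ 4 * A * (r : ℝ) ^ r := by positivity
    have : 0 ≤ A * r ^ r * (r.factorial : ℝ) ^ 2 / ρ₀ ^ (2 * r - 4) := by positivity
    linarith
  set C := 1 + 4 * A * r ^ r + A * r ^ r * (r.factorial : ℝ) ^ 2 / ρ₀ ^ (2 * r - 4) with hC
  have hC0 : 0 < C := by positivity
  intro ρ M hρ hM hMA k
  have hρ' : 0 < ρ := hρ₀.trans_le hρ
  unfold coeffWeight derivOrder
  split_ifs with h1 h2
  · simp [div_self (Nat.cast_ne_zero.2 (Nat.factorial_ne_zero k) : (k.factorial : ℝ) ≠ 0)]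
  · rw [mul_assoc, inv_mul_le_iff₀ hC0]
    have h3 : (1 : ℝ) ≤ (k.factorial : ℝ) / ((k - 2).factorial : ℝ) := by
      rw [one_le_div (by positivity)]
      exact_mod_cast Nat.factorial_le (Nat.sub_le k 2)
    have h4 : 4 * A * (r : ℝ) ^ r ≤ C := by
      have : 0 ≤ A * r ^ r * (r.factorial : ℝ) ^ 2 / ρ₀ ^ (2 * r - 4) := by positivity
      linarith
    have h5 : (k : ℝ) ≤ r := by exact_mod_cast h2.le
    calc M * (k : ℝ) ^ r ≤ (A * ρ ^ 4) * (r : ℝ) ^ r := by gcongr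
      _ = (4 * A * (r : ℝ) ^ r) * ((ρ ^ 2 / (Nat.factorial 2 : ℕ)) ^ 2 * 1) := by
        simp; ring
      _ ≤ _ := by gcongr
  · rw [mul_assoc, inv_mul_le_iff₀ hC0]
    have hk : r ≤ k := not_lt.1 h2
    have h3 : (k.factorial : ℝ) / ((k - r).factorial : ℝ) = k.descFactorial r := by
      rw [div_eq_iff (by positivity), mul_comm]
      exact_mod_cast (Nat.factorial_mul_descFactorial hk).symm
    have h4 : A * r ^ r * (r.factorial : ℝ) ^ 2 / ρ₀ ^ (2 * r - 4) ≤ C := by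
      have : 0 ≤ 4 * A * (r : ℝ) ^ r := by positivity
      linarith
    have h5 : ((k : ℝ)) ^ r ≤ r ^ r * k.descFactorial r := by
      exact_mod_cast pow_le_pow_mul_descFactorial hk
    rw [h3]
    calc M * (k : ℝ) ^ r ≤ (A * ρ ^ 4) * (r ^ r * k.descFactorial r) := by gcongr
      _ = (A * r ^ r * (r.factorial : ℝ) ^ 2 / ρ₀ ^ (2 * r - 4)) *
          ((ρ ^ 4 * ρ₀ ^ (2 * r - 4) / (r.factorial : ℝ) ^ 2) * k.descFactorial r) := by
        field_simp
      _ ≤ C * ((ρ ^ 4 * ρ ^ (2 * r - 4) / (r.factorial : ℝ) ^ 2) * k.descFactorial r) := by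
        gcongr
      _ = _ := by
        rw [← pow_add, show 4 + (2 * r - 4) = r * 2 by omega, div_pow, ← pow_mul]

theorem summable_inv_coeffWeight {C M : ℝ} {r : ℕ} (hr : 2 ≤ r) :
    Summable fun k => (coeffWeight C M r k)⁻¹ := by
  have h : Summable fun k : ℕ => C * M⁻¹ * ((k : ℝ) ^ r)⁻¹ :=
    (Real.summable_nat_pow_inv.2 (by omega)).mul_left _
  refine (summable_nat_add_iff 2).1 (((summable_nat_add_iff 2).2 h).congr fun k => ?_)
  rw [coeffWeight, if_neg (by omega), mul_inv, mul_inv, inv_inv]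

theorem integral_sq_le_of_eLpNorm_le {Ω : Type*} [MeasurableSpace Ω] {μ : Measure Ω} {φ : Ω → ℝ}
    {δ : ℝ} (hδ : 0 ≤ δ) (hφ : MemLp φ 2 μ) (h : eLpNorm φ 2 μ ≤ ENNReal.ofReal δ) :
    ∫ y, φ y ^ 2 ∂μ ≤ δ ^ 2 := by
  have h0 : 0 ≤ ∫ y, φ y ^ 2 ∂μ := integral_nonneg fun _ => sq_nonneg _
  rw [hφ.eLpNorm_eq_integral_rpow_norm (by norm_num) (by norm_num)] at h
  have h1 := (ENNReal.ofReal_le_ofReal_iff hδ).1 h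
  have h2 : ∫ y, ‖φ y‖ ^ (2 : ENNReal).toReal ∂μ = ∫ y, φ y ^ 2 ∂μ := by
    refine integral_congr_ae (ae_of_all _ fun y => ?_)
    simp
  rw [h2, ENNReal.toReal_ofNat, ← one_div, ← Real.sqrt_eq_rpow] at h1
  exact (Real.sqrt_le_left hδ).1 h1

/-- From `2‖c‖ ≤ w ‖c‖² + w⁻¹` and the summability of the inverse weights. The bound may depend on
`N`, since only convergence of the Hermite series is drawn from it. -/
theorem summable_norm_of_weighted_sq {X : Type*} [NormedAddCommGroup X] {N : ℕ}
    {c : (Fin N → ℕ) → X} {C D : ℝ} (hC : 0 < C)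
    {M : ℕ → ℝ} (hM : ∀ j, 0 < M j) {r : ℕ} (hr : 2 ≤ r)
    (h : ∀ S : Finset (Fin N → ℕ), ∑ ν ∈ S, (∏ j : Fin N, coeffWeight C (M j) r (ν j)) * ‖c ν‖ ^ 2 ≤ D) :
    Summable fun ν => ‖c ν‖ := by
  refine summable_of_sum_le (fun _ => norm_nonneg _)
    (c := D + ∏ j : Fin N, ∑' k, (coeffWeight C (M j) r k)⁻¹) fun S => ?_
  have h1 := sum_prod_le_prod_tsum (g := fun (j : Fin N) k => (coeffWeight C (M j) r k)⁻¹)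
    (fun j k => (inv_pos.2 (coeffWeight_pos hC (hM j) r k)).le)
    (fun j => summable_inv_coeffWeight hr) S
  refine le_trans ?_ (add_le_add (h S) h1)
  rw [← Finset.sum_add_distrib]
  refine Finset.sum_le_sum fun ν _ => ?_
  rw [Finset.prod_inv_distrib]
  set w := ∏ j : Fin N, coeffWeight C (M j) r (ν j) with hw
  have hwpos : 0 < w := Finset.prod_pos fun j _ => coeffWeight_pos hC (hM j) _ _
  have h2 : 0 ≤ w * (‖c ν‖ - w⁻¹) ^ 2 := by positivity
  have h3 : w * (‖c ν‖ - w⁻¹) ^ 2 = w * ‖c ν‖ ^ 2 + w⁻¹ - 2 * ‖c ν‖ := by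
    field_simp
    ring
  linarith [norm_nonneg (c ν)]

variable {X : Type*} [NormedAddCommGroup X] [InnerProductSpace ℂ X] [CompleteSpace X]

/-- The Hermite coefficients of the functions of finitely many variables that belong to a
`(b, ξ, δ, X)`-holomorphic function decay, uniformly in the number of variables. -/
theorem HolomorphicWith.exists_coeff_bound {b : ℕ → ℝ} (hb : ∀ j, 0 < b j) {ξ δ : ℝ} (hξ : 0 < ξ)
    (hδ : 0 ≤ δ) {p : ℝ} (hp0 : 0 < p) (hp1 : p < 1) (hbp : Summable fun j => b j ^ p)
    {u : (ℕ → ℝ) → X} {v : (N : ℕ) → (Fin N → ℝ) → X} (hu : HolomorphicWith b ξ δ u v)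
    {r : ℕ} (hr : 2 ≤ r) {κ : ℝ} (hκ : 0 < κ) :
    ∃ C : ℝ, 1 ≤ C ∧ ∀ N : ℕ, 1 ≤ N → Continuous (v N) ∧ MemLp (v N) 2 (gaussFin N) ∧
      ∀ S : Finset (Fin N → ℕ),
        ∑ ν ∈ S, (∏ j : Fin N, coeffWeight C (max 1 (κ * b j ^ (p - 1)) ^ 4) r (ν j)) *
          ‖∫ y, hermiteProd ν y • v N y ∂gaussFin N‖ ^ 2 ≤ δ ^ 2 := by
  set B := ∑' j, b j ^ p with hB
  have hbp0 : ∀ j, 0 < b j ^ p := fun j => Real.rpow_pos_of_pos (hb j) p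
  have hBpos : 0 < B := hbp.tsum_pos (fun j => (hbp0 j).le) 0 (hbp0 0)
  -- Chosen so that the radii `2 ρ_j = 2 η b_j^{p-1}` satisfy `∑ b_j · 2ρ_j ≤ 2 η B = ξ`. The factor
  -- 2 leaves room for circles of radius `ρ_j` inside the polydisc.
  set η := ξ / (2 * B) with hη
  have hη0 : 0 < η := by positivity
  -- A lower bound of all radii: `b_j ≤ B^{1/p}`, and the exponent `p - 1` is negative.
  set ρ₀ := η * (B ^ (1 / p)) ^ (p - 1) with hρ₀
  have hρ₀pos : 0 < ρ₀ := by positivity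
  have hle : ∀ j, ρ₀ ≤ η * b j ^ (p - 1) := by
    intro j
    refine mul_le_mul_of_nonneg_left ?_ hη0.le
    refine Real.rpow_le_rpow_of_nonpos (hb j) ?_ (by linarith)
    rw [one_div, Real.le_rpow_inv_iff_of_pos (hb j).le hBpos.le hp0]
    exact hbp.le_tsum j fun i _ => (hbp0 i).le
  -- Makes `max(1, κ b_j^{p-1}) ≤ A ρ_j`: the first entry uses `ρ_j ≥ ρ₀`, the second compares `κ`
  -- with `η`.
  set A := max (1 / ρ₀) (κ / η) with hA
  have hApos : 0 < A := lt_max_of_lt_left (by positivity)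
  obtain ⟨C, hC1, hC⟩ := exists_coeffWeight_le hr hρ₀pos (by positivity : 0 ≤ A ^ 4)
  refine ⟨C, hC1, fun N hN => ?_⟩
  obtain ⟨φ, hφ0, hφm, hφδ, hV⟩ := hu.extension N hN
  set ρ : Fin N → ℝ := fun j => η * b j ^ (p - 1) with hρdef
  have hρpos : ∀ j, 0 < ρ j := fun j => hρ₀pos.trans_le (hle j)
  have hadm : Admissible b ξ fun j => 2 * ρ j := by
    refine ⟨fun j => by have := hρpos j; positivity, ?_⟩
    calc ∑ j : Fin N, b j * (2 * ρ j) = ∑ j : Fin N, 2 * η * b j ^ p := by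
          refine Finset.sum_congr rfl fun j _ => ?_
          have : b j ^ p = b j * b j ^ (p - 1) := by
            rw [Real.rpow_sub_one (hb j).ne']
            field_simp [(hb j).ne']
          rw [this, hρdef]
          ring
      _ = 2 * η * ∑ j ∈ Finset.range N, b j ^ p := by
          rw [← Finset.mul_sum, Fin.sum_univ_eq_sum_range fun j => b j ^ p]
      _ ≤ 2 * η * B := by
          gcongr
          exact hbp.sum_le_tsum _ fun j _ => (hbp0 j).le
      _ = ξ := by rw [hη]; field_simp
  obtain ⟨V, hVd, hVv, hVφ⟩ := hV _ hadm
  have hVs := SparseGrid.DifferentiableOn.sepHolo hVd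
  have hvV : v N = fun y => V (toComplex y) := by
    funext y
    exact (hVv y).symm
  have hcont : Continuous (v N) := by
    rw [hvV]
    exact hVs.continuous_comp_toComplex hadm.1
  have hmem : MemLp (v N) 2 (gaussFin N) := by
    refine hφm.mono hcont.aestronglyMeasurable (ae_of_all _ fun y => ?_)
    have := hVφ y 0 (fun j => by simpa using hρpos j)
    simp only [Pi.zero_apply, add_zero, hVv] at this
    exact this.trans (le_abs_self _)
  refine ⟨hcont, hmem, fun S => ?_⟩
  have key := sum_weight_mul_norm_sq_coeff_le hρpos (fun j => by linarith [hρpos j]) hVs hφ0 hφm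
    hVφ (fun ν j => derivOrder r (ν j)) (fun ν j => derivOrder_le _ _)
    (fun ν j => derivOrder_lt hr _) S
  refine le_trans ?_ (key.trans (integral_sq_le_of_eLpNorm_le hδ hφm hφδ))
  rw [hvV]
  refine Finset.sum_le_sum fun ν _ => ?_
  refine mul_le_mul_of_nonneg_right ?_ (by positivity)
  refine Finset.prod_le_prod (fun j _ => (coeffWeight_pos (by linarith) (by positivity) _ _).le)
    fun j _ => ?_
  refine hC _ _ (hle j) (by positivity) ?_ (ν j)
  rw [← mul_pow]
  refine pow_le_pow_left₀ (by positivity) (max_le ?_ ?_) 4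
  · calc (1 : ℝ) = 1 / ρ₀ * ρ₀ := by field_simp
      _ ≤ A * ρ j := by
        have := hle j
        gcongr
        exact le_max_left _ _
  · calc κ * b j ^ (p - 1) = κ / η * ρ j := by rw [hρdef]; field_simp
      _ ≤ A * ρ j := mul_le_mul_of_nonneg_right (le_max_right _ _) (hρpos j).le

end CoefficientDecay

/-! ### The combination formula -/

section Combination

open Classical in
/-- The alternating sum over the multi-indices `ν ≥ k` with `l - 1 ≤ ν ≤ l` vanishes for `k ≠ l`. -/
theorem sum_neg_one_pow_degree (Λ : Finset (ℕ →₀ ℕ)) (hΛ : ∀ l ∈ Λ, ∀ ν ≤ l, ν ∈ Λ)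
    {k l : ℕ →₀ ℕ} (hl : l ∈ Λ) (hkl : k ≤ l) :
    ∑ ν ∈ Λ with k ≤ ν ∧ ν ≤ l ∧ ∀ j, l j ≤ ν j + 1, (-1 : ℝ) ^ (l - ν).degree =
      if k = l then 1 else 0 := by
  split_ifs with h
  · subst h
    rw [Finset.sum_eq_single k]
    · simp
    · intro ν hν hne
      rw [Finset.mem_filter] at hν
      exact absurd (le_antisymm hν.2.2.1 hν.2.1) hne
    · intro hk
      exact absurd (Finset.mem_filter.2 ⟨hl, le_rfl, le_rfl, fun j => Nat.le_succ _⟩) hk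
  · obtain ⟨i, hi⟩ : ∃ i, k i < l i := by
      by_contra! hcon
      exact h (le_antisymm hkl hcon)
    -- Toggling coordinate `i` between `l i` and `l i - 1` is an involution without fixed points
    -- that reverses the sign. It stays above `k` because `k i < l i`, and in `Λ` because `Λ` is
    -- downward closed.
    let flip : (ℕ →₀ ℕ) → (ℕ →₀ ℕ) := fun ν => ν.update i (if ν i = l i then l i - 1 else l i)
    have hflip : ∀ ν j, flip ν j = if j = i then (if ν i = l i then l i - 1 else l i) else ν j := by
      intro ν j
      simp [flip, Finsupp.update_apply]
    have hdeg : ∀ ν : ℕ →₀ ℕ, ν ≤ l → l i ≤ ν i + 1 →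
        (-1 : ℝ) ^ (l - ν).degree + (-1 : ℝ) ^ (l - flip ν).degree = 0 := by
      intro ν h1 h2
      have hsplit : ∀ μ : ℕ →₀ ℕ, μ.degree = (μ.erase i).degree + μ i := by
        intro μ
        conv_lhs => rw [← Finsupp.erase_add_single i μ]
        rw [map_add, Finsupp.degree_single]
      have he : (l - flip ν).erase i = (l - ν).erase i := by
        ext j
        by_cases hj : j = i
        · simp [hj]
        · simp [Finsupp.erase_ne hj, hflip, hj]
      rw [hsplit (l - ν), hsplit (l - flip ν), he, Finsupp.tsub_apply, Finsupp.tsub_apply, hflip,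
        if_pos rfl, pow_add, pow_add]
      have h3 := h1 i
      by_cases h4 : ν i = l i
      · rw [if_pos h4, h4, Nat.sub_self, show l i - (l i - 1) = 1 by omega]
        ring
      · rw [if_neg h4, Nat.sub_self, show l i - ν i = 1 by omega]
        ring
    refine Finset.sum_involution (fun ν _ => flip ν) ?_ ?_ ?_ ?_
    · intro ν hν
      rw [Finset.mem_filter] at hν
      exact hdeg ν hν.2.2.1 (hν.2.2.2 i)
    · intro ν hν _ heq
      have := DFunLike.congr_fun heq i
      rw [hflip, if_pos rfl] at this
      split_ifs at this <;> omega
    · intro ν hν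
      rw [Finset.mem_filter] at hν ⊢
      obtain ⟨-, h1, h2, h3⟩ := hν
      have h4 : flip ν ≤ l := by
        intro j
        rw [hflip]
        have := h2 j
        split_ifs with hj <;> first | (subst hj; omega) | omega
      refine ⟨hΛ l hl _ h4, ?_, h4, ?_⟩
      · intro j
        rw [hflip]
        have := h1 j
        split_ifs with hj <;> first | (subst hj; omega) | omega
      · intro j
        rw [hflip]
        have := h3 j
        split_ifs with hj <;> first | (subst hj; omega) | omega
    · intro ν hν
      rw [Finset.mem_filter] at hν
      have h3 := hν.2.2.2 i
      have h4 := hν.2.2.1 i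
      ext j
      rw [hflip]
      by_cases hj : j = i
      · subst hj
        rw [if_pos rfl, hflip, if_pos rfl]
        split_ifs <;> omega
      · rw [if_neg hj, hflip, if_neg hj]

open Classical in
/-- The combination formula: the combination coefficients turn sums over boxes into the sum over
a downward closed index set. -/
theorem sum_combCoeff_mul (Λ : Finset (ℕ →₀ ℕ)) (hΛ : ∀ l ∈ Λ, ∀ ν ≤ l, ν ∈ Λ)
    (D : (ℕ →₀ ℕ) → ℝ) :
    ∑ ν ∈ Λ, combCoeff Λ ν * ∑ k ∈ Finset.Icc 0 ν, D k = ∑ k ∈ Λ, D k := by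
  have h1 : ∀ ν ∈ Λ, combCoeff Λ ν * ∑ k ∈ Finset.Icc 0 ν, D k =
      ∑ k ∈ Λ, ∑ l ∈ Λ, if k ≤ ν ∧ ν ≤ l ∧ (∀ j, l j ≤ ν j + 1) then
        D k * (-1) ^ (l - ν).degree else 0 := by
    intro ν hν
    have h2 : Finset.Icc 0 ν = Λ.filter (· ≤ ν) := by
      ext k
      simp only [Finset.mem_Icc, zero_le, true_and, Finset.mem_filter]
      exact ⟨fun h => ⟨hΛ ν hν k h, h⟩, fun h => h.2⟩
    rw [h2, Finset.sum_filter, combCoeff, Finset.sum_filter, Finset.sum_mul_sum, Finset.sum_comm]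
    refine Finset.sum_congr rfl fun k _ => Finset.sum_congr rfl fun l _ => ?_
    by_cases ha : k ≤ ν <;> by_cases hb : ν ≤ l ∧ ∀ j, l j ≤ ν j + 1
    · rw [if_pos ha, if_pos hb, if_pos (And.intro ha hb), mul_comm]
    · rw [if_neg hb, if_neg (fun h => hb (And.right h) : ¬ (k ≤ ν ∧ _)), zero_mul]
    · rw [if_neg ha, if_neg (fun h => ha (And.left h) : ¬ (k ≤ ν ∧ _)), mul_zero]
    · rw [if_neg ha, if_neg (fun h => ha (And.left h) : ¬ (k ≤ ν ∧ _)), mul_zero]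
  rw [Finset.sum_congr rfl h1, Finset.sum_comm]
  refine Finset.sum_congr rfl fun k hk => ?_
  rw [Finset.sum_comm]
  have h3 : ∀ l ∈ Λ, (∑ ν ∈ Λ, if k ≤ ν ∧ ν ≤ l ∧ (∀ j, l j ≤ ν j + 1) then
      D k * (-1) ^ (l - ν).degree else 0) = if k = l then D k else 0 := by
    intro l hl
    rw [← Finset.sum_filter, ← Finset.mul_sum]
    by_cases hkl : k ≤ l
    · rw [sum_neg_one_pow_degree Λ hΛ hl hkl, mul_ite, mul_one, mul_zero]
    · rw [Finset.filter_false_of_mem fun ν _ h => hkl (h.1.trans h.2.1), Finset.sum_empty, mul_zero,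
        if_neg fun h => hkl h.le]
  rw [Finset.sum_congr rfl h3, Finset.sum_ite_eq, if_pos hk]

/-- A sum of products over a box of finitely supported multi-indices is a product of sums. -/
theorem sum_Icc_prod {N : ℕ} {ν : ℕ →₀ ℕ} (hν : ∀ j, N ≤ j → ν j = 0) (g : Fin N → ℕ → ℝ) :
    ∑ μ ∈ Finset.Icc 0 ν, ∏ j : Fin N, g j (μ j) =
      ∏ j : Fin N, ∑ k ∈ Finset.range (ν j + 1), g j k := by
  rw [Finset.prod_univ_sum]
  refine Finset.sum_nbij (fun μ j => μ j) ?_ ?_ ?_ (fun _ _ => rfl)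
  · intro μ hμ
    rw [Fintype.mem_piFinset]
    intro j
    exact Finset.mem_range.2 (Nat.lt_succ_of_le ((Finset.mem_Icc.1 hμ).2 j))
  · intro μ hμ μ' hμ' h
    ext j
    by_cases hj : j < N
    · exact congrFun h ⟨j, hj⟩
    · have h1 := (Finset.mem_Icc.1 hμ).2 j
      have h2 := (Finset.mem_Icc.1 hμ').2 j
      have h3 := hν j (not_lt.1 hj)
      omega
  · intro m hm
    have hm' := fun j => Fintype.mem_piFinset.1 hm j
    let μ : ℕ →₀ ℕ := Finsupp.embDomain Fin.valEmbedding (Finsupp.equivFunOnFinite.symm m)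
    have hμ : ∀ j : Fin N, μ j = m j := fun j =>
      Finsupp.embDomain_apply_self Fin.valEmbedding (Finsupp.equivFunOnFinite.symm m) j
    refine ⟨μ, Finset.mem_coe.2 (Finset.mem_Icc.2 ⟨zero_le, fun j => ?_⟩), funext hμ⟩
    by_cases hj : j < N
    · have := Finset.mem_range.1 (hm' ⟨j, hj⟩)
      rw [← hμ ⟨j, hj⟩] at this
      exact Nat.le_of_lt_succ this
    · have : μ j = 0 := Finsupp.embDomain_of_notMem_range _ _ _ (by
        rintro ⟨i, rfl⟩
        exact hj i.2)
      rw [this]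
      exact Nat.zero_le _

end Combination

/-! ### The Smolyak quadrature on Hermite polynomials -/

section SmolyakOfHermite

/-- The multi-index in `ℕ^N`, extended by zero. -/
noncomputable def extendIndex {N : ℕ} (m : Fin N → ℕ) : ℕ →₀ ℕ :=
  Finsupp.embDomain Fin.valEmbedding (Finsupp.equivFunOnFinite.symm m)

@[simp] theorem extendIndex_apply {N : ℕ} (m : Fin N → ℕ) (j : Fin N) : extendIndex m j = m j :=
  Finsupp.embDomain_apply_self Fin.valEmbedding (Finsupp.equivFunOnFinite.symm m) j

theorem extendIndex_of_le {N : ℕ} (m : Fin N → ℕ) {j : ℕ} (hj : N ≤ j) : extendIndex m j = 0 :=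
  Finsupp.embDomain_of_notMem_range _ _ _ (by
    rintro ⟨i, rfl⟩
    exact absurd i.2 (not_lt.2 hj))

/-- The Smolyak quadrature of the Hermite polynomial with the multi-index `m`. -/
noncomputable def smolyakHermite {N : ℕ} (Λ : Finset (ℕ →₀ ℕ)) (m : Fin N → ℕ) : ℝ :=
  ∑ l ∈ Λ, ∏ j : Fin N, quadDiff (l j) (m j)

variable {N : ℕ} {Λ : Finset (ℕ →₀ ℕ)}

theorem smolyakHermite_eq_zero_of_eq_one (m : Fin N → ℕ) {j : Fin N} (hj : m j = 1) :
    smolyakHermite Λ m = 0 :=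
  Finset.sum_eq_zero fun l _ => Finset.prod_eq_zero (Finset.mem_univ j) (by
    rw [hj, quadDiff_one_right])

theorem prod_quadDiff_eq_zero {l : ℕ →₀ ℕ} (hl : ∀ j, N ≤ j → l j = 0) (m : Fin N → ℕ)
    (h : ¬ l ≤ extendIndex m) : ∏ j : Fin N, quadDiff (l j) (m j) = 0 := by
  obtain ⟨j, hj⟩ : ∃ j, extendIndex m j < l j := by
    by_contra! hcon
    exact h hcon
  by_cases hjN : j < N
  · refine Finset.prod_eq_zero (Finset.mem_univ ⟨j, hjN⟩) (quadDiff_eq_zero_of_lt ?_)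
    rwa [← extendIndex_apply m ⟨j, hjN⟩]
  · rw [hl j (not_lt.1 hjN)] at hj
    exact absurd hj (Nat.not_lt_zero _)

theorem smolyakHermite_zero (hN : ∀ l ∈ Λ, ∀ j, N ≤ j → l j = 0) (h0 : 0 ∈ Λ) :
    smolyakHermite Λ (0 : Fin N → ℕ) = 1 := by
  rw [smolyakHermite, Finset.sum_eq_single 0]
  · simp [quadDiff_zero_zero]
  · intro l hl hne
    refine prod_quadDiff_eq_zero (hN l hl) _ fun h => hne ?_
    ext j
    by_cases hj : j < N
    · have := h j
      rw [extendIndex_apply (0 : Fin N → ℕ) ⟨j, hj⟩] at this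
      simpa using this
    · exact hN l hl j (not_lt.1 hj)
  · exact fun h => absurd h0 h

/-- Only `l ≤ m` contribute, and this entire box lies in `Λ`. The sum then factorizes into
telescoping sums, one of which is the exact quadrature of a nonconstant `H_{m_j}`. -/
theorem smolyakHermite_eq_zero_of_mem (hN : ∀ l ∈ Λ, ∀ j, N ≤ j → l j = 0)
    (hΛ : ∀ l ∈ Λ, ∀ ν ≤ l, ν ∈ Λ) {m : Fin N → ℕ} (hm0 : m ≠ 0) (hm : extendIndex m ∈ Λ) :
    smolyakHermite Λ m = 0 := by
  have h1 : smolyakHermite Λ m = ∑ l ∈ Finset.Icc 0 (extendIndex m),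
      ∏ j : Fin N, quadDiff (l j) (m j) := by
    refine (Finset.sum_subset (fun l hl => hΛ _ hm _ (Finset.mem_Icc.1 hl).2) fun l hl hl' => ?_).symm
    exact prod_quadDiff_eq_zero (hN l hl) m fun h => hl' (Finset.mem_Icc.2 ⟨zero_le, h⟩)
  rw [h1, sum_Icc_prod (fun j hj => extendIndex_of_le m hj) fun j k => quadDiff k (m j)]
  obtain ⟨j, hj⟩ := Function.ne_iff.1 hm0
  refine Finset.prod_eq_zero (Finset.mem_univ j) ?_
  rw [extendIndex_apply]
  exact sum_quadDiff_self hj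

/-- Again only `l ≤ m` contribute, so the sum over the box is a bound that no longer depends on `Λ`.
-/
theorem abs_smolyakHermite_le (hN : ∀ l ∈ Λ, ∀ j, N ≤ j → l j = 0) (m : Fin N → ℕ) :
    |smolyakHermite Λ m| ≤ ∏ j : Fin N, ∑ k ∈ Finset.range (m j + 1), |quadDiff k (m j)| := by
  have h1 := sum_Icc_prod (fun j hj => extendIndex_of_le m hj) fun j k => |quadDiff k (m j)|
  simp only [extendIndex_apply] at h1
  rw [← h1]
  refine (Finset.abs_sum_le_sum_abs _ _).trans ?_
  simp only [Finset.abs_prod]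
  rw [← Finset.sum_filter_of_ne (p := (· ≤ extendIndex m))]
  · refine Finset.sum_le_sum_of_subset_of_nonneg (fun l hl => ?_) fun l _ _ =>
      Finset.prod_nonneg fun _ _ => abs_nonneg _
    exact Finset.mem_Icc.2 ⟨zero_le, (Finset.mem_filter.1 hl).2⟩
  · intro l hl hne
    by_contra hcon
    refine hne ?_
    rw [← Finset.abs_prod, prod_quadDiff_eq_zero (hN l hl) m hcon, abs_zero]

theorem exists_abs_smolyakHermite_le : ∃ C : ℝ, 1 ≤ C ∧ ∀ (N : ℕ) (Λ : Finset (ℕ →₀ ℕ)),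
    (∀ l ∈ Λ, ∀ j, N ≤ j → l j = 0) → ∀ m : Fin N → ℕ,
      |smolyakHermite Λ m| ≤ ∏ j, if m j = 0 then 1 else C * (m j : ℝ) ^ 2 := by
  obtain ⟨C, hC1, hC⟩ := exists_sum_abs_quadDiff_le
  refine ⟨C, hC1, fun N Λ hN m => (abs_smolyakHermite_le hN m).trans ?_⟩
  refine Finset.prod_le_prod (fun j _ => Finset.sum_nonneg fun _ _ => abs_nonneg _) fun j _ => ?_
  split_ifs with h
  · simp [h, quadDiff_zero_zero]
  · exact hC _ (Nat.one_le_iff_ne_zero.2 h)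

variable {X : Type*} [NormedAddCommGroup X] [InnerProductSpace ℂ X]

/-- The Hermite series converges at every node, so a finite quadrature acts on it termwise. Since
`χ_{0,0} = 0`, all grid points vanish beyond coordinate `N` and `v N` computes their point values.
-/
theorem hasSum_tensorQuad {b : ℕ → ℝ} {ξ δ : ℝ} {u : (ℕ → ℝ) → X}
    {v : (N : ℕ) → (Fin N → ℝ) → X} (hu : HolomorphicWith b ξ δ u v) (hN1 : 1 ≤ N)
    {c : (Fin N → ℕ) → X} (hc : ∀ y, HasSum (fun m => hermiteProd m y • c m) (v N y))
    {ν : ℕ →₀ ℕ} (hν : ∀ j, N ≤ j → ν j = 0) :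
    HasSum (fun m : Fin N → ℕ => (∏ j : Fin N, quadHermite (ν j) (m j)) • c m)
      (tensorQuad v ν) := by
  have h1 : tensorQuad v ν = ∑ μ ∈ Finset.Icc 0 ν,
      (∏ j : Fin N, weight (ν j) (μ j)) • v N fun i : Fin N => gridPoint ν μ i := by
    refine Finset.sum_congr rfl fun μ hμ => ?_
    have hμν := (Finset.mem_Icc.1 hμ).2
    have hμ0 : ∀ j, ν j = 0 → μ j = 0 := fun j hj => Nat.le_zero.1 (hj ▸ hμν j)
    rw [hu.pointEval_eq hN1 fun j hj => by
      rw [gridPoint, hν j hj, hμ0 j (hν j hj), node_zero_zero]]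
    congr 1
    rw [Fin.prod_univ_eq_prod_range fun j => weight (ν j) (μ j)]
    refine Finset.prod_subset (fun j hj => ?_) fun j _ hj => ?_
    · by_contra hcon
      exact Finsupp.mem_support_iff.1 hj (hν j (by simpa using hcon))
    · have h0 := Finsupp.notMem_support_iff.1 hj
      rw [h0, hμ0 j h0, weight_zero_zero]
  rw [h1]
  have h2 := hasSum_sum (s := Finset.Icc 0 ν) fun μ _ =>
    (hc fun i : Fin N => gridPoint ν μ i).const_smul (∏ j : Fin N, weight (ν j) (μ j))
  refine h2.congr_fun ?_
  intro m
  simp only [smul_smul]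
  rw [← Finset.sum_smul]
  congr 1
  simp only [hermiteProd, ← Finset.prod_mul_distrib, gridPoint]
  exact (sum_Icc_prod hν fun j k => weight (ν j) k * hermiteFun (m j) (node (ν j) k)).symm

theorem hasSum_smolyakQuad {b : ℕ → ℝ} {ξ δ : ℝ} {u : (ℕ → ℝ) → X}
    {v : (N : ℕ) → (Fin N → ℝ) → X} (hu : HolomorphicWith b ξ δ u v) (hN1 : 1 ≤ N)
    {c : (Fin N → ℕ) → X} (hc : ∀ y, HasSum (fun m => hermiteProd m y • c m) (v N y))
    (hN : ∀ l ∈ Λ, ∀ j, N ≤ j → l j = 0) (hΛ : ∀ l ∈ Λ, ∀ ν ≤ l, ν ∈ Λ) :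
    HasSum (fun m : Fin N → ℕ => smolyakHermite Λ m • c m) (smolyakQuad Λ v) := by
  have h2 := hasSum_sum (s := Λ) fun ν hν =>
    (hasSum_tensorQuad hu hN1 hc (hN ν hν)).const_smul (combCoeff Λ ν)
  refine h2.congr_fun ?_
  intro m
  simp only [smul_smul]
  rw [← Finset.sum_smul]
  congr 1
  rw [smolyakHermite, ← sum_combCoeff_mul Λ hΛ]
  refine Finset.sum_congr rfl fun ν hν => ?_
  rw [sum_Icc_prod (hN ν hν) fun j k => quadDiff k (m j)]
  simp only [sum_quadDiff]

end SmolyakOfHermite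

/-! ### Dimension-free summability and the number of quadrature points -/

section WeightedSums

theorem exists_forall_le_eq_zero (S : Finset (ℕ →₀ ℕ)) (N₀ : ℕ) :
    ∃ N, N₀ ≤ N ∧ ∀ l ∈ S, ∀ j, N ≤ j → l j = 0 := by
  refine ⟨N₀ + S.sup fun l => l.support.sup fun j => j + 1, Nat.le_add_right _ _, fun l hl j hj => ?_⟩
  by_contra hne
  have h1 : j + 1 ≤ l.support.sup fun j => j + 1 :=
    Finset.le_sup (f := fun j => j + 1) (Finsupp.mem_support_iff.2 hne)
  have h2 := Finset.le_sup (f := fun l : ℕ →₀ ℕ => l.support.sup fun j => j + 1) hl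
  omega

theorem prod_support_eq_prod_fin {N : ℕ} {ν : ℕ →₀ ℕ} (hν : ∀ j, N ≤ j → ν j = 0)
    (f : ℕ → ℕ → ℝ) :
    ∏ j ∈ ν.support, f j (ν j) = ∏ j : Fin N, if ν j = 0 then 1 else f j (ν j) := by
  rw [Fin.prod_univ_eq_prod_range fun j => if ν j = 0 then 1 else f j (ν j)]
  have h1 : ∏ j ∈ ν.support, f j (ν j) = ∏ j ∈ ν.support, if ν j = 0 then 1 else f j (ν j) :=
    Finset.prod_congr rfl fun j hj => by rw [if_neg (Finsupp.mem_support_iff.1 hj)]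
  rw [h1]
  refine Finset.prod_subset (fun j hj => ?_) fun j _ hj => ?_
  · by_contra hcon
    exact Finsupp.mem_support_iff.1 hj (hν j (by simpa using hcon))
  · rw [if_pos (Finsupp.notMem_support_iff.1 hj)]

/-- Sums of products of powers over multi-indices are bounded, uniformly in the dimension. -/
theorem exists_sum_prod_rpow_le {θ : ℕ → ℝ} (hθ0 : ∀ j, 0 ≤ θ j) (hθ : Summable θ) {e : ℝ}
    (he : e < -1) : ∃ B : ℝ, 0 < B ∧ ∀ (N : ℕ) (S : Finset (Fin N → ℕ)),
      ∑ m ∈ S, ∏ j, (if m j = 0 then 1 else θ j * (m j : ℝ) ^ e) ≤ B := by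
  have hZ : Summable fun k : ℕ => ((k + 1 : ℕ) : ℝ) ^ e :=
    (summable_nat_add_iff 1).2 (Real.summable_nat_rpow.2 he)
  set Z := ∑' k : ℕ, ((k + 1 : ℕ) : ℝ) ^ e with hZdef
  have hZ0 : 0 ≤ Z := tsum_nonneg fun k => by positivity
  -- Each variable contributes `1 + θ_j Z ≤ e^{θ_j Z}`, and summability of `θ` makes the product
  -- bounded independently of `N`.
  refine ⟨Real.exp (Z * ∑' j, θ j), Real.exp_pos _, fun N S => ?_⟩
  have hg : ∀ j : Fin N,
      HasSum (fun k : ℕ => if k = 0 then 1 else θ j * (k : ℝ) ^ e) (1 + θ j * Z) := by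
    intro j
    rw [← hasSum_nat_add_iff' 1]
    simpa [hZdef] using hZ.hasSum.mul_left (θ j)
  refine (sum_prod_le_prod_tsum (g := fun (j : Fin N) k => if k = 0 then 1 else θ j * (k : ℝ) ^ e)
    (fun j k => ?_) (fun j => (hg j).summable) S).trans ?_
  · have := hθ0 j
    split_ifs <;> positivity
  calc ∏ j : Fin N, ∑' k : ℕ, (if k = 0 then 1 else θ j * (k : ℝ) ^ e)
      = ∏ j : Fin N, (1 + θ j * Z) := Finset.prod_congr rfl fun j _ => (hg j).tsum_eq
    _ ≤ ∏ j : Fin N, Real.exp (θ j * Z) := by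
        refine Finset.prod_le_prod (fun j _ => ?_) fun j _ => ?_
        · have := hθ0 j
          positivity
        · rw [add_comm]
          exact Real.add_one_le_exp _
    _ = Real.exp (Z * ∑ j ∈ Finset.range N, θ j) := by
        rw [← Real.exp_sum, ← Finset.sum_mul, Fin.sum_univ_eq_sum_range, mul_comm]
    _ ≤ _ := by
        gcongr
        exact hθ.sum_le_tsum _ fun j _ => hθ0 j

theorem exists_sum_prod_support_rpow_le {θ : ℕ → ℝ} (hθ0 : ∀ j, 0 ≤ θ j) (hθ : Summable θ) {e : ℝ}
    (he : e < -1) : ∃ B : ℝ, 0 < B ∧ ∀ S : Finset (ℕ →₀ ℕ),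
      ∑ ν ∈ S, ∏ j ∈ ν.support, θ j * (ν j : ℝ) ^ e ≤ B := by
  obtain ⟨B, hB0, hB⟩ := exists_sum_prod_rpow_le hθ0 hθ he
  refine ⟨B, hB0, fun S => ?_⟩
  obtain ⟨N, -, hN⟩ := exists_forall_le_eq_zero S 0
  classical
  refine le_trans (le_of_eq ?_) (hB N (S.image fun ν (j : Fin N) => ν j))
  rw [Finset.sum_image]
  · exact Finset.sum_congr rfl fun ν hν =>
      prod_support_eq_prod_fin (hN ν hν) fun j k => θ j * (k : ℝ) ^ e
  · intro ν hν μ hμ h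
    ext j
    by_cases hj : j < N
    · exact congrFun h ⟨j, hj⟩
    · rw [hN ν hν j (not_lt.1 hj), hN μ hμ j (not_lt.1 hj)]

/-- The weight `∏_{j ∈ supp ν} M_j ν_j^α`. -/
noncomputable def prodWeight (M : ℕ → ℝ) (α : ℝ) (ν : ℕ →₀ ℕ) : ℝ :=
  ∏ j ∈ ν.support, M j * (ν j : ℝ) ^ α

variable {M : ℕ → ℝ} {α s : ℝ}

theorem one_le_natCast_of_mem_support {ν : ℕ →₀ ℕ} {j : ℕ} (hj : j ∈ ν.support) :
    (1 : ℝ) ≤ ν j := by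
  exact_mod_cast Nat.one_le_iff_ne_zero.2 (Finsupp.mem_support_iff.1 hj)

theorem prodWeight_pos (hM : ∀ j, 1 ≤ M j) (ν : ℕ →₀ ℕ) : 0 < prodWeight M α ν :=
  Finset.prod_pos fun j hj => mul_pos (one_pos.trans_le (hM j))
    (Real.rpow_pos_of_pos (one_pos.trans_le (one_le_natCast_of_mem_support hj)) _)

theorem prodWeight_mono (hM : ∀ j, 1 ≤ M j) (hα : 0 ≤ α) {ν μ : ℕ →₀ ℕ} (h : ν ≤ μ) :
    prodWeight M α ν ≤ prodWeight M α μ := by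
  obtain ⟨N, -, hN⟩ := exists_forall_le_eq_zero {ν, μ} 0
  unfold prodWeight
  rw [prod_support_eq_prod_fin (hN ν (by simp)) fun j k => M j * (k : ℝ) ^ α,
    prod_support_eq_prod_fin (hN μ (by simp)) fun j k => M j * (k : ℝ) ^ α]
  refine Finset.prod_le_prod (fun j _ => ?_) fun j _ => ?_
  · have := one_pos.trans_le (hM j)
    split_ifs <;> positivity
  · have h1 := h j
    have h2 := one_pos.trans_le (hM j)
    split_ifs with h3 h4 h4
    · exact le_rfl
    · refine one_le_mul_of_one_le_of_one_le (hM j) (Real.one_le_rpow ?_ hα)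
      exact_mod_cast Nat.one_le_iff_ne_zero.2 h4
    · omega
    · gcongr

theorem one_le_prodWeight (hM : ∀ j, 1 ≤ M j) (hα : 0 ≤ α) (ν : ℕ →₀ ℕ) :
    1 ≤ prodWeight M α ν := by
  have := prodWeight_mono hM hα (zero_le (a := ν))
  simpa [prodWeight] using this

/-- The number of indices in the boxes below an index set grows at most like `ε^{-s}`. -/
theorem exists_sum_card_Icc_le (hM : ∀ j, 1 ≤ M j) (hs : 0 < s)
    (hMs : Summable fun j => M j ^ (-s)) (hα : 2 < α * s) :
    ∃ B : ℝ, 1 ≤ B ∧ ∀ ε : ℝ, 0 < ε → ∀ S : Finset (ℕ →₀ ℕ),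
      (↑S ⊆ indexSet (prodWeight M α) ε) →
        ((∑ ν ∈ S, (Finset.Icc 0 ν).card : ℕ) : ℝ) ≤ B * ε ^ (-s) := by
  obtain ⟨B, hB0, hB⟩ := exists_sum_prod_support_rpow_le (θ := fun j => 2 * M j ^ (-s))
    (e := 1 - α * s) (fun j => by have := one_pos.trans_le (hM j); positivity)
    (hMs.mul_left 2) (by linarith)
  refine ⟨max 1 B, le_max_left _ _, fun ε hε S hS => ?_⟩
  -- The box has `∏ (ν_j + 1) ≤ ∏ 2ν_j` elements over the support. The factor `(ε c_ν)^{-s} ≥ 1` on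
  -- the index set makes this summable: the exponent `1 - αs` is below `-1`.
  have h1 : ∀ ν ∈ S, ((Finset.Icc 0 ν).card : ℝ) ≤
      ε ^ (-s) * ∏ j ∈ ν.support, 2 * M j ^ (-s) * (ν j : ℝ) ^ (1 - α * s) := by
    intro ν hν
    have hc := prodWeight_pos (α := α) hM ν
    have h2 : ((Finset.Icc 0 ν).card : ℝ) ≤ ∏ j ∈ ν.support, 2 * (ν j : ℝ) := by
      rw [Finsupp.card_Icc]
      simp only [Finsupp.support_zero, Finset.empty_union, Finsupp.coe_zero, Pi.zero_apply,
        Nat.card_Icc, tsub_zero, Nat.cast_prod]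
      refine Finset.prod_le_prod (fun j _ => by positivity) fun j hj => ?_
      have := one_le_natCast_of_mem_support hj
      push_cast
      linarith
    have h3 : ε * prodWeight M α ν ≤ 1 := by
      have : ε ≤ (prodWeight M α ν)⁻¹ := hS hν
      rwa [le_inv_comm₀ hε hc, ← one_div, le_div_iff₀ hε, mul_comm] at this
    have h4 : 1 ≤ ε ^ (-s) * prodWeight M α ν ^ (-s) := by
      rw [← Real.mul_rpow hε.le hc.le]
      exact Real.one_le_rpow_of_pos_of_le_one_of_nonpos (by positivity) h3 (by linarith)
    have h5 : prodWeight M α ν ^ (-s) = ∏ j ∈ ν.support, M j ^ (-s) * (ν j : ℝ) ^ (-(α * s)) := by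
      unfold prodWeight
      rw [← Real.finsetProd_rpow _ _ fun j _ => by
        have := one_pos.trans_le (hM j); positivity]
      refine Finset.prod_congr rfl fun j _ => ?_
      rw [Real.mul_rpow (one_pos.trans_le (hM j)).le (by positivity),
        ← Real.rpow_mul (by positivity), mul_neg]
    calc ((Finset.Icc 0 ν).card : ℝ) ≤ 1 * ∏ j ∈ ν.support, 2 * (ν j : ℝ) := by rwa [one_mul]
      _ ≤ (ε ^ (-s) * prodWeight M α ν ^ (-s)) * ∏ j ∈ ν.support, 2 * (ν j : ℝ) := by gcongr
      _ = _ := by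
        rw [h5, mul_assoc, ← Finset.prod_mul_distrib]
        congr 1
        refine Finset.prod_congr rfl fun j hj => ?_
        have h6 := one_pos.trans_le (one_le_natCast_of_mem_support hj)
        rw [sub_eq_add_neg, Real.rpow_add h6, Real.rpow_one]
        ring
  push_cast
  calc ∑ ν ∈ S, ((Finset.Icc 0 ν).card : ℝ)
      ≤ ∑ ν ∈ S, ε ^ (-s) * ∏ j ∈ ν.support, 2 * M j ^ (-s) * (ν j : ℝ) ^ (1 - α * s) :=
        Finset.sum_le_sum h1
    _ = ε ^ (-s) * ∑ ν ∈ S, ∏ j ∈ ν.support, 2 * M j ^ (-s) * (ν j : ℝ) ^ (1 - α * s) := by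
        rw [Finset.mul_sum]
    _ ≤ ε ^ (-s) * max 1 B := by
        gcongr
        exact (hB S).trans (le_max_right _ _)
    _ = _ := mul_comm _ _

theorem finite_of_sum_card_Icc_le {Λ : Set (ℕ →₀ ℕ)} {D : ℝ}
    (h : ∀ S : Finset (ℕ →₀ ℕ), ↑S ⊆ Λ → ((∑ ν ∈ S, (Finset.Icc 0 ν).card : ℕ) : ℝ) ≤ D) :
    Λ.Finite := by
  by_contra hinf
  obtain ⟨S, hS, hcard⟩ := Set.Infinite.exists_subset_card_eq hinf (⌊D⌋₊ + 1)
  have h1 : S.card ≤ ∑ ν ∈ S, (Finset.Icc 0 ν).card := by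
    rw [Finset.card_eq_sum_ones]
    exact Finset.sum_le_sum fun ν _ => Finset.card_pos.2 ⟨0, Finset.mem_Icc.2 ⟨le_rfl, zero_le⟩⟩
  have h2 : (S.card : ℝ) ≤ D := le_trans (by exact_mod_cast h1) (h S hS)
  rw [hcard] at h2
  push_cast at h2
  linarith [Nat.lt_floor_add_one D]

theorem encard_pts_le (Λ : Finset (ℕ →₀ ℕ)) :
    (pts (Λ : Set (ℕ →₀ ℕ))).encard ≤ (∑ ν ∈ Λ, (Finset.Icc 0 ν).card : ℕ) := by
  classical
  have h1 : pts (Λ : Set (ℕ →₀ ℕ)) ⊆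
      ((Λ.sigma fun ν => Finset.Icc 0 ν).image fun q => gridPoint q.1 q.2 : Finset (ℕ → ℝ)) := by
    rintro y ⟨ν, hν, μ, hμ, rfl⟩
    rw [Finset.coe_image]
    exact ⟨⟨ν, μ⟩, by simpa using ⟨hν, hμ⟩, rfl⟩
  refine (Set.encard_le_encard h1).trans ?_
  rw [Set.encard_coe_eq_coe_finsetCard]
  refine Nat.cast_le.2 (Finset.card_image_le.trans ?_)
  rw [Finset.card_sigma]

end WeightedSums

/-! ### Passage from `N` to infinitely many variables -/

section DimensionLimit

instance : IsProbabilityMeasure gaussInf := by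
  unfold gaussInf
  infer_instance

theorem measurable_restrict_fin (N : ℕ) : Measurable fun (y : ℕ → ℝ) (i : Fin N) => y i :=
  measurable_pi_lambda _ fun _ => measurable_pi_apply _

theorem map_gaussInf (N : ℕ) : gaussInf.map (fun y (i : Fin N) => y i) = gaussFin N := by
  unfold gaussInf gaussFin
  refine (Measure.pi_eq fun s hs => ?_).symm
  rw [Measure.map_apply (measurable_restrict_fin N) (MeasurableSet.univ_pi hs)]
  have h1 : (fun (y : ℕ → ℝ) (i : Fin N) => y i) ⁻¹' Set.univ.pi s =
      Set.pi (Finset.range N) fun j => if h : j < N then s ⟨j, h⟩ else Set.univ := by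
    ext y
    simp only [Set.mem_preimage, Set.mem_pi, Set.mem_univ, true_imp_iff, Finset.coe_range,
      Set.mem_Iio]
    constructor
    · intro h j hj
      simpa [hj] using h ⟨j, hj⟩
    · intro h i
      simpa using h i i.2
  rw [h1, Measure.infinitePi_pi _ fun j hj => by
    have hj' : j < N := by simpa using hj
    simpa [hj'] using hs ⟨j, hj'⟩]
  rw [← Fin.prod_univ_eq_prod_range
    fun j => gaussianReal 0 1 (if h : j < N then s ⟨j, h⟩ else Set.univ)]
  simp

theorem integral_gaussInf_comp {X : Type*} [NormedAddCommGroup X] [NormedSpace ℝ X] {N : ℕ}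
    {f : (Fin N → ℝ) → X} (hf : Continuous f) :
    ∫ y, f (fun i => y i) ∂gaussInf = ∫ y, f y ∂gaussFin N := by
  rw [← map_gaussInf, integral_map (measurable_restrict_fin N).aemeasurable hf.aestronglyMeasurable]

variable {X : Type*} [NormedAddCommGroup X] [InnerProductSpace ℂ X]

theorem HolomorphicWith.tendsto_integral {b : ℕ → ℝ} {ξ δ : ℝ} {u : (ℕ → ℝ) → X}
    {v : (N : ℕ) → (Fin N → ℝ) → X} (hu : HolomorphicWith b ξ δ u v)
    (hv : ∀ N, 1 ≤ N → Continuous (v N)) (hv2 : ∀ N, 1 ≤ N → MemLp (v N) 2 (gaussFin N)) :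
    Tendsto (fun N => ∫ y, v N y ∂gaussFin N) atTop (𝓝 (∫ y, u y ∂gaussInf)) := by
  have hmem : ∀ N, 1 ≤ N → MemLp (fun y : ℕ → ℝ => v N fun i => y i) 2 gaussInf := by
    intro N hN
    have h := hv2 N hN
    rw [← map_gaussInf] at h
    exact h.comp_of_map (measurable_restrict_fin N).aemeasurable
  have hL1 : Tendsto (fun N => ∫⁻ y : ℕ → ℝ, ‖v N (fun i => y i) - u y‖ₑ ∂gaussInf) atTop
      (𝓝 0) := by
    refine tendsto_of_tendsto_of_tendsto_of_le_of_le' tendsto_const_nhds hu.tendsto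
      (Eventually.of_forall fun _ => zero_le) ?_
    filter_upwards [eventually_ge_atTop 1] with N hN
    rw [← eLpNorm_one_eq_lintegral_enorm, ← eLpNorm_neg]
    refine (eLpNorm_le_eLpNorm_of_exponent_le (q := 2) (by norm_num)
      ((hmem N hN).sub hu.memLp).neg.1).trans (le_of_eq ?_)
    congr 1
    funext y
    simp
  have h := tendsto_integral_of_L1 u hu.memLp.1
    (F := fun (N : ℕ) (y : ℕ → ℝ) => v N fun i => y i)
    ((eventually_ge_atTop 1).mono fun N hN => (hmem N hN).integrable (by norm_num)) hL1
  refine h.congr' ?_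
  filter_upwards [eventually_ge_atTop 1] with N hN
  exact integral_gaussInf_comp (hv N hN)

end DimensionLimit

/-! ### The quadrature error -/

section ErrorBound

/-- Weighted Cauchy–Schwarz on partial sums: it separates coefficient decay from the error of the
functional. -/
theorem norm_hasSum_smul_le {ι X : Type*} [NormedAddCommGroup X] [NormedSpace ℝ X] {e w : ι → ℝ}
    {c : ι → X} {x : X} (hx : HasSum (fun i => e i • c i) x) (hw : ∀ i, 0 < w i) {D E : ℝ}
    (hD : 0 ≤ D) (hc : ∀ S : Finset ι, ∑ i ∈ S, w i * ‖c i‖ ^ 2 ≤ D ^ 2)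
    (he : ∀ S : Finset ι, ∑ i ∈ S, (w i)⁻¹ * e i ^ 2 ≤ E) : ‖x‖ ≤ D * √E := by
  have hE : 0 ≤ E := by simpa using he ∅
  refine le_of_tendsto hx.norm (Eventually.of_forall fun S => ?_)
  refine (norm_sum_le _ _).trans (abs_le_of_sq_le_sq' ?_ (by positivity)).2
  calc (∑ i ∈ S, ‖e i • c i‖) ^ 2
      ≤ (∑ i ∈ S, w i * ‖c i‖ ^ 2) * ∑ i ∈ S, (w i)⁻¹ * e i ^ 2 := by
        refine Finset.sum_sq_le_sum_mul_sum_of_sq_le_mul S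
          (fun i _ => mul_nonneg (hw i).le (sq_nonneg _))
          (fun i _ => mul_nonneg (inv_pos.2 (hw i)).le (sq_nonneg _)) fun i _ => le_of_eq ?_
        rw [norm_smul, mul_pow, Real.norm_eq_abs, sq_abs]
        field_simp [(hw i).ne']
    _ ≤ D ^ 2 * E := mul_le_mul (hc S) (he S)
        (Finset.sum_nonneg fun i _ => mul_nonneg (inv_pos.2 (hw i)).le (sq_nonneg _)) (sq_nonneg D)
    _ = (D * √E) ^ 2 := by rw [mul_pow, Real.sq_sqrt hE]

/-- The contribution of a single Hermite index to the squared quadrature error. -/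
theorem inv_coeffWeight_mul_sq_le {N : ℕ} {M : ℕ → ℝ} (hM : ∀ j, 1 ≤ M j) {C₀ C₁ α τ s ε : ℝ}
    (hC₀ : 1 ≤ C₀) {r : ℕ} (hα : α = r - τ) (hs : s < 1)
    (m : Fin N → ℕ) (hm1 : ∀ j, m j ≠ 1) (hmε : (prodWeight M α (extendIndex m))⁻¹ < ε) {q : ℝ}
    (hq : |q| ≤ ∏ j, if m j = 0 then 1 else C₁ * (m j : ℝ) ^ 2) :
    (∏ j : Fin N, coeffWeight C₀ (M j) r (m j))⁻¹ * q ^ 2 ≤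
      ε ^ (1 - s) * ∏ j : Fin N, if m j = 0 then 1 else
        (C₁ ^ 2 * C₀ * M j ^ (-s)) * (m j : ℝ) ^ (4 - τ - α * s) := by
  have hM0 : ∀ j, 0 < M j := fun j => one_pos.trans_le (hM j)
  have hC₀' : 0 < C₀ := one_pos.trans_le hC₀
  have hq2 : q ^ 2 ≤ (∏ j, if m j = 0 then 1 else C₁ * (m j : ℝ) ^ 2) ^ 2 := by
    rw [← sq_abs]
    exact pow_le_pow_left₀ (abs_nonneg _) hq 2
  have hw0 : 0 ≤ (∏ j : Fin N, coeffWeight C₀ (M j) r (m j))⁻¹ :=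
    inv_nonneg.2 (Finset.prod_nonneg fun j _ => (coeffWeight_pos hC₀' (hM0 j) _ _).le)
  have hc : (prodWeight M α (extendIndex m))⁻¹ ^ (1 - s) =
      ∏ j : Fin N, if m j = 0 then 1 else (M j * (m j : ℝ) ^ α) ^ (-(1 - s)) := by
    rw [Real.inv_rpow (prodWeight_pos hM _).le, ← Real.rpow_neg (prodWeight_pos hM _).le,
      prodWeight, prod_support_eq_prod_fin (fun j hj => extendIndex_of_le m hj)
        fun j k => M j * (k : ℝ) ^ α,
      ← Real.finsetProd_rpow _ _ fun j _ => by
        have := hM0 j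
        split_ifs <;> positivity]
    refine Finset.prod_congr rfl fun j _ => ?_
    rw [extendIndex_apply]
    split_ifs
    · exact Real.one_rpow _
    · rfl
  have hcε : (prodWeight M α (extendIndex m))⁻¹ ^ (1 - s) ≤ ε ^ (1 - s) :=
    Real.rpow_le_rpow (inv_pos.2 (prodWeight_pos hM _)).le hmε.le (by linarith)
  -- Since no entry is 1, the inverse coefficient weight is `C₀ M_j⁻¹ m_j^{-r}` at each nonzero
  -- entry. The power `1 - s` of the inverse product weight is split off and bounded by `ε^{1-s}`;
  -- the rest keeps `M_j^{-s}`.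
  calc _ ≤ (∏ j : Fin N, coeffWeight C₀ (M j) r (m j))⁻¹ *
        (∏ j, if m j = 0 then 1 else C₁ * (m j : ℝ) ^ 2) ^ 2 :=
        mul_le_mul_of_nonneg_left hq2 hw0
    _ = (prodWeight M α (extendIndex m))⁻¹ ^ (1 - s) * ∏ j : Fin N, if m j = 0 then 1 else
        (C₁ ^ 2 * C₀ * M j ^ (-s)) * (m j : ℝ) ^ (4 - τ - α * s) := by
      rw [hc, ← Finset.prod_inv_distrib, ← Finset.prod_pow, ← Finset.prod_mul_distrib,
        ← Finset.prod_mul_distrib]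
      refine Finset.prod_congr rfl fun j _ => ?_
      by_cases h0 : m j = 0
      · simp [h0, coeffWeight]
      · have hk : (0 : ℝ) < m j := by exact_mod_cast Nat.pos_of_ne_zero h0
        have h1 := hm1 j
        rw [if_neg h0, if_neg h0, if_neg h0, coeffWeight, if_neg (by omega),
          Real.mul_rpow (hM0 j).le (by positivity), ← Real.rpow_mul hk.le]
        have h2 : (M j)⁻¹ = M j ^ (-(1 - s)) * M j ^ (-s) := by
          rw [← Real.rpow_add (hM0 j), ← Real.rpow_neg_one]
          congr 1
          ring
        -- Exponents with `α = r - τ`: `4 - r = -α(1 - s) + (4 - τ - αs)`.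
        have h3 : (((m j : ℝ)) ^ r)⁻¹ * ((m j : ℝ) ^ 2) ^ 2 =
            (m j : ℝ) ^ (α * -(1 - s)) * (m j : ℝ) ^ (4 - τ - α * s) := by
          rw [← Real.rpow_add hk, ← pow_mul, ← Real.rpow_natCast, ← Real.rpow_natCast,
            ← Real.rpow_neg hk.le, ← Real.rpow_add hk, hα]
          congr 1
          push_cast
          ring
        rw [mul_inv, mul_inv, inv_inv, mul_pow, h2]
        linear_combination (C₀ * (M j ^ (-(1 - s)) * M j ^ (-s)) * C₁ ^ 2) * h3
    _ ≤ _ := by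
      refine mul_le_mul_of_nonneg_right hcε (Finset.prod_nonneg fun j _ => ?_)
      have := hM0 j
      split_ifs <;> positivity

variable {X : Type*} [NormedAddCommGroup X] [InnerProductSpace ℂ X] [CompleteSpace X]

theorem hasSum_integral_sub_smolyakQuad {b : ℕ → ℝ} {ξ δ : ℝ} {u : (ℕ → ℝ) → X}
    {v : (N : ℕ) → (Fin N → ℝ) → X} (hu : HolomorphicWith b ξ δ u v) {N : ℕ} (hN1 : 1 ≤ N)
    (hcont : Continuous (v N)) (hv2 : MemLp (v N) 2 (gaussFin N))
    (hs : Summable fun m => ‖∫ y, hermiteProd m y • v N y ∂gaussFin N‖) {Λ : Finset (ℕ →₀ ℕ)}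
    (hN : ∀ l ∈ Λ, ∀ j, N ≤ j → l j = 0) (hΛ : ∀ l ∈ Λ, ∀ ν ≤ l, ν ∈ Λ) :
    HasSum (fun m : Fin N → ℕ => ((if m = 0 then (1 : ℝ) else 0) - smolyakHermite Λ m) •
      ∫ y, hermiteProd m y • v N y ∂gaussFin N)
      ((∫ y, v N y ∂gaussFin N) - smolyakQuad Λ v) := by
  have hI : HasSum (fun m : Fin N → ℕ => (if m = 0 then (1 : ℝ) else 0) •
      ∫ y, hermiteProd m y • v N y ∂gaussFin N) (∫ y, v N y ∂gaussFin N) := by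
    refine (hasSum_ite_eq (0 : Fin N → ℕ) (∫ y, v N y ∂gaussFin N)).congr_fun fun m => ?_
    split_ifs with hm
    · simp [hm]
    · simp
  refine (hI.sub (hasSum_smolyakQuad hu hN1 (hasSum_hermiteProd_smul hcont hv2 hs) hN hΛ)).congr_fun
    fun m => ?_
  rw [sub_smul]

/-- Only nonzero `m` outside `Λ` without an entry 1 have a nonzero factor: `m = 0` and `m ∈ Λ` are
exact, and an entry 1 makes both integral and quadrature vanish. -/
theorem norm_integral_sub_smolyakQuad_le {b : ℕ → ℝ} {ξ δ : ℝ} (hδ : 0 ≤ δ) {u : (ℕ → ℝ) → X}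
    {v : (N : ℕ) → (Fin N → ℝ) → X} (hu : HolomorphicWith b ξ δ u v) {M : ℕ → ℝ}
    (hM : ∀ j, 1 ≤ M j) {C₀ C₁ α τ s ε B : ℝ} {r : ℕ} (hr : 2 ≤ r) (hC₀ : 1 ≤ C₀) {N : ℕ}
    (hN1 : 1 ≤ N) (hcont : Continuous (v N)) (hv2 : MemLp (v N) 2 (gaussFin N))
    (hsum : ∀ S : Finset (Fin N → ℕ), ∑ ν ∈ S, (∏ j : Fin N, coeffWeight C₀ (M j) r (ν j)) *
        ‖∫ y, hermiteProd ν y • v N y ∂gaussFin N‖ ^ 2 ≤ δ ^ 2)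
    (hα : α = r - τ) (hα0 : 0 ≤ α) (hs1 : s < 1) (hε : 0 < ε)
    {Λ : Finset (ℕ →₀ ℕ)} (h0 : 0 ∈ Λ) (hmem : ∀ ν, ν ∈ Λ ↔ ε ≤ (prodWeight M α ν)⁻¹)
    (hN : ∀ l ∈ Λ, ∀ j, N ≤ j → l j = 0)
    (hQ : ∀ m : Fin N → ℕ, |smolyakHermite Λ m| ≤ ∏ j, if m j = 0 then 1 else C₁ * (m j : ℝ) ^ 2)
    (hB : ∀ S : Finset (Fin N → ℕ), ∑ m ∈ S, ∏ j : Fin N, (if m j = 0 then 1 else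
      (C₁ ^ 2 * C₀ * M j ^ (-s)) * (m j : ℝ) ^ (4 - τ - α * s)) ≤ B) :
    ‖(∫ y, v N y ∂gaussFin N) - smolyakQuad Λ v‖ ≤ δ * √(ε ^ (1 - s) * B) := by
  have hM0 : ∀ j, 0 < M j := fun j => one_pos.trans_le (hM j)
  have hC₀' : 0 < C₀ := one_pos.trans_le hC₀
  have hΛ : ∀ l ∈ Λ, ∀ ν ≤ l, ν ∈ Λ := by
    intro l hl ν hν
    rw [hmem] at hl ⊢
    exact hl.trans (inv_anti₀ (prodWeight_pos hM ν) (prodWeight_mono hM hα0 hν))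
  have hdiff := hasSum_integral_sub_smolyakQuad hu hN1 hcont hv2
    (summable_norm_of_weighted_sq hC₀' hM0 hr hsum) hN hΛ
  have hw : ∀ m : Fin N → ℕ, 0 < ∏ j : Fin N, coeffWeight C₀ (M j) r (m j) := fun m =>
    Finset.prod_pos fun j _ => coeffWeight_pos hC₀' (hM0 j) r (m j)
  have hterm : ∀ m : Fin N → ℕ, (∏ j : Fin N, coeffWeight C₀ (M j) r (m j))⁻¹ *
      ((if m = 0 then (1 : ℝ) else 0) - smolyakHermite Λ m) ^ 2 ≤
      ε ^ (1 - s) * ∏ j : Fin N, if m j = 0 then 1 else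
        (C₁ ^ 2 * C₀ * M j ^ (-s)) * (m j : ℝ) ^ (4 - τ - α * s) := by
    intro m
    by_cases he : (if m = 0 then (1 : ℝ) else 0) - smolyakHermite Λ m = 0
    · rw [he, zero_pow two_ne_zero, mul_zero]
      refine mul_nonneg (by positivity) (Finset.prod_nonneg fun j _ => ?_)
      have := hM0 j
      split_ifs <;> positivity
    · have hm0 : m ≠ 0 := by
        rintro rfl
        exact he (by rw [if_pos rfl, smolyakHermite_zero hN h0, sub_self])
      rw [if_neg hm0, zero_sub, neg_eq_zero] at he
      rw [if_neg hm0, zero_sub, neg_sq]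
      refine inv_coeffWeight_mul_sq_le hM hC₀ hα hs1 m
        (fun j hj => he (smolyakHermite_eq_zero_of_eq_one m hj)) ?_ (hQ m)
      by_contra! hcon
      exact he (smolyakHermite_eq_zero_of_mem hN hΛ hm0 ((hmem _).2 hcon))
  have he : ∀ S : Finset (Fin N → ℕ), ∑ m ∈ S, (∏ j : Fin N, coeffWeight C₀ (M j) r (m j))⁻¹ *
      ((if m = 0 then (1 : ℝ) else 0) - smolyakHermite Λ m) ^ 2 ≤ ε ^ (1 - s) * B := by
    intro S
    refine (Finset.sum_le_sum fun m _ => hterm m).trans ?_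
    rw [← Finset.mul_sum]
    exact mul_le_mul_of_nonneg_left (hB S) (by positivity)
  exact norm_hasSum_smul_le hdiff hw hδ hsum he

/-- The error of the Smolyak quadrature, uniformly in the number of variables. -/
theorem HolomorphicWith.exists_error_bound {b : ℕ → ℝ} {ξ δ : ℝ} (hδ : 0 ≤ δ) {u : (ℕ → ℝ) → X}
    {v : (N : ℕ) → (Fin N → ℝ) → X} (hu : HolomorphicWith b ξ δ u v) {M : ℕ → ℝ}
    (hM : ∀ j, 1 ≤ M j) {C₀ α τ s : ℝ} {r : ℕ} (hr : 2 ≤ r) (hC₀ : 1 ≤ C₀)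
    (hcoeff : ∀ N : ℕ, 1 ≤ N → Continuous (v N) ∧ MemLp (v N) 2 (gaussFin N) ∧
      ∀ S : Finset (Fin N → ℕ), ∑ ν ∈ S, (∏ j : Fin N, coeffWeight C₀ (M j) r (ν j)) *
        ‖∫ y, hermiteProd ν y • v N y ∂gaussFin N‖ ^ 2 ≤ δ ^ 2)
    (hα : α = r - τ) (hα0 : 0 ≤ α) (hs1 : s < 1) (hMs : Summable fun j => M j ^ (-s))
    (hατ : 5 - τ < α * s) :
    ∃ B : ℝ, 0 < B ∧ ∀ ε : ℝ, 0 < ε → ∀ Λ : Finset (ℕ →₀ ℕ), 0 ∈ Λ →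
      (Λ : Set (ℕ →₀ ℕ)) = indexSet (prodWeight M α) ε →
        ‖(∫ y, u y ∂gaussInf) - smolyakQuad Λ v‖ ≤ δ * √(ε ^ (1 - s) * B) := by
  obtain ⟨C₁, -, hQ⟩ := exists_abs_smolyakHermite_le
  have hM0 : ∀ j, 0 < M j := fun j => one_pos.trans_le (hM j)
  have hC₀' : 0 < C₀ := one_pos.trans_le hC₀
  obtain ⟨B, hB0, hB⟩ := exists_sum_prod_rpow_le (θ := fun j => C₁ ^ 2 * C₀ * M j ^ (-s))
    (e := 4 - τ - α * s) (fun j => by have := hM0 j; positivity) (hMs.mul_left _) (by linarith)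
  refine ⟨B, hB0, fun ε hε Λ h0 hΛε => ?_⟩
  have hmem : ∀ ν, ν ∈ Λ ↔ ε ≤ (prodWeight M α ν)⁻¹ := fun ν => by
    rw [← Finset.mem_coe, hΛε]
    rfl
  -- From `N₀` on, the quadrature involves only the first `N` variables. The bound does not depend
  -- on `N` and survives the limit.
  obtain ⟨N₀, hN₀1, hN₀⟩ := exists_forall_le_eq_zero Λ 1
  refine le_of_tendsto ((hu.tendsto_integral (fun N hN => (hcoeff N hN).1)
    fun N hN => (hcoeff N hN).2.1).sub_const (smolyakQuad Λ v)).norm ?_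
  filter_upwards [eventually_ge_atTop N₀] with N hN
  have hN1 : 1 ≤ N := hN₀1.trans hN
  have hNΛ : ∀ l ∈ Λ, ∀ j, N ≤ j → l j = 0 := fun l hl j hj => hN₀ l hl j (hN.trans hj)
  obtain ⟨hcont, hv2, hsum⟩ := hcoeff N hN1
  exact norm_integral_sub_smolyakQuad_le hδ hu hM hr hC₀ hN1 hcont hv2 hsum hα hα0 hs1 hε h0 hmem
    hNΛ (hQ N Λ hNΛ) (hB N)

end ErrorBound

/-! ### The index sets of the theorem -/

section IndexSets

theorem cWeight_two_eq_prodWeight (b : ℕ → ℝ) (p ξ K τ : ℝ) (r : ℕ) :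
    cWeight 2 K (rhoSeq b p ξ r) r τ = prodWeight (fun j => max 1 (K * (ξ /
      (4 * √(r.factorial : ℝ) * (∑' i, b i ^ p) ^ (1 / p))) * b j ^ (p - 1)) ^ 4) (r - τ) := by
  funext ν
  refine Finset.prod_congr rfl fun j _ => ?_
  rw [rhoSeq]
  congr 3
  ring

/-- The relation between `s` and `p` says exactly that `(b_j^{p-1})^{-4s} = b_j^p`. -/
theorem summable_max_rpow_neg {b : ℕ → ℝ} (hb : ∀ j, 0 < b j) {p κ s : ℝ}
    (hbp : Summable fun j => b j ^ p) (hκ : 0 < κ) (hs : 0 ≤ s) (hsp : 4 * s * (1 - p) = p) :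
    Summable fun j => (max 1 (κ * b j ^ (p - 1)) ^ 4) ^ (-s) := by
  refine Summable.of_nonneg_of_le (fun j => by positivity) (fun j => ?_)
    (hbp.mul_left ((κ ^ 4) ^ (-s)))
  have hbj := hb j
  have h1 : (κ * b j ^ (p - 1)) ^ 4 ≤ max 1 (κ * b j ^ (p - 1)) ^ 4 :=
    pow_le_pow_left₀ (by positivity) (le_max_right _ _) 4
  refine (Real.rpow_le_rpow_of_nonpos (by positivity) h1 (by linarith)).trans (le_of_eq ?_)
  rw [mul_pow, Real.mul_rpow (by positivity) (by positivity), ← Real.rpow_natCast (b j ^ (p - 1)),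
    ← Real.rpow_mul hbj.le, ← Real.rpow_mul hbj.le]
  congr 2
  push_cast
  linarith

theorem indexSet_prodWeight_eq_empty {M : ℕ → ℝ} {α ε : ℝ} (hM : ∀ j, 1 ≤ M j) (hα : 0 ≤ α)
    (hε : 1 < ε) : indexSet (prodWeight M α) ε = ∅ := by
  refine Set.eq_empty_of_forall_notMem fun ν hν => ?_
  have h1 : ε ≤ (prodWeight M α ν)⁻¹ := hν
  have h2 := inv_le_one_of_one_le₀ (one_le_prodWeight hM hα ν)
  linarith

theorem zero_mem_indexSet_prodWeight {M : ℕ → ℝ} {α ε : ℝ} (hε : ε ≤ 1) :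
    0 ∈ indexSet (prodWeight M α) ε := by
  simpa [indexSet, prodWeight] using hε

end IndexSets

end SparseGrid

/-! ### Balancing the error against the number of points -/

theorem theorem6p15 {X : Type*} [NormedAddCommGroup X] [InnerProductSpace ℂ X] [CompleteSpace X]
    [TopologicalSpace.SeparableSpace X]
    (b : ℕ → ℝ) (hb : ∀ j, 0 < b j) (ξ δ : ℝ) (hξ : 0 < ξ) (hδ : 0 < δ)
    (p : ℝ) (hp0 : 0 < p) (hp1 : p < 4 / 5) (hbp : Summable fun j => b j ^ p)
    (u : (ℕ → ℝ) → X) (v : (N : ℕ) → (Fin N → ℝ) → X)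
    (hu : SparseGrid.HolomorphicWith b ξ δ u v)
    (r : ℕ) (τ K : ℝ) (hτ : 0 < τ)
    (hr : max 2 (5 - τ) < ((r : ℝ) - τ) * (p / (1 - p)) / 4) (hK : 0 < K) :
    ∃ C : ℝ, 0 < C ∧ ∀ n : ℕ, 1 ≤ n → ∃ ε : ℝ, 0 < ε ∧
      ∃ hfin : (SparseGrid.indexSet
          (SparseGrid.cWeight 2 K (SparseGrid.rhoSeq b p ξ r) r τ) ε).Finite,
        (SparseGrid.pts (SparseGrid.indexSet
          (SparseGrid.cWeight 2 K (SparseGrid.rhoSeq b p ξ r) r τ) ε)).encard ≤ (n : ℕ∞) ∧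
        ‖(∫ y, u y ∂SparseGrid.gaussInf) - SparseGrid.smolyakQuad hfin.toFinset v‖ ≤
          C * (n : ℝ) ^ (-2 / p + 5 / 2) := by
  open SparseGrid in
  have h1p : 0 < 1 - p := by linarith
  set s := p / (4 * (1 - p)) with hs
  have hs0 : 0 < s := by positivity
  have hs1 : s < 1 := by
    rw [hs, div_lt_one (by positivity)]
    linarith
  have hsp : 4 * s * (1 - p) = p := by
    rw [hs]
    field_simp
  obtain ⟨hα2, hατ⟩ : 2 < ((r : ℝ) - τ) * s ∧ 5 - τ < ((r : ℝ) - τ) * s := by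
    rw [← max_lt_iff]
    refine hr.trans_eq ?_
    rw [hs]
    field_simp
  have hα0 : 2 < (r : ℝ) - τ := by nlinarith
  have hr2 : 2 ≤ r := by
    have : (2 : ℝ) ≤ r := by linarith
    exact_mod_cast this
  have hBp : 0 < ∑' i, b i ^ p :=
    hbp.tsum_pos (fun j => (Real.rpow_pos_of_pos (hb j) p).le) 0 (Real.rpow_pos_of_pos (hb 0) p)
  rw [cWeight_two_eq_prodWeight]
  set κ := K * (ξ / (4 * √(r.factorial : ℝ) * (∑' i, b i ^ p) ^ (1 / p))) with hκ
  have hκ0 : 0 < κ := by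
    have := sqrt_factorial_pos r
    positivity
  obtain ⟨C₀, hC₀, hcoeff⟩ := hu.exists_coeff_bound hb hξ hδ.le hp0 (by linarith) hbp hr2 hκ0
  have hMs := summable_max_rpow_neg hb hbp hκ0 hs0.le hsp
  set M : ℕ → ℝ := fun j => max 1 (κ * b j ^ (p - 1)) ^ 4 with hMdef
  have hM : ∀ j, 1 ≤ M j := fun j => one_le_pow₀ (le_max_left _ _)
  obtain ⟨B₁, hB₁, hcard⟩ := exists_sum_card_Icc_le hM hs0 hMs hα2
  obtain ⟨B₂, hB₂, herr⟩ := hu.exists_error_bound hδ.le hM hr2 hC₀ hcoeff rfl (by linarith) hs1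
    hMs hατ
  have hB₁0 : 0 < B₁ := by linarith
  have hE : 2 / p - 5 / 2 = (1 - s) / (2 * s) := by
    rw [hs]
    field_simp
    ring
  set E := 2 / p - 5 / 2 with hEdef
  have hE0 : 0 < E := by
    have : 0 < 1 - s := by linarith
    rw [hE]
    positivity
  have hexp : -2 / p + 5 / 2 = -E := by rw [hEdef]; ring
  -- The first term serves `n ≥ B₁`. The second serves `n < B₁`, where the index set is empty and
  -- the error is the norm of the integral.
  refine ⟨δ * √B₂ * B₁ ^ E + ‖∫ y, u y ∂gaussInf‖ * B₁ ^ E + 1, by positivity, fun n hn => ?_⟩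
  have hn0 : (0 : ℝ) < n := by exact_mod_cast hn
  have hx : 0 < (n : ℝ) / B₁ := by positivity
  have hdiv : ((n : ℝ) / B₁) ^ (-E) = B₁ ^ E * (n : ℝ) ^ (-E) := by
    rw [Real.div_rpow hn0.le hB₁0.le, Real.rpow_neg hB₁0.le, div_inv_eq_mul, mul_comm]
  -- This `ε` solves `B₁ ε^{-s} = n`, so the bound for the number of points is exactly `n`.
  have hε0 : 0 < ((n : ℝ) / B₁) ^ (-(1 / s)) := by positivity
  have hcard' := hcard _ hε0
  rw [← Real.rpow_mul hx.le, show -(1 / s) * -s = 1 by field_simp, Real.rpow_one,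
    mul_div_cancel₀ _ hB₁0.ne'] at hcard'
  have hfin := finite_of_sum_card_Icc_le hcard'
  refine ⟨_, hε0, hfin, ?_, ?_⟩
  · have h1 := encard_pts_le hfin.toFinset
    rw [hfin.coe_toFinset] at h1
    refine h1.trans (Nat.cast_le.2 ?_)
    exact_mod_cast hcard' hfin.toFinset (by simp)
  rw [hexp, add_mul, add_mul, mul_assoc _ _ ((n : ℝ) ^ (-E)), mul_assoc _ _ ((n : ℝ) ^ (-E)),
    ← hdiv]
  have hrest : 0 ≤ 1 * (n : ℝ) ^ (-E) := by positivity
  rcases le_or_gt B₁ n with hnB | hnB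
  · have hε1 : ((n : ℝ) / B₁) ^ (-(1 / s)) ≤ 1 :=
      Real.rpow_le_one_of_one_le_of_nonpos ((one_le_div hB₁0).2 hnB) (by
        have : 0 < 1 / s := by positivity
        linarith)
    refine (herr _ hε0 hfin.toFinset (by
      rw [Set.Finite.mem_toFinset]
      exact zero_mem_indexSet_prodWeight hε1) hfin.coe_toFinset).trans ?_
    -- `√(ε^{1-s})` is the power `-(1-s)/(2s) = -E` of `n / B₁`.
    have h2 : √((((n : ℝ) / B₁) ^ (-(1 / s))) ^ (1 - s) * B₂) = √B₂ * ((n : ℝ) / B₁) ^ (-E) := by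
      rw [mul_comm, Real.sqrt_mul hB₂.le, Real.sqrt_eq_rpow (_ ^ (1 - s)), ← Real.rpow_mul hx.le,
        ← Real.rpow_mul hx.le, hE]
      congr 2
      field_simp
    rw [h2, ← mul_assoc]
    have : 0 ≤ ‖∫ y, u y ∂gaussInf‖ * ((n : ℝ) / B₁) ^ (-E) := by positivity
    linarith
  · have hε1 : 1 < ((n : ℝ) / B₁) ^ (-(1 / s)) :=
      Real.one_lt_rpow_of_pos_of_lt_one_of_neg hx ((div_lt_one hB₁0).2 hnB) (by
        have : 0 < 1 / s := by positivity
        linarith)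
    have h2 : hfin.toFinset = ∅ := by
      rw [Set.Finite.toFinset_eq_empty]
      exact indexSet_prodWeight_eq_empty hM (by linarith) hε1
    rw [h2, smolyakQuad, Finset.sum_empty, sub_zero]
    have h3 : 1 ≤ ((n : ℝ) / B₁) ^ (-E) :=
      (Real.one_lt_rpow_of_pos_of_lt_one_of_neg hx ((div_lt_one hB₁0).2 hnB) (by linarith)).le
    have h4 : 0 ≤ δ * √B₂ * ((n : ℝ) / B₁) ^ (-E) := by positivity
    have h5 := le_mul_of_one_le_right (norm_nonneg (∫ y, u y ∂gaussInf)) h3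
    linarith
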